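/- **Lemma 5.2 (extension of cohomology classes).** Let $m\ge 2$ be an integer, let $X$ be a (Hausdorff, second countable) complex manifold with complex structure $J$, and let $M$ be a closed Levi-flat real hypersurface of class $C^{m+1}$ in $X$; that is, $M$ is a closed subset and near each of its points $M$ is the zero set of a real-valued $C^{m+1}$ function $f$ such that, at the points of $M$, $df\neq 0$ and the restriction of $\partial\bar\partial f$ to the complex tangent space $T_M\cap JT_M$ of $M$ is zero. Let $T^{0,1}_M=T^{0,1}_X\cap(T_M\otimes\mathbb C)$, and let $\alpha$ be a $C^m$ $(0,1)$-form on $M$, that is, a $C^m$ section of $(T^{0,1}_M)^*$ over $M$, with $\bar\partial_b\alpha=0$. Here $\bar\partial_b$ of a function or of a $(0,1)$-form on $M$ is the restriction to $T^{0,1}_M$ of $\bar\partial$ of any local $C^1$ extension to $X$. Then there exist a $(0,1)$-form $\tilde\alpha$ of class $C^{m-1}$ on $X$ and a complex-valued function $H$ of class $C^m$ on $M$ such that the restriction of $\tilde\alpha$ to $T^{0,1}_M$ equals $\alpha+\bar\partial_b H$ and (a) $\bar\partial\tilde\alpha$ vanishes to order at least $m-2$ at the points of $M$; (b) for every point $P\in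 M$ there exist an open neighborhood $U$ of $P$ in $X$ and a complex-valued $C^m$ function $h$ on $U$ such that $\tilde\alpha-\bar\partial h$ vanishes to order at least $m-2$ at the points of $M\cap U$. Here a form vanishes to order at least $k$ at a point if all partial derivatives of order at most $k$ of its coefficients in local holomorphic coordinates vanish at that point. -/

import Mathlib

open scoped Manifold ContDiff Topology

noncomputable section

namespace CRGeom

section Linear

variable {E F : Type*} [NormedAddCommGroup E] [NormedSpace ℂ E]
  [NormedAddCommGroup F] [NormedSpace ℂ F]

/-- The complex linear part `v ↦ (L v - i L (i v)) / 2` of a real linear map. -/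
def linPart (L : E →L[ℝ] F) : E →L[ℂ] F where
  toFun v := (1 / 2 : ℂ) • (L v - Complex.I • L (Complex.I • v))
  map_add' v w := by
    simp only [smul_add, map_add]
    module
  map_smul' c v := by
    have key : ∀ w : E, L (c • w) = (c.re : ℂ) • L w + (c.im : ℂ) • L (Complex.I • w) := by
      intro w
      have h : c • w = c.re • w + c.im • (Complex.I • w) := by
        rw [← Complex.coe_smul c.re w, ← Complex.coe_smul c.im (Complex.I • w), smul_smul,
          ← add_smul, Complex.re_add_im]
      rw [h, map_add, map_smul, map_smul, Complex.coe_smul, Complex.coe_smul]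
    rw [smul_comm Complex.I c v, key v, key (Complex.I • v), smul_smul Complex.I Complex.I v,
      Complex.I_mul_I, neg_one_smul, map_neg, RingHom.id_apply]
    conv_rhs => rw [← Complex.re_add_im c]
    match_scalars
    · ring
    · linear_combination ((c.im : ℂ) / 2) * Complex.I_sq
  cont := by fun_prop

/-- The conjugate linear part `v ↦ (L v + i L (i v)) / 2` of a real linear map. -/
def conjPart (L : E →L[ℝ] F) : E →L⋆[ℂ] F where
  toFun v := (1 / 2 : ℂ) • (L v + Complex.I • L (Complex.I • v))
  map_add' v w := by
    simp only [smul_add, map_add]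
    module
  map_smul' c v := by
    have key : ∀ w : E, L (c • w) = (c.re : ℂ) • L w + (c.im : ℂ) • L (Complex.I • w) := by
      intro w
      have h : c • w = c.re • w + c.im • (Complex.I • w) := by
        rw [← Complex.coe_smul c.re w, ← Complex.coe_smul c.im (Complex.I • w), smul_smul,
          ← add_smul, Complex.re_add_im]
      rw [h, map_add, map_smul, map_smul, Complex.coe_smul, Complex.coe_smul]
    have hc : (starRingEnd ℂ) c = (c.re : ℂ) - (c.im : ℂ) * Complex.I := by
      apply Complex.ext <;> simp
    rw [smul_comm Complex.I c v, key v, key (Complex.I • v), smul_smul Complex.I Complex.I v,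
      Complex.I_mul_I, neg_one_smul, map_neg, hc]
    match_scalars
    · ring
    · linear_combination ((c.im : ℂ) / 2) * Complex.I_sq
  cont := by fun_prop

/-- `∂g` at `y`, for a map `g` between complex normed spaces: `∂g (v) = (Dg(v) - i Dg(iv)) / 2`. -/
def del (g : E → F) (y : E) : E →L[ℂ] F := linPart (fderiv ℝ g y)

/-- `∂̄g` at `y`: `∂̄g (v) = (Dg(v) + i Dg(iv)) / 2`. -/
def dbar (g : E → F) (y : E) : E →L⋆[ℂ] F := conjPart (fderiv ℝ g y)

/-- `∂̄` of a `(0,1)`-form `a` on (an open subset of) the vector space `E`, that is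
`∂̄a (v, w) = (∂̄_v a)(w) - (∂̄_w a)(v)`.  For `a = ∑ aₖ dz̄ₖ` these are the coefficients
`∂aₖ/∂z̄ⱼ - ∂aⱼ/∂z̄ₖ`. -/
def dbarForm (a : E → E →L⋆[ℂ] ℂ) (y : E) : E →L⋆[ℂ] E →L⋆[ℂ] ℂ :=
  dbar a y - (dbar a y).flip

/-- All derivatives of `g` of order `≤ k` vanish at `y` (order `0` being `g` itself). -/
def VanishesToOrder (k : ℕ) (g : E → F) (y : E) : Prop :=
  ∀ j ≤ k, iteratedFDeriv ℝ j g y = 0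

end Linear

section Manifold

variable (E : Type*) [NormedAddCommGroup E] [NormedSpace ℂ E]
  {X : Type*} [TopologicalSpace X] [ChartedSpace E X]

variable (X) in
/-- A `(0,1)`-form on the complex manifold `X` (no regularity): a conjugate linear functional on
each tangent space. -/
abbrev Form01 : Type _ := ∀ x : X, TangentSpace 𝓘(ℂ, E) x →L⋆[ℂ] ℂ

variable {E}

/-- The expression of a `(0,1)`-form in a holomorphic chart `φ`, that is its pull-back by `φ⁻¹`. -/
def Form01.inChart (a : Form01 E X) (φ : OpenPartialHomeomorph X E) (y : E) : E →L⋆[ℂ] ℂ :=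
  (a (φ.symm y)).comp (mfderiv 𝓘(ℂ, E) 𝓘(ℂ, E) φ.symm y)

/-- `a` is of class `C^k` on the open set `U`: its coefficients in all charts are `C^k`. -/
def Form01.IsCk (k : ℕ) (a : Form01 E X) (U : Set X) : Prop :=
  ∀ φ ∈ atlas E X, ContDiffOn ℝ k (a.inChart φ) (φ.target ∩ φ.symm ⁻¹' U)

/-- `a` vanishes to order at least `k` at `p`. -/
def Form01.VanishesAt (k : ℕ) (a : Form01 E X) (p : X) : Prop :=
  ∀ φ ∈ atlas E X, p ∈ φ.source → VanishesToOrder k (a.inChart φ) (φ p)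

/-- `∂̄a` vanishes to order at least `k` at `p`. -/
def Form01.DbarVanishesAt (k : ℕ) (a : Form01 E X) (p : X) : Prop :=
  ∀ φ ∈ atlas E X, p ∈ φ.source → VanishesToOrder k (dbarForm (a.inChart φ)) (φ p)

/-- The value of `∂̄a` at `p`, a form on the tangent space at `p` (which Mathlib identifies with
`E` through the preferred chart at `p`). -/
def Form01.dbarAt (a : Form01 E X) (p : X) (v w : TangentSpace 𝓘(ℂ, E) p) : ℂ :=
  dbarForm (E := E) (a.inChart (chartAt E p)) (chartAt E p p) v w

variable (E) in
/-- `∂̄h` for a complex-valued function `h` on `X`. -/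
def dbarFun (h : X → ℂ) : Form01 E X := fun x =>
  conjPart (E := E) (F := ℂ) (mfderiv 𝓘(ℝ, E) 𝓘(ℝ, ℂ) h x)

/-- `∂∂̄f (v, w̄)` at `p` for a real-valued function `f` on `X`; in coordinates this is
`∑ ∂²f/∂zⱼ∂z̄ₖ vⱼ w̄ₖ`. -/
def leviForm (f : X → ℝ) (p : X) (v w : TangentSpace 𝓘(ℂ, E) p) : ℂ :=
  del (E := E) (dbar (E := E) fun y => ((f ((chartAt E p).symm y) : ℝ) : ℂ)) (chartAt E p p) v w

variable (E) in
/-- `g` is a complex-valued function, of class `C^k` on the open set `U`, that agrees with `H` on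
`M ∩ U`. -/
def IsExtension (k : ℕ) {M : Set X} (H : M → ℂ) (U : Set X) (g : X → ℂ) : Prop :=
  IsOpen U ∧ ContMDiffOn 𝓘(ℝ, E) 𝓘(ℝ, ℂ) k g U ∧ ∀ q : M, (q : X) ∈ U → g q = H q

/-- `v` is tangent to `M` at `p`: it annihilates all `C^1` functions defined near `p` that vanish
on `M`.  For a hypersurface with local defining function `f` this is the kernel of `df`. -/
def IsTangent (M : Set X) (p : X) (v : TangentSpace 𝓘(ℂ, E) p) : Prop :=
  ∀ (U : Set X) (g : X → ℂ), p ∈ U → IsExtension E 1 (M := M) 0 U g →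
    mfderiv 𝓘(ℝ, E) 𝓘(ℝ, ℂ) g p v = 0

variable (E) in
/-- The complex tangent space `T_pM ∩ J T_pM` of `M`, the largest complex subspace of `T_pX` that
is tangent to `M`.  By `v ↦ (v + i J v) / 2` it is conjugate linearly isomorphic to
`T^{0,1}_{M,p}`, so that linear functionals on `T^{0,1}_{M,p}` are conjugate linear functionals on
this space. -/
def holTangent (M : Set X) (p : X) : Submodule ℂ (TangentSpace 𝓘(ℂ, E) p) where
  carrier := {v | ∀ c : ℂ, IsTangent M p (c • v)}
  add_mem' := by
    intro v w hv hw c U g hp hg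
    rw [smul_add]
    exact (map_add (mfderiv 𝓘(ℝ, E) 𝓘(ℝ, ℂ) g p) _ _).trans
      (by rw [hv c U g hp hg, hw c U g hp hg]; exact add_zero (0 : ℂ))
  zero_mem' := by
    intro c U g hp hg
    rw [smul_zero]
    exact map_zero (mfderiv 𝓘(ℝ, E) 𝓘(ℝ, ℂ) g p)
  smul_mem' := by
    intro c v hv d
    rw [smul_smul]
    exact hv (d * c)

variable (E) in
/-- A closed Levi-flat real hypersurface of class `C^k`: near each of its points it is the zero set
of a real-valued `C^k` function `f` with `df ≠ 0` on `M`, and `∂∂̄f` vanishes on the complex tangent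
spaces of `M`. -/
structure IsLeviFlatHypersurface (k : ℕ) (M : Set X) : Prop where
  isClosed : IsClosed M
  exists_defining : ∀ p ∈ M, ∃ (U : Set X) (f : X → ℝ), IsOpen U ∧ p ∈ U ∧
    ContMDiffOn 𝓘(ℝ, E) 𝓘(ℝ, ℝ) k f U ∧
    (∀ q ∈ U, q ∈ M ↔ f q = 0) ∧
    (∀ q ∈ M ∩ U, mfderiv 𝓘(ℝ, E) 𝓘(ℝ, ℝ) f q ≠ 0) ∧
    (∀ q ∈ M ∩ U, ∀ v ∈ holTangent E M q, ∀ w ∈ holTangent E M q, leviForm f q v w = 0)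

variable (E) in
/-- A `(0,1)`-form on `M` (no regularity): at each point of `M` an element of
`(T^{0,1}_{M,p})^*`. -/
abbrev CRForm01 (M : Set X) : Type _ := ∀ p : M, holTangent E M (p : X) →L⋆[ℂ] ℂ

/-- The restriction of a `(0,1)`-form on `X` to `T^{0,1}_M`. -/
def Form01.restrict (a : Form01 E X) (M : Set X) : CRForm01 E M := fun p =>
  (a p).comp (holTangent E M (p : X)).subtypeL

/-- `b` is a `(0,1)`-form, of class `C^k` on the open set `U`, whose restriction to `T^{0,1}_M`
agrees with `α` over `M ∩ U`. -/
def CRForm01.IsExtension (k : ℕ) {M : Set X} (α : CRForm01 E M) (U : Set X) (b : Form01 E X) :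
    Prop :=
  IsOpen U ∧ b.IsCk k U ∧ ∀ q : M, (q : X) ∈ U → b.restrict M q = α q

/-- A `(0,1)`-form on `M` is of class `C^k` if near each point it is the restriction of a `C^k`
form on an open subset of `X`. -/
def CRForm01.IsCk (k : ℕ) {M : Set X} (α : CRForm01 E M) : Prop :=
  ∀ p ∈ M, ∃ (U : Set X) (b : Form01 E X), p ∈ U ∧ α.IsExtension k U b

/-- `∂̄_b α = 0`: for each `C^1` extension `b` of `α` to an open subset of `X`, the form `∂̄b`
vanishes on `T^{0,1}_M` (its restriction to `T^{0,1}_M` is `∂̄_b α`, independently of `b`). -/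
def CRForm01.IsDbarBClosed {M : Set X} (α : CRForm01 E M) : Prop :=
  ∀ (U : Set X) (b : Form01 E X), α.IsExtension 1 U b →
    ∀ p ∈ M ∩ U, ∀ v ∈ holTangent E M p, ∀ w ∈ holTangent E M p, b.dbarAt p v w = 0

variable (E) in
/-- A function on `M` is of class `C^k` if near each point it is the restriction of a `C^k`
function on an open subset of `X`. -/
def IsCkOn (k : ℕ) {M : Set X} (H : M → ℂ) : Prop :=
  ∀ p ∈ M, ∃ (U : Set X) (g : X → ℂ), p ∈ U ∧ IsExtension E k H U g

open Classical in
variable (E) in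
/-- `∂̄_b H` for a function `H` on `M`: at `p` it is the restriction to `T^{0,1}_M` of `∂̄g`, where
`g` is any `C^1` extension of `H` to a neighbourhood of `p` in `X` (see `dbarB_eq`). -/
def dbarB {M : Set X} (H : M → ℂ) : CRForm01 E M := fun p =>
  if h : ∃ (g : X → ℂ) (U : Set X), (p : X) ∈ U ∧ IsExtension E 1 H U g then
    (dbarFun E h.choose).restrict M p
  else 0

/-- `∂̄_b H` does not depend on the extension. -/
theorem dbarB_eq {M : Set X} {H : M → ℂ} {U : Set X} {g : X → ℂ} (p : M) (hp : (p : X) ∈ U)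
    (hg : IsExtension E 1 H U g) : dbarB E H p = (dbarFun E g).restrict M p := by
  have h : ∃ (g : X → ℂ) (U : Set X), (p : X) ∈ U ∧ IsExtension E 1 H U g := ⟨g, U, hp, hg⟩
  rw [dbarB, dif_pos h]
  obtain ⟨V, hpV, hV, hsmooth, hagree⟩ := h.choose_spec
  obtain ⟨hU, hgs, hga⟩ := hg
  set g' := h.choose
  have hext : IsExtension E 1 (M := M) 0 (U ∩ V) (g' - g) := by
    refine ⟨hU.inter hV, ?_, ?_⟩
    · exact (hsmooth.mono Set.inter_subset_right).sub (hgs.mono Set.inter_subset_left)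
    · intro q hq
      simp [hagree q hq.2, hga q hq.1]
  have hd' : MDifferentiableAt 𝓘(ℝ, E) 𝓘(ℝ, ℂ) g' (p : X) :=
    ((hsmooth p hpV).contMDiffAt (hV.mem_nhds hpV)).mdifferentiableAt (by norm_num)
  have hd : MDifferentiableAt 𝓘(ℝ, E) 𝓘(ℝ, ℂ) g (p : X) :=
    ((hgs p hp).contMDiffAt (hU.mem_nhds hp)).mdifferentiableAt (by norm_num)
  have key : ∀ v : E, IsTangent M (p : X) v →
      (mfderiv 𝓘(ℝ, E) 𝓘(ℝ, ℂ) g' (p : X) : E →L[ℝ] ℂ) v =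
        (mfderiv 𝓘(ℝ, E) 𝓘(ℝ, ℂ) g (p : X) : E →L[ℝ] ℂ) v := by
    intro v hv
    have h0 := hv (U ∩ V) (g' - g) ⟨hp, hpV⟩ hext
    rw [mfderiv_sub hd' hd] at h0
    exact sub_eq_zero.mp h0
  refine ContinuousLinearMap.ext fun x => ?_
  obtain ⟨v, hv⟩ := x
  have h1 := key v (by simpa using hv 1)
  have h2 := key (Complex.I • v) (hv Complex.I)
  exact congrArg₂ (fun a b : ℂ => (1 / 2 : ℂ) • (a + Complex.I • b)) h1 h2

end Manifold

end CRGeom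

end

/-! The class of α need not be changed: the proof produces an extension of α itself and takes H = 0.
Write m = n + 1. Two mechanisms alternate, one local and one global.

Local solvability. Near a point of M the kernels of ∂r, for a defining function r, form a field of
complex subspaces of class C^m. Levi-flatness says exactly that this field is involutive along M, so
M is foliated by complex leaves, and `exists_leaf_coordinates` provides C^m coordinates (z, c) in
which the leaves of M are slices c = const, each embedded holomorphically in z. In them the equation
∂̄_b u = α becomes a ∂̄-system in z with parameter c. `exists_dbarAlong_eq` solves it by Cauchy
transforms, which lose no derivatives, so u is of class C^m on a neighbourhood in the ambient space
(`exists_dbar_eq_on_levi_flat`).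

Gluing. Let the u_x be local solutions whose ∂̄u_x agree to order < k along M, and let ρ_x be a
partition of unity. Then a = ∑ ρ_x ∂̄u_x restricts to α, and for any fixed w = u_z, since ∑ ρ_x = 1
and ∂̄² = 0, ∂̄a = ∑ ∂̄ρ_x ∧ (∂̄u_x - ∂̄w). Hence both ∂̄a and a - ∂̄w are flat to order < k on M
(`flatBelow_dbarForm_sum_smul_dbar`).

Raising the order. Put b = a - ∂̄u with u a local solution. It is flat to order < k, and so is ∂̄b =
∂̄a. The leading normal coefficient of b then annihilates the complex tangent space of M: for k = 0
because a and ∂̄u have the same restriction, for k > 0 because ∂̄b is flat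
(`pd_iterate_apply_eq_zero_of_dbarForm`). It is therefore a multiple of ∂̄r, and subtracting ∂̄ of a
function with leading term r^(k+1) w / (k+1)! makes b flat to order < k + 1
(`exists_dbar_sub_flat`). The coefficient w is only C^(n-k), but replacing it by its average at
scale r restores the lost derivatives: each factor r, through an integration by parts, buys one
(`exists_contDiff_pow_smul`). So the corrected solution is still C^(n+1), and gluing again gives a
better form.

Starting from the zero form at order 0 and iterating up to k = n, all derivatives of order at most n
- 1 = m - 2 vanish on M, and the local solutions are the functions h of (b). -/

namespace CRGeom

/-! ### Calculus of functions whose derivatives vanish below a given order at a point -/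

section Flat

universe u
variable {E F G : Type u} [NormedAddCommGroup E] [NormedSpace ℝ E]
  [NormedAddCommGroup F] [NormedSpace ℝ F] [NormedAddCommGroup G] [NormedSpace ℝ G]

theorem contDiffAt_clm_comp {E F G : Type*} [NormedAddCommGroup E] [NormedSpace ℝ E]
    [NormedAddCommGroup F] [NormedSpace ℝ F] [NormedAddCommGroup G] [NormedSpace ℝ G]
    {n : WithTop ℕ∞} {g : E → F} {y : E} (h : ContDiffAt ℝ n g y) (L : F →L[ℝ] G) :
    ContDiffAt ℝ n (fun x => L (g x)) y :=
  L.contDiff.contDiffAt.comp y h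

theorem hasFDerivAt_clm_comp {E F G : Type*} [NormedAddCommGroup E] [NormedSpace ℝ E]
    [NormedAddCommGroup F] [NormedSpace ℝ F] [NormedAddCommGroup G] [NormedSpace ℝ G]
    {g : E → F} {g' : E →L[ℝ] F} {y : E} (h : HasFDerivAt g g' y) (L : F →L[ℝ] G) :
    HasFDerivAt (fun x => L (g x)) (L.comp g') y :=
  L.hasFDerivAt.comp y h

/-- All derivatives of `g` of order `< k` vanish at `y`. -/
def FlatBelow (k : ℕ) (g : E → F) (y : E) : Prop :=
  ∀ j < k, iteratedFDeriv ℝ j g y = 0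

theorem flatBelow_zero (g : E → F) (y : E) : FlatBelow 0 g y := fun j hj => absurd hj j.not_lt_zero

theorem FlatBelow.mono {k l : ℕ} {g : E → F} {y : E} (h : FlatBelow l g y) (hkl : k ≤ l) :
    FlatBelow k g y := fun j hj => h j (hj.trans_le hkl)

/-- This recursion replaces iterated multilinear derivatives by `fderiv`, so that the closure
properties below follow by induction on the order. The induction changes the target from `F` to `E
→L[ℝ] F`, which is why all spaces share one universe. -/
theorem flatBelow_succ {k : ℕ} {g : E → F} {y : E} :
    FlatBelow (k + 1) g y ↔ g y = 0 ∧ FlatBelow k (fderiv ℝ g) y := by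
  have key : ∀ j, iteratedFDeriv ℝ (j + 1) g y = 0 ↔ iteratedFDeriv ℝ j (fderiv ℝ g) y = 0 := by
    intro j
    rw [← norm_eq_zero, ← norm_iteratedFDeriv_fderiv, norm_eq_zero]
  have key0 : iteratedFDeriv ℝ 0 g y = 0 ↔ g y = 0 := by
    rw [← norm_eq_zero, norm_iteratedFDeriv_zero, norm_eq_zero]
  constructor
  · intro h
    exact ⟨key0.1 (h 0 k.succ_pos), fun j hj => (key j).1 (h (j + 1) (by omega))⟩
  · rintro ⟨h0, h⟩ j hj
    cases j with
    | zero => exact key0.2 h0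
    | succ j => exact (key j).2 (h j (by omega))

theorem FlatBelow.congr {k : ℕ} {g₁ g₂ : E → F} {y : E} (h : FlatBelow k g₁ y)
    (he : g₁ =ᶠ[𝓝 y] g₂) : FlatBelow k g₂ y := fun j hj => by
  rw [← (he.iteratedFDeriv ℝ j).eq_of_nhds]
  exact h j hj

theorem FlatBelow.add {k n : ℕ} {g₁ g₂ : E → F} {y : E} (h₁ : FlatBelow k g₁ y)
    (h₂ : FlatBelow k g₂ y) (hk : k ≤ n + 1) (c₁ : ContDiffAt ℝ n g₁ y)
    (c₂ : ContDiffAt ℝ n g₂ y) : FlatBelow k (fun x => g₁ x + g₂ x) y := fun j hj => by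
  have hjn : (j : WithTop ℕ∞) ≤ n := by exact_mod_cast (by omega : j ≤ n)
  have := iteratedFDeriv_add_apply (c₁.of_le hjn) (c₂.of_le hjn)
  change iteratedFDeriv ℝ j (g₁ + g₂) y = 0
  rw [this, h₁ j hj, h₂ j hj, add_zero]

/-- By the product rule, every term of the derivative contains either the derivative of g, flat to
one order less, or g itself. -/
theorem FlatBelow.clm_apply {k n : ℕ} {A : E → F →L[ℝ] G} {g : E → F} {y : E}
    (h : FlatBelow k g y) (hk : k ≤ n + 1) (hA : ContDiffAt ℝ n A y) (hg : ContDiffAt ℝ n g y) :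
    FlatBelow k (fun x => A x (g x)) y := by
  induction k generalizing n F G A g with
  | zero => exact flatBelow_zero _ _
  | succ k ih =>
    obtain ⟨h0, h1⟩ := flatBelow_succ.1 h
    refine flatBelow_succ.2 ⟨by simp [h0], ?_⟩
    rcases Nat.eq_zero_or_pos k with rfl | hkp
    · exact flatBelow_zero _ _
    obtain ⟨n, rfl⟩ : ∃ n', n = n' + 1 := ⟨n - 1, by omega⟩
    have hle : ((n : ℕ) : WithTop ℕ∞) + 1 ≤ ((n + 1 : ℕ) : WithTop ℕ∞) := by norm_cast
    have hle' : ((n : ℕ) : WithTop ℕ∞) ≤ ((n + 1 : ℕ) : WithTop ℕ∞) := by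
      exact_mod_cast n.le_succ
    have hA' := hA.fderiv_right hle
    have hg' := hg.fderiv_right hle
    have e : (fun x => (ContinuousLinearMap.compL ℝ E F G (A x)) (fderiv ℝ g x)
        + (ContinuousLinearMap.flipₗᵢ ℝ E F G (fderiv ℝ A x)) (g x))
        =ᶠ[𝓝 y] fderiv ℝ (fun x => A x (g x)) := by
      have d1 : ∀ᶠ x in 𝓝 y, DifferentiableAt ℝ A x :=
        (hA.eventually (by simp)).mono fun x hx => hx.differentiableAt (by simp)
      have d2 : ∀ᶠ x in 𝓝 y, DifferentiableAt ℝ g x :=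
        (hg.eventually (by simp)).mono fun x hx => hx.differentiableAt (by simp)
      filter_upwards [d1, d2] with x hx1 hx2
      rw [fderiv_clm_apply hx1 hx2]
      rfl
    have cA1 : ContDiffAt ℝ n (fun x => ContinuousLinearMap.compL ℝ E F G (A x)) y :=
      contDiffAt_clm_comp (hA.of_le hle') (G := (E →L[ℝ] F) →L[ℝ] E →L[ℝ] G)
        (ContinuousLinearMap.compL ℝ E F G)
    have cA2 : ContDiffAt ℝ n (fun x => ContinuousLinearMap.flipₗᵢ ℝ E F G (fderiv ℝ A x)) y :=
      contDiffAt_clm_comp hA' (G := F →L[ℝ] E →L[ℝ] G)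
        (ContinuousLinearMap.flipₗᵢ ℝ E F G).toContinuousLinearEquiv.toContinuousLinearMap
    have f1 := ih (n := n) h1 (by omega) cA1 hg'
    have f2 := ih (n := n) (h.mono k.le_succ) (by omega) cA2 (hg.of_le hle')
    exact (f1.add f2 (n := n) (by omega) (cA1.clm_apply hg')
      (cA2.clm_apply (hg.of_le hle'))).congr e

/-- The chain rule writes the derivative as a smooth operator applied to Dg ∘ φ, to which the
induction on the order applies. -/
theorem FlatBelow.comp {k n : ℕ} {g : F → G} {φ : E → F} {y : E}
    (h : FlatBelow k g (φ y)) (hk : k ≤ n + 1) (hg : ContDiffAt ℝ n g (φ y))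
    (hφ : ContDiffAt ℝ n φ y) : FlatBelow k (fun x => g (φ x)) y := by
  induction k generalizing n G g with
  | zero => exact flatBelow_zero _ _
  | succ k ih =>
    obtain ⟨h0, h1⟩ := flatBelow_succ.1 h
    refine flatBelow_succ.2 ⟨h0, ?_⟩
    rcases Nat.eq_zero_or_pos k with rfl | hkp
    · exact flatBelow_zero _ _
    obtain ⟨n, rfl⟩ : ∃ n', n = n' + 1 := ⟨n - 1, by omega⟩
    have hle : ((n : ℕ) : WithTop ℕ∞) + 1 ≤ ((n + 1 : ℕ) : WithTop ℕ∞) := by norm_cast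
    have hle' : ((n : ℕ) : WithTop ℕ∞) ≤ ((n + 1 : ℕ) : WithTop ℕ∞) := by
      exact_mod_cast n.le_succ
    have hg' := hg.fderiv_right hle
    have hφ' := hφ.fderiv_right hle
    have e : (fun x => ((ContinuousLinearMap.compL ℝ E F G).flip (fderiv ℝ φ x))
        (fderiv ℝ g (φ x))) =ᶠ[𝓝 y] fderiv ℝ (fun x => g (φ x)) := by
      have d1 : ∀ᶠ x in 𝓝 y, DifferentiableAt ℝ g (φ x) :=
        hφ.continuousAt.eventually
          ((hg.eventually (by simp)).mono fun x hx => hx.differentiableAt (by simp))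
      have d2 : ∀ᶠ x in 𝓝 y, DifferentiableAt ℝ φ x :=
        (hφ.eventually (by simp)).mono fun x hx => hx.differentiableAt (by simp)
      filter_upwards [d1, d2] with x hx1 hx2
      exact (fderiv_fun_comp x hx1 hx2).symm
    have f1 := ih (n := n) h1 (by omega) hg' (hφ.of_le hle')
    have cA : ContDiffAt ℝ n (fun x => (ContinuousLinearMap.compL ℝ E F G).flip (fderiv ℝ φ x)) y :=
      contDiffAt_clm_comp hφ' (G := (F →L[ℝ] G) →L[ℝ] E →L[ℝ] G)
        (ContinuousLinearMap.compL ℝ E F G).flip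
    exact (f1.clm_apply (n := n) (by omega) cA (hg'.comp y (hφ.of_le hle'))).congr e

theorem FlatBelow.clm_comp {k n : ℕ} (L : F →L[ℝ] G) {g : E → F} {y : E}
    (h : FlatBelow k g y) (hk : k ≤ n + 1) (hg : ContDiffAt ℝ n g y) :
    FlatBelow k (fun x => L (g x)) y :=
  h.clm_apply hk (A := fun _ => L) contDiffAt_const hg

theorem FlatBelow.neg {k n : ℕ} {g : E → F} {y : E}
    (h : FlatBelow k g y) (hk : k ≤ n + 1) (hg : ContDiffAt ℝ n g y) :
    FlatBelow k (fun x => -g x) y :=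
  h.clm_comp (-ContinuousLinearMap.id ℝ F) hk hg

theorem FlatBelow.sub {k n : ℕ} {g₁ g₂ : E → F} {y : E} (h₁ : FlatBelow k g₁ y)
    (h₂ : FlatBelow k g₂ y) (hk : k ≤ n + 1) (c₁ : ContDiffAt ℝ n g₁ y)
    (c₂ : ContDiffAt ℝ n g₂ y) : FlatBelow k (fun x => g₁ x - g₂ x) y := by
  simpa only [sub_eq_add_neg] using h₁.add (h₂.neg hk c₂) hk c₁ c₂.neg

theorem flatBelow_zero_fun (k : ℕ) (y : E) : FlatBelow k (fun _ : E => (0 : F)) y := fun j _ => by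
  have : (fun _ : E => (0 : F)) = 0 := rfl
  rw [this, iteratedFDeriv_zero]; rfl

theorem FlatBelow.sum {ι : Type*} {k n : ℕ} (s : Finset ι) {g : ι → E → F} {y : E}
    (h : ∀ i ∈ s, FlatBelow k (g i) y) (hk : k ≤ n + 1) (c : ∀ i ∈ s, ContDiffAt ℝ n (g i) y) :
    FlatBelow k (fun x => ∑ i ∈ s, g i x) y := by
  classical
  induction s using Finset.induction_on with
  | empty => simpa using flatBelow_zero_fun k y
  | insert a s ha ih =>
    simp only [Finset.sum_insert ha]
    exact (h a (by simp)).add (ih (fun i hi => h i (by simp [hi])) fun i hi => c i (by simp [hi]))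
      hk (c a (by simp)) (ContDiffAt.sum fun i hi => c i (by simp [hi]))

end Flat

/-! ### Derivatives in a constant direction transverse to a hypersurface -/

section Normal

variable {E F G : Type*} [NormedAddCommGroup E] [NormedSpace ℝ E]
  [NormedAddCommGroup F] [NormedSpace ℝ F] [NormedAddCommGroup G] [NormedSpace ℝ G]

/-- The derivative of `g` in the constant direction `ν`. -/
noncomputable def pd (ν : E) (g : E → F) (y : E) : F := fderiv ℝ g y ν

theorem ContDiffAt.pd {n : ℕ} {ν : E} {g : E → F} {y : E}
    (hg : ContDiffAt ℝ (n + 1 : ℕ) g y) : ContDiffAt ℝ n (pd ν g) y :=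
  (hg.fderiv_right (m := n) (by norm_cast)).clm_apply contDiffAt_const

theorem ContDiffAt.pd_iterate {n i : ℕ} {ν : E} {g : E → F} {y : E}
    (hg : ContDiffAt ℝ (n + i : ℕ) g y) : ContDiffAt ℝ n ((CRGeom.pd ν)^[i] g) y := by
  induction i generalizing g with
  | zero => simpa using hg
  | succ i ih => exact ih (ContDiffAt.pd (n := n + i) hg)

theorem pd_congr {ν : E} {g₁ g₂ : E → F} {y : E} (h : g₁ =ᶠ[𝓝 y] g₂) :
    pd ν g₁ =ᶠ[𝓝 y] pd ν g₂ :=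
  (h.fderiv (𝕜 := ℝ)).mono fun x hx => by rw [pd, pd, hx]

theorem pd_iterate_congr {ν : E} {g₁ g₂ : E → F} {y : E} (i : ℕ) (h : g₁ =ᶠ[𝓝 y] g₂) :
    (pd ν)^[i] g₁ =ᶠ[𝓝 y] (pd ν)^[i] g₂ := by
  induction i generalizing g₁ g₂ with
  | zero => exact h
  | succ i ih => exact ih (pd_congr h)

theorem pd_clm {ν : E} (L : F →L[ℝ] G) {g : E → F} {y : E} (h : DifferentiableAt ℝ g y) :
    pd ν (fun x => L (g x)) y = L (pd ν g y) := by
  have := (L.hasFDerivAt.comp y h.hasFDerivAt).fderiv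
  change fderiv ℝ (L ∘ g) y ν = _
  rw [this]; rfl

theorem pd_iterate_clm {ν : E} (L : F →L[ℝ] G) {g : E → F} {y : E} (i : ℕ)
    (h : ContDiffAt ℝ i g y) :
    (pd ν)^[i] (fun x => L (g x)) y = L ((pd ν)^[i] g y) := by
  induction i generalizing g with
  | zero => rfl
  | succ i ih =>
    have e : pd ν (fun x => L (g x)) =ᶠ[𝓝 y] fun x => L (pd ν g x) :=
      (h.eventually (by simp)).mono fun x hx => pd_clm L (hx.differentiableAt (by simp))
    rw [Function.iterate_succ_apply, (pd_iterate_congr i e).eq_of_nhds,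
      ih (ContDiffAt.pd h), Function.iterate_succ_apply]

/-- This is the symmetry of the second derivative. -/
theorem pd_fderiv_comm {ν : E} {g : E → F} {y : E} (h : ContDiffAt ℝ 2 g y) :
    pd ν (fderiv ℝ g) y = fderiv ℝ (pd ν g) y := by
  have hd : DifferentiableAt ℝ (fderiv ℝ g) y :=
    (h.fderiv_right (m := 1) (by norm_num)).differentiableAt (by norm_num)
  have hsym : IsSymmSndFDerivAt ℝ g y := h.isSymmSndFDerivAt (by simp)
  ext v
  have : fderiv ℝ (pd ν g) y v = fderiv ℝ (fderiv ℝ g) y v ν := by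
    change fderiv ℝ (fun x => fderiv ℝ g x ν) y v = _
    rw [fderiv_clm_apply hd (differentiableAt_const ν)]
    simp
  rw [this, pd]
  exact hsym.eq ν v

theorem pd_iterate_fderiv_comm {ν : E} {g : E → F} {y : E} (i : ℕ)
    (h : ContDiffAt ℝ (i + 1 : ℕ) g y) :
    (pd ν)^[i] (fderiv ℝ g) y = fderiv ℝ ((pd ν)^[i] g) y := by
  induction i generalizing g with
  | zero => rfl
  | succ i ih =>
    have e : pd ν (fderiv ℝ g) =ᶠ[𝓝 y] fderiv ℝ (pd ν g) :=
      (h.eventually (by simp)).mono fun x hx =>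
        pd_fderiv_comm (hx.of_le (by exact_mod_cast (by omega : 2 ≤ i + 1 + 1)))
    rw [Function.iterate_succ_apply, (pd_iterate_congr i e).eq_of_nhds, ih (ContDiffAt.pd h),
      Function.iterate_succ_apply]

theorem pd_iterate_sub {ν : E} {g₁ g₂ : E → F} {y : E} (i : ℕ)
    (h₁ : ContDiffAt ℝ i g₁ y) (h₂ : ContDiffAt ℝ i g₂ y) :
    (pd ν)^[i] (fun x => g₁ x - g₂ x) y = (pd ν)^[i] g₁ y - (pd ν)^[i] g₂ y := by
  have h := pd_iterate_clm (ν := ν)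
    (ContinuousLinearMap.fst ℝ F F - ContinuousLinearMap.snd ℝ F F) i (h₁.prodMk h₂)
  have e1 := pd_iterate_clm (ν := ν) (ContinuousLinearMap.fst ℝ F F) i (h₁.prodMk h₂)
  have e2 := pd_iterate_clm (ν := ν) (ContinuousLinearMap.snd ℝ F F) i (h₁.prodMk h₂)
  exact h.trans (congrArg₂ (fun a b : F => a - b) e1.symm e2.symm)

/-- A `C^1` function vanishing on the zero set of a submersion has a derivative that annihilates
the kernel of the derivative of the submersion. -/
theorem fderiv_apply_eq_zero_of_zeroSet [CompleteSpace E] {f : E → ℝ} {g : E → F} {y : E}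
    (hf : ContDiffAt ℝ 1 f y) (hy : f y = 0) (hf' : fderiv ℝ f y ≠ 0) (hg : ContDiffAt ℝ 1 g y)
    (h : ∀ᶠ x in 𝓝 y, f x = 0 → g x = 0) {v : E} (hv : fderiv ℝ f y v = 0) :
    fderiv ℝ g y v = 0 := by
  by_contra hne
  obtain ⟨ℓ, hℓ⟩ := SeparatingDual.exists_eq_one (R := ℝ) hne
  have hgℓ : HasStrictFDerivAt (fun x => ℓ (g x)) (ℓ.comp (fderiv ℝ g y)) y :=
    ℓ.hasStrictFDerivAt.comp y (hg.hasStrictFDerivAt (by norm_num))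
  have hext : IsLocalExtrOn (fun x => ℓ (g x)) {x | f x = f y} y := by
    left
    have : ∀ᶠ x in 𝓝[{x | f x = f y}] y, ℓ (g y) ≤ ℓ (g x) := by
      rw [eventually_nhdsWithin_iff]
      filter_upwards [h] with x hx hx'
      rw [hx (by rw [← hy]; exact hx'), h.self_of_nhds hy]
    exact this
  obtain ⟨a, b, hab, hlin⟩ := hext.exists_multipliers_of_hasStrictFDerivAt_1d
    (hf.hasStrictFDerivAt (by norm_num)) hgℓ
  have h1 := DFunLike.congr_fun hlin v
  simp only [add_apply, smul_apply,
    ContinuousLinearMap.comp_apply, hv, smul_eq_mul, mul_zero, zero_add,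
    zero_apply, hℓ, mul_one] at h1
  subst h1
  have ha : a ≠ 0 := fun ha => hab (by simp [ha])
  apply hf'
  ext w
  have h2 := DFunLike.congr_fun hlin w
  simpa [ha] using h2

end Normal

/-! ### Flatness along a hypersurface is detected by normal derivatives -/

section NormalFlat

universe u
variable {E F : Type u} [NormedAddCommGroup E] [NormedSpace ℝ E]
  [NormedAddCommGroup F] [NormedSpace ℝ F]

/-- The normal derivatives of a function flat on a set vanish. -/
theorem FlatBelow.pd_iterate_eq_zero {k n : ℕ} {g : E → F} {y : E} (ν : E) (h : FlatBelow k g y)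
    (hk : k ≤ n + 1) (hg : ContDiffAt ℝ n g y) {i : ℕ} (hi : i < k) : (pd ν)^[i] g y = 0 := by
  induction i generalizing k n g with
  | zero =>
    obtain ⟨k, rfl⟩ : ∃ k', k = k' + 1 := ⟨k - 1, by omega⟩
    exact (flatBelow_succ.1 h).1
  | succ i ih =>
    obtain ⟨k, rfl⟩ : ∃ k', k = k' + 1 := ⟨k - 1, by omega⟩
    obtain ⟨n, rfl⟩ : ∃ n', n = n' + 1 := ⟨n - 1, by omega⟩
    have h1 := (flatBelow_succ.1 h).2
    have := h1.clm_comp (n := n) (ContinuousLinearMap.apply ℝ F ν) (by omega)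
      (hg.fderiv_right (by norm_cast))
    exact ih this (n := n) (by omega) (ContDiffAt.pd hg) (by omega)

/-- A function all of whose normal derivatives of order `< k` vanish on a hypersurface is flat. -/
theorem flatBelow_of_pd_iterate [CompleteSpace E] {f : E → ℝ} {ν : E} {Ω : Set E} (hΩ : IsOpen Ω)
    (hf : ∀ y ∈ Ω, ContDiffAt ℝ 1 f y) (hν : ∀ y ∈ Ω, fderiv ℝ f y ν ≠ 0)
    {k n : ℕ} (hk : k ≤ n + 1) {g : E → F} (hg : ∀ y ∈ Ω, ContDiffAt ℝ n g y)
    (h : ∀ y ∈ Ω, f y = 0 → ∀ i < k, (pd ν)^[i] g y = 0) :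
    ∀ y ∈ Ω, f y = 0 → FlatBelow k g y := by
  induction k generalizing n F g with
  | zero => exact fun y _ _ => flatBelow_zero _ _
  | succ k ih =>
    intro y hy hfy
    refine flatBelow_succ.2 ⟨h y hy hfy 0 k.succ_pos, ?_⟩
    rcases Nat.eq_zero_or_pos k with rfl | hkp
    · exact flatBelow_zero _ _
    obtain ⟨n, rfl⟩ : ∃ n', n = n' + 1 := ⟨n - 1, by omega⟩
    -- The i-th normal derivative of Dg is D of the i-th normal derivative of g. It vanishes on
    -- tangent vectors because that function is zero on the hypersurface, and on ν because the next
    -- normal derivative is.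
    refine ih (n := n) (by omega) (g := fderiv ℝ g)
      (fun x hx => (hg x hx).fderiv_right (by norm_cast)) ?_ y hy hfy
    intro x hx hfx i hi
    rw [pd_iterate_fderiv_comm i ((hg x hx).of_le (by exact_mod_cast (by omega : i + 1 ≤ n + 1)))]
    have c1 : ContDiffAt ℝ 1 ((pd ν)^[i] g) x := by
      have := ContDiffAt.pd_iterate (n := 1) (i := i) (ν := ν) (g := g) (y := x)
        ((hg x hx).of_le (by exact_mod_cast (by omega : 1 + i ≤ n + 1)))
      exact_mod_cast this
    have hf0 : fderiv ℝ f x ≠ 0 := fun h0 => hν x hx (by simp [h0])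
    have ht : ∀ v, fderiv ℝ f x v = 0 → fderiv ℝ ((pd ν)^[i] g) x v = 0 := fun v hv =>
      fderiv_apply_eq_zero_of_zeroSet (hf x hx) hfx hf0 c1
        ((hΩ.mem_nhds hx |> Filter.eventually_of_mem) fun z hz hfz => h z hz hfz i (by omega)) hv
    have hn : fderiv ℝ ((pd ν)^[i] g) x ν = 0 := by
      have := h x hx hfx (i + 1) (by omega)
      rwa [Function.iterate_succ_apply'] at this
    ext v
    have hdec : v = (v - (fderiv ℝ f x v / fderiv ℝ f x ν) • ν)
        + (fderiv ℝ f x v / fderiv ℝ f x ν) • ν := by simp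
    rw [hdec, map_add, map_smul, hn, smul_zero, add_zero, zero_apply]
    refine ht _ ?_
    rw [map_sub, map_smul, smul_eq_mul, div_mul_cancel₀ _ (hν x hx), sub_self]

end NormalFlat

/-! ### The leading normal derivative of a function f^k s -/

section Leading

variable {E F : Type*} [NormedAddCommGroup E] [NormedSpace ℝ E]
  [NormedAddCommGroup F] [NormedSpace ℝ F]

/-- A polynomial of degree `≤ k` that is `o(t^k)` at `0` vanishes. -/
theorem polynomial_coeff_eq_zero_of_isLittleO (k : ℕ) (c : ℕ → F)
    (h : (fun t : ℝ => ∑ i ∈ Finset.range (k + 1), t ^ i • c i) =o[𝓝 0] fun t : ℝ => t ^ k) :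
    ∀ i ≤ k, c i = 0 := by
  induction k generalizing c with
  | zero =>
    intro i hi
    obtain rfl : i = 0 := by omega
    simp only [zero_add, Finset.range_one, Finset.sum_singleton, pow_zero, one_smul] at h
    exact tendsto_nhds_unique tendsto_const_nhds (Asymptotics.isLittleO_one_iff ℝ |>.1 h)
  | succ k ih =>
    have h0 : c 0 = 0 := by
      have h1 : (fun t : ℝ => t ^ (k + 1)) =O[𝓝 0] fun _ : ℝ => (1 : ℝ) :=
        (Continuous.tendsto (by fun_prop) 0).isBigO_one ℝ
      have h2 := Asymptotics.isLittleO_one_iff ℝ |>.1 (h.trans_isBigO h1)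
      have h3 : Filter.Tendsto (fun t : ℝ => ∑ i ∈ Finset.range (k + 1 + 1), t ^ i • c i) (𝓝 0)
          (𝓝 (∑ i ∈ Finset.range (k + 1 + 1), (0 : ℝ) ^ i • c i)) :=
        Continuous.tendsto (by fun_prop) 0
      have h4 := tendsto_nhds_unique h2 h3
      rw [Finset.sum_eq_single 0 (by intro i _ hi; simp [hi]) (by simp)] at h4
      simpa using h4.symm
    have hstep : ∀ i ≤ k, c (i + 1) = 0 := by
      refine ih (fun i => c (i + 1)) ?_
      have e : (fun t : ℝ => ∑ i ∈ Finset.range (k + 1 + 1), t ^ i • c i)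
          = fun t : ℝ => t • ∑ i ∈ Finset.range (k + 1), t ^ i • c (i + 1) := by
        funext t
        rw [Finset.sum_range_succ', h0, Finset.smul_sum]
        simp [pow_succ', mul_smul]
      rw [e] at h
      have hc : Continuous fun t : ℝ => ∑ i ∈ Finset.range (k + 1), t ^ i • c (i + 1) := by
        fun_prop
      have hne : (fun t : ℝ => ∑ i ∈ Finset.range (k + 1), t ^ i • c (i + 1))
          =o[𝓝[≠] 0] fun t : ℝ => t ^ k := by
        rw [Asymptotics.isLittleO_iff] at h ⊢
        intro C hC
        filter_upwards [nhdsWithin_le_nhds (h hC), self_mem_nhdsWithin] with t ht ht0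
        have ht0' : 0 < ‖t‖ := norm_pos_iff.2 ht0
        rw [norm_smul, pow_succ', norm_mul] at ht
        rw [mul_left_comm] at ht
        exact le_of_mul_le_mul_left ht ht0'
      -- Division by t gives the estimate only on a punctured neighbourhood; continuity supplies the
      -- value at 0.
      rw [← nhdsNE_sup_pure, Asymptotics.isLittleO_sup]
      refine ⟨hne, ?_⟩
      rw [Asymptotics.isLittleO_pure]
      rcases Nat.eq_zero_or_pos k with rfl | hk
      · have h1 : Filter.Tendsto (fun t : ℝ => ∑ i ∈ Finset.range (0 + 1), t ^ i • c (i + 1))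
            (𝓝[≠] 0) (𝓝 0) := by
          simpa [Asymptotics.isLittleO_one_iff] using hne
        exact tendsto_nhds_unique (hc.continuousAt.tendsto.mono_left nhdsWithin_le_nhds) h1
      · have h1 : Filter.Tendsto (fun t : ℝ => ∑ i ∈ Finset.range (k + 1), t ^ i • c (i + 1))
            (𝓝[≠] 0) (𝓝 0) := by
          refine hne.isBigO.trans_tendsto ?_
          have : Filter.Tendsto (fun t : ℝ => t ^ k) (𝓝 0) (𝓝 (0 ^ k)) :=
            Continuous.tendsto (by fun_prop) 0
          rw [zero_pow hk.ne'] at this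
          exact this.mono_left nhdsWithin_le_nhds
        exact tendsto_nhds_unique (hc.continuousAt.tendsto.mono_left nhdsWithin_le_nhds) h1
    intro i hi
    cases i with
    | zero => exact h0
    | succ i => exact hstep i (by omega)

/-- The Taylor polynomial of h and t^k σ(0) differ by o(t^k), so their coefficients agree. Only
continuity of σ is assumed, because the averaged coefficient to which this is applied has no further
guaranteed regularity. -/
theorem iteratedDeriv_of_eq_pow_smul {k : ℕ} {h σ : ℝ → F} (hh : ContDiffAt ℝ k h 0)
    (hσ : ContinuousAt σ 0) (e : h =ᶠ[𝓝 0] fun t => t ^ k • σ t) :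
    (∀ i < k, iteratedDeriv i h 0 = 0) ∧ iteratedDeriv k h 0 = (k.factorial : ℝ) • σ 0 := by
  obtain ⟨u, hu, hcu⟩ := hh.contDiffOn le_rfl (by simp)
  obtain ⟨ε, hε, hball⟩ := Metric.mem_nhds_iff.1 (by simpa using hu)
  set s := Metric.ball (0 : ℝ) ε
  have hso : IsOpen s := Metric.isOpen_ball
  have h0s : (0 : ℝ) ∈ s := Metric.mem_ball_self hε
  have hT := taylor_isLittleO (convex_ball (0 : ℝ) ε) h0s (hcu.mono (hball.trans (by simp)))
  rw [hso.nhdsWithin_eq h0s] at hT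
  have hσo : (fun t : ℝ => t ^ k • (σ t - σ 0)) =o[𝓝 0] fun t : ℝ => t ^ k := by
    have h1 : (fun t => σ t - σ 0) =o[𝓝 0] fun _ : ℝ => (1 : ℝ) := by
      rw [Asymptotics.isLittleO_one_iff]
      exact tendsto_sub_nhds_zero_iff.2 hσ
    simpa using (Asymptotics.isBigO_refl (fun t : ℝ => t ^ k) (𝓝 0)).smul_isLittleO h1
  have key := polynomial_coeff_eq_zero_of_isLittleO k
    (fun i => ((i.factorial : ℝ)⁻¹ • iteratedDeriv i h 0) - if i = k then σ 0 else 0) (by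
      have h2 : (fun t : ℝ => t ^ k • (σ t - σ 0) - (h t - taylorWithinEval h k s 0 t))
          =o[𝓝 0] fun t : ℝ => t ^ k := hσo.sub (by simpa using hT)
      refine h2.congr' ?_ Filter.EventuallyEq.rfl
      filter_upwards [e] with t ht
      rw [ht, taylor_within_apply]
      simp only [smul_sub, Finset.sum_sub_distrib]
      have e1 : ∑ i ∈ Finset.range (k + 1), t ^ i • (if i = k then σ 0 else 0) = t ^ k • σ 0 := by
        rw [Finset.sum_eq_single k (by intro i _ hi; simp [hi]) (by simp)]
        simp
      rw [e1]
      have e2 : ∑ i ∈ Finset.range (k + 1), (((i.factorial : ℝ)⁻¹ * (t - 0) ^ i) •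
          iteratedDerivWithin i h s 0) =
          ∑ i ∈ Finset.range (k + 1), t ^ i • (i.factorial : ℝ)⁻¹ • iteratedDeriv i h 0 := by
        refine Finset.sum_congr rfl fun i _ => ?_
        rw [iteratedDerivWithin_of_isOpen hso h0s, sub_zero, smul_smul, mul_comm]
      rw [e2]
      abel)
  have hfac : ∀ i : ℕ, (i.factorial : ℝ) ≠ 0 := fun i => by exact_mod_cast i.factorial_ne_zero
  constructor
  · intro i hi
    have := key i hi.le
    simp only [hi.ne, if_false, sub_zero] at this
    simpa [hfac i] using this
  · have := key k le_rfl
    simp only [if_true, sub_eq_zero] at this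
    rw [← this, smul_smul, mul_inv_cancel₀ (hfac k), one_smul]

theorem iteratedDeriv_line_eq_pd_iterate {k : ℕ} {g : E → F} {y ν : E}
    (hg : ContDiffAt ℝ k g y) :
    iteratedDeriv k (fun t : ℝ => g (y + t • ν)) =ᶠ[𝓝 0] fun t => (pd ν)^[k] g (y + t • ν) := by
  induction k generalizing g with
  | zero => exact Filter.Eventually.of_forall fun t => by simp
  | succ k ih =>
    have hc : Filter.Tendsto (fun t : ℝ => y + t • ν) (𝓝 0) (𝓝 y) := by
      have : Continuous fun t : ℝ => y + t • ν := by fun_prop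
      simpa using this.tendsto 0
    have hd : deriv (fun t : ℝ => g (y + t • ν)) =ᶠ[𝓝 0] fun t => pd ν g (y + t • ν) := by
      filter_upwards [hc.eventually (hg.eventually (by simp))] with t ht
      have h1 : HasDerivAt (fun t : ℝ => y + t • ν) ν t := by
        simpa using ((hasDerivAt_id t).smul_const ν).const_add y
      exact ((ht.differentiableAt (by simp)).hasFDerivAt.comp_hasDerivAt t h1).deriv
    rw [iteratedDeriv_succ']
    have h2 := ih (ContDiffAt.pd (ν := ν) hg)
    have h3 := hd.iteratedDeriv k
    exact h3.trans h2

/-- The normal derivatives, on the zero set of `f`, of a function of the form `f ^ k • s`. -/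
theorem pd_iterate_of_eq_pow_smul {k : ℕ} {g s : E → F} {f : E → ℝ} {y : E} (ν : E)
    (hg : ContDiffAt ℝ k g y) (hf : DifferentiableAt ℝ f y) (hfy : f y = 0)
    (hs : ContinuousAt s y) (h : g =ᶠ[𝓝 y] fun x => f x ^ k • s x) :
    (∀ i < k, (pd ν)^[i] g y = 0) ∧
      (pd ν)^[k] g y = ((k.factorial : ℝ) * fderiv ℝ f y ν ^ k) • s y := by
  have hline : Continuous fun t : ℝ => y + t • ν := by fun_prop
  have hc : Filter.Tendsto (fun t : ℝ => y + t • ν) (𝓝 0) (𝓝 y) := by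
    simpa using hline.tendsto 0
  have hder : HasDerivAt (fun t : ℝ => f (y + t • ν)) (fderiv ℝ f y ν) 0 := by
    have h1 : HasDerivAt (fun t : ℝ => y + t • ν) ν 0 := by
      simpa using ((hasDerivAt_id (0 : ℝ)).smul_const ν).const_add y
    have h2 : HasFDerivAt f (fderiv ℝ f y) (y + (0 : ℝ) • ν) := by simpa using hf.hasFDerivAt
    exact h2.comp_hasDerivAt 0 h1
  -- On the line through y one has f(y + tν) = t κ(t) with κ continuous and κ(0) = Df(ν), so g takes
  -- the form t^k (κ^k s).
  set κ : ℝ → ℝ := dslope (fun t : ℝ => f (y + t • ν)) 0 with hκ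
  have hκc : ContinuousAt κ 0 := continuousAt_dslope_same.2 hder.differentiableAt
  have hκ0 : κ 0 = fderiv ℝ f y ν := by rw [hκ, dslope_same, hder.deriv]
  have hfκ : ∀ t, f (y + t • ν) = t * κ t := by
    intro t
    have := sub_smul_dslope (fun t : ℝ => f (y + t • ν)) 0 t
    simpa [hfy] using this.symm
  have hg' : ContDiffAt ℝ k (fun t : ℝ => g (y + t • ν)) 0 := by
    have : ContDiffAt ℝ k g (y + (0 : ℝ) • ν) := by simpa using hg
    exact this.comp (0 : ℝ) (by fun_prop)
  have hs' : ContinuousAt (fun t : ℝ => κ t ^ k • s (y + t • ν)) 0 := by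
    refine (hκc.pow k).smul ?_
    have : ContinuousAt s (y + (0 : ℝ) • ν) := by simpa using hs
    exact ContinuousAt.comp' (f := fun t : ℝ => y + t • ν) this hline.continuousAt
  obtain ⟨h1, h2⟩ := iteratedDeriv_of_eq_pow_smul hg' hs' (by
    filter_upwards [hc.eventually h] with t ht
    rw [ht, hfκ, mul_pow, mul_smul])
  have hi : ∀ i ≤ k, iteratedDeriv i (fun t : ℝ => g (y + t • ν)) 0 = (pd ν)^[i] g y := by
    intro i hi
    have := (iteratedDeriv_line_eq_pd_iterate (ν := ν)
      (hg.of_le (by exact_mod_cast hi : (i : WithTop ℕ∞) ≤ k))).eq_of_nhds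
    simpa using this
  refine ⟨fun i hik => by rw [← hi i hik.le, h1 i hik], ?_⟩
  rw [← hi k le_rfl, h2, hκ0, zero_smul, add_zero, smul_smul]

end Leading

/-! ### The operators ∂ and ∂̄ on a vector space, and holomorphic changes of variable -/

section Complex

variable {E F G : Type*} [NormedAddCommGroup E] [NormedSpace ℂ E]
  [NormedAddCommGroup F] [NormedSpace ℂ F] [NormedAddCommGroup G] [NormedSpace ℂ G]

theorem conjPart_apply (L : E →L[ℝ] F) (v : E) :
    conjPart L v = (1 / 2 : ℂ) • (L v + Complex.I • L (Complex.I • v)) := rfl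

theorem linPart_apply (L : E →L[ℝ] F) (v : E) :
    linPart L v = (1 / 2 : ℂ) • (L v - Complex.I • L (Complex.I • v)) := rfl

theorem conjPart_add (L L' : E →L[ℝ] F) : conjPart (L + L') = conjPart L + conjPart L' := by
  ext v
  simp only [conjPart_apply, add_apply, smul_add]
  abel

theorem norm_conjPart_le (L : E →L[ℝ] F) : ‖conjPart L‖ ≤ ‖L‖ := by
  refine ContinuousLinearMap.opNorm_le_bound _ (by positivity) fun v => ?_
  change ‖(1 / 2 : ℂ) • (L v + Complex.I • L (Complex.I • v))‖ ≤ _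
  rw [norm_smul]
  have h1 := L.le_opNorm v
  have h2 := L.le_opNorm (Complex.I • v)
  have h3 := norm_add_le (L v) (Complex.I • L (Complex.I • v))
  rw [norm_smul, Complex.norm_I, one_mul] at h2 h3
  have : ‖(1 / 2 : ℂ)‖ = 1 / 2 := by norm_num
  rw [this]
  linarith

theorem conjPart_smul (c : ℝ) (L : E →L[ℝ] F) : conjPart (c • L) = c • conjPart L := by
  ext v
  simp only [conjPart_apply, smul_apply, ← Complex.coe_smul]
  module

/-- `conjPart` as a continuous real linear map. -/
noncomputable def conjPartL : (E →L[ℝ] F) →L[ℝ] (E →L⋆[ℂ] F) :=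
  LinearMap.mkContinuous
    { toFun := conjPart
      map_add' := conjPart_add
      map_smul' := conjPart_smul } 1 (fun L => by simpa using norm_conjPart_le L)

theorem conjPartL_apply (L : E →L[ℝ] F) : conjPartL L = conjPart L := rfl

theorem dbar_eq (g : E → F) : dbar g = fun y => conjPartL (fderiv ℝ g y) := rfl

theorem dbar_apply (g : E → F) (y v : E) :
    dbar g y v = (1 / 2 : ℂ) • (fderiv ℝ g y v + Complex.I • fderiv ℝ g y (Complex.I • v)) := rfl

theorem ContDiffAt.dbar {n : ℕ} {g : E → F} {y : E} (h : ContDiffAt ℝ (n + 1 : ℕ) g y) :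
    ContDiffAt ℝ n (dbar g) y :=
  contDiffAt_clm_comp (h.fderiv_right (m := n) (by norm_cast)) conjPartL

theorem dbar_congr {g₁ g₂ : E → F} {y : E} (h : g₁ =ᶠ[𝓝 y] g₂) : dbar g₁ =ᶠ[𝓝 y] dbar g₂ :=
  (h.fderiv (𝕜 := ℝ)).mono fun x hx => by rw [CRGeom.dbar, CRGeom.dbar, hx]

/-- `∂̄` of a form is a continuous linear function of the derivative of its coefficients. -/
noncomputable def antisymmL : (E →L[ℝ] (E →L⋆[ℂ] ℂ)) →L[ℝ] (E →L⋆[ℂ] E →L⋆[ℂ] ℂ) where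
  toFun L := conjPart L - (conjPart L).flip
  map_add' L L' := by
    rw [conjPart_add, ContinuousLinearMap.flip_add]
    abel
  map_smul' c L := by
    rw [conjPart_smul, RingHom.id_apply]
    refine ContinuousLinearMap.ext fun v => ContinuousLinearMap.ext fun w => ?_
    exact (smul_sub c (conjPart L v w) (conjPart L w v)).symm
  cont := by
    have h1 : Continuous fun L : E →L[ℝ] (E →L⋆[ℂ] ℂ) => conjPart L := conjPartL.continuous
    exact h1.sub ((ContinuousLinearMap.flipₗᵢ' E E ℂ (starRingEnd ℂ)
      (starRingEnd ℂ)).continuous.comp h1)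

theorem dbarForm_eq (a : E → E →L⋆[ℂ] ℂ) : dbarForm a = fun y => antisymmL (fderiv ℝ a y) := rfl

theorem dbarForm_apply (a : E → E →L⋆[ℂ] ℂ) (y v w : E) :
    dbarForm a y v w = (1 / 2 : ℂ) • (fderiv ℝ a y v w + Complex.I • fderiv ℝ a y (Complex.I • v) w)
      - (1 / 2 : ℂ) • (fderiv ℝ a y w v + Complex.I • fderiv ℝ a y (Complex.I • w) v) := rfl

theorem ContDiffAt.dbarForm {n : ℕ} {a : E → E →L⋆[ℂ] ℂ} {y : E}
    (h : ContDiffAt ℝ (n + 1 : ℕ) a y) : ContDiffAt ℝ n (dbarForm a) y :=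
  contDiffAt_clm_comp (G := E →L⋆[ℂ] E →L⋆[ℂ] ℂ) (h.fderiv_right (m := n) (by norm_cast)) antisymmL

theorem dbarForm_congr {a₁ a₂ : E → E →L⋆[ℂ] ℂ} {y : E} (h : a₁ =ᶠ[𝓝 y] a₂) :
    dbarForm a₁ =ᶠ[𝓝 y] dbarForm a₂ := by
  filter_upwards [h.fderiv (𝕜 := ℝ)] with x hx
  change antisymmL _ = antisymmL _
  rw [hx]

theorem fderiv_dbar_apply {u : E → F} {y : E} (h : ContDiffAt ℝ 2 u y) (v w : E) :
    fderiv ℝ (dbar u) y v w = (1 / 2 : ℂ) • (fderiv ℝ (fderiv ℝ u) y v w +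
      Complex.I • fderiv ℝ (fderiv ℝ u) y v (Complex.I • w)) := by
  have hd : DifferentiableAt ℝ (fderiv ℝ u) y :=
    (h.fderiv_right (m := 1) (by norm_num)).differentiableAt (by norm_num)
  have h1 : HasFDerivAt (dbar u) (conjPartL.comp (fderiv ℝ (fderiv ℝ u) y)) y :=
    hasFDerivAt_clm_comp (G := E →L⋆[ℂ] F) hd.hasFDerivAt conjPartL
  rw [h1.fderiv]; rfl

/-- The identity ∂̄² = 0: antisymmetrisation kills the symmetric second derivative. -/
theorem dbarForm_dbar {u : E → ℂ} {y : E} (h : ContDiffAt ℝ 2 u y) : dbarForm (dbar u) y = 0 := by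
  have hsym : IsSymmSndFDerivAt ℝ u y := h.isSymmSndFDerivAt (by simp)
  ext v w
  rw [dbarForm_apply]
  simp only [fderiv_dbar_apply h]
  rw [hsym.eq v w, hsym.eq v (Complex.I • w), hsym.eq (Complex.I • v) w,
    hsym.eq (Complex.I • v) (Complex.I • w)]
  simp only [zero_apply, smul_eq_mul]
  ring

/-- The derivative of a map is complex linear. -/
def IsHolAt (φ : E → F) (x : E) : Prop :=
  ∀ v, fderiv ℝ φ x (Complex.I • v) = Complex.I • fderiv ℝ φ x v

/-- Obtained by differentiating Dφ(iw) = i Dφ(w), which holds on a whole neighbourhood. With the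
symmetric counterpart below, D²φ is complex bilinear. -/
theorem snd_fderiv_I {φ : E → F} {y : E} (hφ : ContDiffAt ℝ 2 φ y)
    (hh : ∀ᶠ x in 𝓝 y, IsHolAt φ x) (v w : E) :
    fderiv ℝ (fderiv ℝ φ) y v (Complex.I • w) = Complex.I • fderiv ℝ (fderiv ℝ φ) y v w := by
  have hd : DifferentiableAt ℝ (fderiv ℝ φ) y :=
    (hφ.fderiv_right (m := 1) (by norm_num)).differentiableAt (by norm_num)
  have e : (fun x => fderiv ℝ φ x (Complex.I • w)) =ᶠ[𝓝 y] fun x => Complex.I • fderiv ℝ φ x w :=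
    hh.mono fun x hx => hx w
  have h1 : ∀ w, fderiv ℝ (fun x => fderiv ℝ φ x w) y v = fderiv ℝ (fderiv ℝ φ) y v w := by
    intro w
    rw [fderiv_clm_apply hd (differentiableAt_const w)]
    simp
  have h2 : DifferentiableAt ℝ (fun x => fderiv ℝ φ x w) y :=
    hd.clm_apply (differentiableAt_const w)
  rw [← h1, e.fderiv_eq, fderiv_fun_const_smul h2, smul_apply, h1]

theorem snd_fderiv_I_left {φ : E → F} {y : E} (hφ : ContDiffAt ℝ 2 φ y)
    (hh : ∀ᶠ x in 𝓝 y, IsHolAt φ x) (v w : E) :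
    fderiv ℝ (fderiv ℝ φ) y (Complex.I • v) w = Complex.I • fderiv ℝ (fderiv ℝ φ) y v w := by
  have hsym : IsSymmSndFDerivAt ℝ φ y := hφ.isSymmSndFDerivAt (by simp)
  rw [hsym.eq (Complex.I • v) w, snd_fderiv_I hφ hh, hsym.eq w v]

/-- The derivative of the coefficients of the pull-back of a form. -/
theorem fderiv_pullback {φ : E → F} {y : E} {b : F → F →L⋆[ℂ] ℂ} {a : E → E →L⋆[ℂ] ℂ}
    (hφ : ContDiffAt ℝ 2 φ y) (hb : DifferentiableAt ℝ b (φ y)) (ha : DifferentiableAt ℝ a y)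
    (h : ∀ᶠ x in 𝓝 y, ∀ w, a x w = b (φ x) (fderiv ℝ φ x w)) (v w : E) :
    fderiv ℝ a y v w = fderiv ℝ b (φ y) (fderiv ℝ φ y v) (fderiv ℝ φ y w)
      + b (φ y) (fderiv ℝ (fderiv ℝ φ) y v w) := by
  have hd : DifferentiableAt ℝ (fderiv ℝ φ) y :=
    (hφ.fderiv_right (m := 1) (by norm_num)).differentiableAt (by norm_num)
  have hφd : DifferentiableAt ℝ φ y := hφ.differentiableAt (by norm_num)
  let B : (F →L⋆[ℂ] ℂ) →L[ℝ] F →L[ℝ] ℂ :=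
    LinearMap.mkContinuous₂
      (LinearMap.mk₂ ℝ (fun (l : F →L⋆[ℂ] ℂ) (w : F) => l w) (fun _ _ _ => rfl)
        (fun _ _ _ => rfl) (fun l _ _ => map_add l _ _) (fun c l w => by
          rw [← Complex.coe_smul, map_smulₛₗ, Complex.conj_ofReal, Complex.coe_smul])) 1
      (fun l w => by simpa using l.le_opNorm w)
  let ev : E → ((E →L⋆[ℂ] ℂ) →L[ℝ] ℂ) := fun w =>
    LinearMap.mkContinuous
      { toFun := fun l => l w, map_add' := fun _ _ => rfl, map_smul' := fun _ _ => rfl } ‖w‖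
      (fun l => by simpa [mul_comm] using l.le_opNorm w)
  have e1 : fderiv ℝ (fun x => a x w) y v = fderiv ℝ a y v w := by
    have := ((ev w).hasFDerivAt.comp y ha.hasFDerivAt).fderiv (f := fun x => a x w)
    rw [this]; rfl
  have e2 : (fun x => a x w) =ᶠ[𝓝 y] fun x => B (b (φ x)) (fderiv ℝ φ x w) :=
    h.mono fun x hx => hx w
  have hbφ : HasFDerivAt (fun x => b (φ x)) ((fderiv ℝ b (φ y)).comp (fderiv ℝ φ y)) y :=
    hb.hasFDerivAt.comp y hφd.hasFDerivAt
  have hw : HasFDerivAt (fun x => fderiv ℝ φ x w) ((fderiv ℝ (fderiv ℝ φ) y).flip w) y :=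
    ((ContinuousLinearMap.apply ℝ F w).hasFDerivAt.comp y hd.hasFDerivAt)
  have := (B.hasFDerivAt_of_bilinear hbφ hw).fderiv
  rw [← e1, e2.fderiv_eq, this]
  simp only [ContinuousLinearMap.precompR_apply, ContinuousLinearMap.precompL_apply, add_apply]
  rw [add_comm]
  rfl

/-- `∂̄` commutes with holomorphic pull-backs. -/
theorem dbarForm_pullback {φ : E → F} {y : E} {b : F → F →L⋆[ℂ] ℂ} {a : E → E →L⋆[ℂ] ℂ}
    (hφ : ContDiffAt ℝ 2 φ y) (hh : ∀ᶠ x in 𝓝 y, IsHolAt φ x)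
    (hb : DifferentiableAt ℝ b (φ y)) (ha : DifferentiableAt ℝ a y)
    (h : ∀ᶠ x in 𝓝 y, ∀ w, a x w = b (φ x) (fderiv ℝ φ x w)) (v w : E) :
    dbarForm a y v w = dbarForm b (φ y) (fderiv ℝ φ y v) (fderiv ℝ φ y w) := by
  have hsym : IsSymmSndFDerivAt ℝ φ y := hφ.isSymmSndFDerivAt (by simp)
  simp only [dbarForm_apply, fderiv_pullback hφ hb ha h]
  -- Since b is conjugate linear and D²φ complex bilinear, the second-order contribution to the
  -- ∂̄-derivative is b(D²φ(v, w)). It is symmetric and cancels in the antisymmetrisation.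
  rw [snd_fderiv_I_left hφ hh, snd_fderiv_I_left hφ hh, hsym.eq v w, hh.self_of_nhds v,
    hh.self_of_nhds w]
  simp only [smul_eq_mul, map_smulₛₗ]
  ring

/-- The Levi form is invariant under holomorphic maps. -/
theorem del_pullback {φ : E → F} {y : E} {b : F → F →L⋆[ℂ] ℂ} {a : E → E →L⋆[ℂ] ℂ}
    (hφ : ContDiffAt ℝ 2 φ y) (hh : ∀ᶠ x in 𝓝 y, IsHolAt φ x)
    (hb : DifferentiableAt ℝ b (φ y)) (ha : DifferentiableAt ℝ a y)
    (h : ∀ᶠ x in 𝓝 y, ∀ w, a x w = b (φ x) (fderiv ℝ φ x w)) (v w : E) :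
    del a y v w = del b (φ y) (fderiv ℝ φ y v) (fderiv ℝ φ y w) := by
  change (1 / 2 : ℂ) • (fderiv ℝ a y v w - Complex.I • fderiv ℝ a y (Complex.I • v) w)
    = (1 / 2 : ℂ) • (fderiv ℝ b (φ y) (fderiv ℝ φ y v) (fderiv ℝ φ y w)
      - Complex.I • fderiv ℝ b (φ y) (Complex.I • fderiv ℝ φ y v) (fderiv ℝ φ y w))
  simp only [fderiv_pullback hφ hb ha h]
  -- Here the second-order contribution cancels by itself: ∂ of the antiholomorphic coefficients of
  -- the pull-back is zero.
  rw [snd_fderiv_I_left hφ hh, hh.self_of_nhds v]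
  simp only [smul_eq_mul, map_smulₛₗ, Complex.conj_I]
  linear_combination (1 / 2 : ℂ) * b (φ y) (fderiv ℝ (fderiv ℝ φ) y v w) * Complex.I_sq

/-- `∂̄` of a function commutes with holomorphic maps. -/
theorem dbar_comp {φ : E → F} {x : E} {u : F → G} (hφ : DifferentiableAt ℝ φ x)
    (hh : IsHolAt φ x) (hu : DifferentiableAt ℝ u (φ x)) (w : E) :
    dbar (fun x => u (φ x)) x w = dbar u (φ x) (fderiv ℝ φ x w) := by
  rw [dbar_apply, dbar_apply, fderiv_fun_comp x hu hφ]
  simp only [ContinuousLinearMap.comp_apply]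
  rw [hh w]

end Complex

/-! ### Globalising germs by cutoffs -/

section Cutoff

variable {E F : Type*} [NormedAddCommGroup E] [NormedSpace ℝ E] [FiniteDimensional ℝ E]
  [NormedAddCommGroup F] [NormedSpace ℝ F]

/-- A germ of a `C^n` function is the germ of a compactly supported `C^n` function. -/
theorem exists_contDiff_eventuallyEq {n : ℕ} {g : E → F} {y₀ : E}
    (hg : ∀ᶠ y in 𝓝 y₀, ContDiffAt ℝ n g y) :
    ∃ g' : E → F, ContDiff ℝ n g' ∧ HasCompactSupport g' ∧ g' =ᶠ[𝓝 y₀] g := by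
  obtain ⟨ε, hε, hball⟩ := Metric.eventually_nhds_iff_ball.1 hg
  let χ : ContDiffBump y₀ := ⟨ε / 4, ε / 2, by positivity, by linarith⟩
  refine ⟨fun y => χ y • g y, ?_, χ.hasCompactSupport.smul_right, ?_⟩
  · rw [contDiff_iff_contDiffAt]
    intro y
    by_cases hy : y ∈ tsupport χ
    · refine ContDiffAt.smul χ.contDiffAt (hball y ?_)
      rw [χ.tsupport_eq] at hy
      exact Metric.closedBall_subset_ball (by change ε / 2 < ε; linarith) hy
    · have : (fun y => χ y • g y) =ᶠ[𝓝 y] fun _ => 0 := by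
        filter_upwards [notMem_tsupport_iff_eventuallyEq.1 hy] with z hz
        simp [hz]
      exact contDiffAt_const.congr_of_eventuallyEq this
  · filter_upwards [χ.eventuallyEq_one] with y hy
    simp [hy]

end Cutoff

/-! ### Averages at a variable scale: each factor f gains one derivative -/

section Mollifier

open MeasureTheory

variable {E F : Type*} [NormedAddCommGroup E] [NormedSpace ℝ E] [MeasurableSpace E] (μ : Measure E)
  [NormedAddCommGroup F] [NormedSpace ℝ F]

/-- The average of `w` near `y` at the scale `f y`, weighted by `φ`. -/
noncomputable def scaledAverage (φ : E → ℝ) (f : E → ℝ) (w : E → F) (y : E) : F :=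
  ∫ z, φ z • w (y - f y • z) ∂μ

theorem scaledAverage_of_eq_zero [CompleteSpace F] (φ : E → ℝ) {f : E → ℝ} (w : E → F)
    {y : E} (hy : f y = 0) :
    scaledAverage μ φ f w y = (∫ z, φ z ∂μ) • w y := by
  simp only [scaledAverage, hy, zero_smul, sub_zero, integral_smul_const]

variable {μ} {φ f : E → ℝ} {w : E → F} [FiniteDimensional ℝ E]

/-- The average is a convolution, evaluated at 0, with a function depending on the parameter y. The
cutoff ψ, equal to 1 near the reflected support of φ, changes nothing and makes that function
compactly supported in z, as differentiation under the integral sign requires. -/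
theorem exists_scaledAverage_eq_convolution (hφ : HasCompactSupport φ) :
    ∃ ψ : E → ℝ, ContDiff ℝ ∞ ψ ∧ HasCompactSupport ψ ∧
      (∀ z ∈ tsupport φ, ψ =ᶠ[𝓝 (-z)] 1) ∧
      ∀ (f : E → ℝ) (w : E → F), scaledAverage μ φ f w = fun y => convolution φ
      (fun z => ψ z • w (y + f y • z)) (ContinuousLinearMap.lsmul ℝ ℝ) μ 0 := by
  obtain ⟨R, hR, hsub⟩ := hφ.isCompact.isBounded.subset_ball_lt 0 0
  let ψ : ContDiffBump (0 : E) := ⟨R, R + 1, hR, by linarith⟩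
  have h1 : ∀ z ∈ tsupport φ, ψ =ᶠ[𝓝 (-z)] 1 := by
    intro z hz
    refine ψ.eventuallyEq_one_of_mem_ball ?_
    simpa using hsub hz
  refine ⟨ψ, ψ.contDiff, ψ.hasCompactSupport, h1, fun f w => funext fun y => ?_⟩
  simp only [scaledAverage, convolution, zero_sub, ContinuousLinearMap.lsmul_apply]
  refine integral_congr_ae (Filter.Eventually.of_forall fun z => ?_)
  by_cases hz : z ∈ tsupport φ
  · simp [(h1 z hz).eq_of_nhds, sub_eq_add_neg]
  · simp [image_eq_zero_of_notMem_tsupport hz]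

variable [BorelSpace E] [μ.IsAddHaarMeasure]

theorem contDiff_scaledAverage [CompleteSpace F] {n : ℕ} (hφc : Continuous φ)
    (hφ : HasCompactSupport φ)
    (hf : ContDiff ℝ n f) (hw : ContDiff ℝ n w) : ContDiff ℝ n (scaledAverage μ φ f w) := by
  obtain ⟨ψ, hψ, hψc, -, h⟩ := exists_scaledAverage_eq_convolution (F := F) (μ := μ) hφ
  rw [h, ← contDiffOn_univ]
  refine contDiffOn_convolution_right_with_param_comp (n := n) (ContinuousLinearMap.lsmul ℝ ℝ)
    (v := fun _ => (0 : E)) (g := fun y z => ψ z • w (y + f y • z)) contDiffOn_const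
    isOpen_univ hψc.isCompact ?_ hφc.locallyIntegrable ?_
  · intro p x _ hx
    simp [image_eq_zero_of_notMem_tsupport hx]
  · refine ContDiff.contDiffOn ?_
    have : ContDiff ℝ n ψ := hψ.of_le (by exact_mod_cast le_top)
    exact (this.comp contDiff_snd).smul
      (hw.comp (contDiff_fst.add ((hf.comp contDiff_fst).smul contDiff_snd)))

theorem fderiv_scaledAverage [CompleteSpace F] (hφc : Continuous φ)
    (hφ : HasCompactSupport φ)
    (hf : ContDiff ℝ 1 f) (hw : ContDiff ℝ 1 w) (y v : E) :
    fderiv ℝ (scaledAverage μ φ f w) y v =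
      ∫ z, φ z • fderiv ℝ w (y - f y • z) (v - fderiv ℝ f y v • z) ∂μ := by
  obtain ⟨ψ, hψ, hψc, hψ1, h⟩ := exists_scaledAverage_eq_convolution (F := F) (μ := μ) hφ
  set g : E → E → F := fun y z => ψ z • w (y + f y • z) with hg
  have hψ' : ContDiff ℝ 1 ψ := hψ.of_le (by exact_mod_cast le_top)
  have hgc : ContDiff ℝ 1 (↿g) :=
    (hψ'.comp contDiff_snd).smul
      (hw.comp (contDiff_fst.add ((hf.comp contDiff_fst).smul contDiff_snd)))
  have hsupp : ∀ p, ∀ x, p ∈ (Set.univ : Set E) → x ∉ tsupport ψ → g p x = 0 := by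
    intro p x _ hx
    simp [hg, image_eq_zero_of_notMem_tsupport hx]
  have hd := hasFDerivAt_convolution_right_with_param (μ := μ) (ContinuousLinearMap.lsmul ℝ ℝ)
    isOpen_univ hψc.isCompact hsupp hφc.locallyIntegrable hgc.contDiffOn (y, (0 : E)) trivial
  have hin : HasFDerivAt (fun y : E => (y, (0 : E))) (ContinuousLinearMap.inl ℝ E E) y :=
    (ContinuousLinearMap.inl ℝ E E).hasFDerivAt
  have hd2 := (hd.comp y hin).fderiv
  have e0 : scaledAverage μ φ f w = (fun q : E × E => convolution φ (g q.1)
      (ContinuousLinearMap.lsmul ℝ ℝ) μ q.2) ∘ fun y : E => (y, (0 : E)) := h f w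
  rw [e0, hd2]
  simp only [convolution, zero_sub]
  have hcont : Continuous fun t : E => (ContinuousLinearMap.precompR (E × E)
      (ContinuousLinearMap.lsmul ℝ ℝ : ℝ →L[ℝ] F →L[ℝ] F)) (φ t) (fderiv ℝ (↿g) (y, -t)) := by
    have h1 : Continuous fun t : E => fderiv ℝ (↿g) (y, -t) :=
      (hgc.continuous_fderiv (by norm_num)).comp (by fun_prop)
    exact ((ContinuousLinearMap.precompR (E × E)
      (ContinuousLinearMap.lsmul ℝ ℝ : ℝ →L[ℝ] F →L[ℝ] F)).continuous.comp hφc).clm_apply h1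
  have hcs : HasCompactSupport fun t : E => (ContinuousLinearMap.precompR (E × E)
      (ContinuousLinearMap.lsmul ℝ ℝ : ℝ →L[ℝ] F →L[ℝ] F)) (φ t) (fderiv ℝ (↿g) (y, -t)) := by
    refine hφ.mono fun t ht => ?_
    contrapose! ht
    simp only [Function.mem_support, not_not] at ht ⊢
    simp [ht]
  have hint := hcont.integrable_of_hasCompactSupport (μ := μ) hcs
  rw [ContinuousLinearMap.comp_apply, ContinuousLinearMap.integral_apply hint]
  refine integral_congr_ae (Filter.Eventually.of_forall fun t => ?_)
  change φ t • fderiv ℝ (↿g) (y, -t) (v, 0) = _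
  by_cases ht : t ∈ tsupport φ
  · congr 1
    have e1 : fderiv ℝ (↿g) (y, -t) (v, 0) = fderiv ℝ (fun x => g x (-t)) y v := by
      have h1 : HasFDerivAt (fun x : E => (x, -t)) (ContinuousLinearMap.inl ℝ E E) y :=
        hasFDerivAt_prodMk_left y (-t)
      have h2 := ((hgc.differentiable (by norm_num) (y, -t)).hasFDerivAt.comp y h1).fderiv
      change fderiv ℝ (fun x => g x (-t)) y = _ at h2
      rw [h2]; rfl
    rw [e1]
    have e2 : (fun x => g x (-t)) = fun x => w (x - f x • t) := by
      funext x
      simp [hg, (hψ1 t ht).eq_of_nhds, sub_eq_add_neg]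
    rw [e2]
    have h3 : HasFDerivAt (fun x => x - f x • t)
        (ContinuousLinearMap.id ℝ E - (fderiv ℝ f y).smulRight t) y :=
      (hasFDerivAt_id y).sub ((hf.differentiable (by norm_num) y).hasFDerivAt.smul_const t)
    have h4 : HasFDerivAt (fun x => w (x - f x • t)) _ y :=
      (hw.differentiable (by norm_num) _).hasFDerivAt.comp y h3
    rw [h4.fderiv]
    simp
  · simp [image_eq_zero_of_notMem_tsupport ht]

/-- Integration by parts in z. Since the z-derivative of w(y - f(y) z) is -f(y) Dw, the factor f(y)
turns a derivative of w into a derivative of the kernel. -/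
theorem smul_integral_smul_fderiv {θ : E → ℝ} (hθc : ContDiff ℝ 1 θ) (hθ : HasCompactSupport θ)
    (hw : ContDiff ℝ 1 w) (y e : E) :
    f y • ∫ z, θ z • fderiv ℝ w (y - f y • z) e ∂μ =
      scaledAverage μ (fun z => fderiv ℝ θ z e) f w y := by
  set W : E → F := fun z => w (y - f y • z) with hW
  have hWc : ContDiff ℝ 1 W := hw.comp (by fun_prop)
  have hWd : ∀ z, fderiv ℝ W z e = -(f y • fderiv ℝ w (y - f y • z) e) := by
    intro z
    have h3 : HasFDerivAt (fun z => y - f y • z) (-(f y • ContinuousLinearMap.id ℝ E)) z := by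
      simpa using ((hasFDerivAt_id z).const_smul (f y)).const_sub y
    have h4 : HasFDerivAt W _ z := (hw.differentiable (by norm_num) _).hasFDerivAt.comp z h3
    rw [h4.fderiv]
    simp
  have c1 : Continuous fun z => fderiv ℝ θ z e :=
    (hθc.continuous_fderiv (by norm_num)).clm_apply continuous_const
  have c2 : Continuous fun z => fderiv ℝ W z e :=
    (hWc.continuous_fderiv (by norm_num)).clm_apply continuous_const
  have ibp := integral_smul_fderiv_eq_neg_fderiv_smul_of_integrable (μ := μ) (f := θ) (g := W)
    (v := e)
    ((c1.smul hWc.continuous).integrable_of_hasCompactSupport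
      ((hθ.fderiv_apply ℝ e).smul_right))
    ((hθc.continuous.smul c2).integrable_of_hasCompactSupport hθ.smul_right)
    ((hθc.continuous.smul hWc.continuous).integrable_of_hasCompactSupport hθ.smul_right)
    (fun x _ => hθc.differentiable (by norm_num) x) (fun x _ => hWc.differentiable (by norm_num) x)
  simp only [hWd, smul_neg, integral_neg, neg_inj] at ibp
  rw [scaledAverage, ← ibp, ← integral_smul]
  refine integral_congr_ae (Filter.Eventually.of_forall fun z => ?_)
  simp only [smul_comm (f y)]

/-- The divergence of `z ↦ φ z • z`, in the basis `b`, up to the order of summation. -/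
noncomputable def coordDiv {ι : Type*} (b : Module.Basis ι ℝ E) (φ : E → ℝ) (i : ι) (z : E) : ℝ :=
  fderiv ℝ (fun z => b.coord i z * φ z) z (b i)

/-- The point is that the right-hand side contains no derivative of w, only averages of w against
new kernels. The second group comes from the dependence of the scale on y: expanding z in a basis
and integrating by parts yields the divergence of φ(z) z. -/
theorem smul_fderiv_scaledAverage [CompleteSpace F] {ι : Type*} [Fintype ι] (b : Module.Basis ι ℝ E)
    (hφc : ContDiff ℝ 1 φ) (hφ : HasCompactSupport φ)
    (hf : ContDiff ℝ 1 f) (hw : ContDiff ℝ 1 w) (y v : E) :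
    f y • fderiv ℝ (scaledAverage μ φ f w) y v =
      scaledAverage μ (fun z => fderiv ℝ φ z v) f w y -
        fderiv ℝ f y v • ∑ i, scaledAverage μ (coordDiv b φ i) f w y := by
  have hb : ∀ i, ContDiff ℝ 1 fun z => b.coord i z := fun i =>
    (b.coord i).toContinuousLinearMap.contDiff
  rw [fderiv_scaledAverage hφc.continuous hφ hf hw,
    ← smul_integral_smul_fderiv hφc hφ hw y v]
  have hsum : ∀ i, scaledAverage μ (coordDiv b φ i) f w y =
      f y • ∫ z, (b.coord i z * φ z) • fderiv ℝ w (y - f y • z) (b i) ∂μ := fun i =>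
    (smul_integral_smul_fderiv ((hb i).mul hφc) hφ.mul_left hw y (b i)).symm
  simp only [hsum]
  rw [← Finset.smul_sum, smul_comm (fderiv ℝ f y v), ← smul_sub]
  congr 1
  have hDw : Continuous fun z => fderiv ℝ w (y - f y • z) :=
    (hw.continuous_fderiv (by norm_num)).comp (by fun_prop)
  have i1 : Integrable (fun z => φ z • fderiv ℝ w (y - f y • z) v) μ :=
    (hφc.continuous.smul (hDw.clm_apply continuous_const)).integrable_of_hasCompactSupport
      hφ.smul_right
  have i2 : ∀ i, Integrable
      (fun z => (b.coord i z * φ z) • fderiv ℝ w (y - f y • z) (b i)) μ := fun i =>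
    (((hb i).continuous.mul hφc.continuous).smul
      (hDw.clm_apply continuous_const)).integrable_of_hasCompactSupport hφ.mul_left.smul_right
  have i3 : Integrable (fun z => fderiv ℝ f y v •
      ∑ i, (b.coord i z * φ z) • fderiv ℝ w (y - f y • z) (b i)) μ :=
    (integrable_finsetSum _ fun i _ => i2 i).smul (fderiv ℝ f y v)
  rw [← integral_finsetSum _ fun i _ => i2 i, ← integral_smul, ← integral_sub i1 i3]
  refine integral_congr_ae (Filter.Eventually.of_forall fun z => ?_)
  have hz : z = ∑ i, b.coord i z • b i := by
    simp [b.sum_repr]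
  have h1 : fderiv ℝ w (y - f y • z) z =
      ∑ i, b.coord i z • fderiv ℝ w (y - f y • z) (b i) := by
    conv_lhs => rw [show fderiv ℝ w (y - f y • z) z =
      fderiv ℝ w (y - f y • z) (∑ i, b.coord i z • b i) from by rw [← hz]]
    rw [map_sum]
    simp only [map_smul]
  simp only [map_sub, map_smul, h1, smul_sub, Finset.smul_sum, smul_smul]
  congr 1
  refine Finset.sum_congr rfl fun i _ => ?_
  congr 1
  ring

/-- Induction on j for all kernels at once: the derivative of f^(j+1) times an average is a
combination, with coefficients from Df, of terms f^j times averages with other kernels. The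
condition k ≥ 1 lets the average be differentiated in the first place. -/
theorem contDiff_pow_smul_scaledAverage [CompleteSpace F] {k : ℕ} (hk : 1 ≤ k) (j : ℕ)
    (hφc : ContDiff ℝ ∞ φ)
    (hφ : HasCompactSupport φ) (hf : ContDiff ℝ (k + j : ℕ) f) (hw : ContDiff ℝ k w) :
    ContDiff ℝ (k + j : ℕ) (fun y => f y ^ j • scaledAverage μ φ f w y) := by
  induction j generalizing φ with
  | zero => simpa using contDiff_scaledAverage hφc.continuous hφ (by simpa using hf) hw
  | succ j ih =>
    have hfj : ContDiff ℝ (k + j : ℕ) f := hf.of_le (by exact_mod_cast Nat.le_succ _)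
    have hf1 : ContDiff ℝ 1 f := hf.of_le (by exact_mod_cast (by omega : 1 ≤ k + (j + 1)))
    have hw1 : ContDiff ℝ 1 w := hw.of_le (by exact_mod_cast hk)
    have hφ1 : ContDiff ℝ 1 φ := hφc.of_le (by exact_mod_cast le_top)
    let b := Module.finBasis ℝ E
    have hS1 : ContDiff ℝ 1 (scaledAverage μ φ f w) :=
      contDiff_scaledAverage (n := 1) hφc.continuous hφ (by exact_mod_cast hf1)
        (by exact_mod_cast hw1)
    have hf' : ∀ v, ContDiff ℝ (k + j : ℕ) fun y => fderiv ℝ f y v := fun v =>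
      (hf.fderiv_right (m := (k + j : ℕ)) (by norm_cast)).clm_apply contDiff_const
    have hφ' : ∀ v, ContDiff ℝ ∞ fun z => fderiv ℝ φ z v := fun v =>
      (hφc.fderiv_right (m := ∞) (by simp)).clm_apply contDiff_const
    have hb : ∀ i, ContDiff ℝ ∞ fun z => b.coord i z := fun i =>
      (b.coord i).toContinuousLinearMap.contDiff
    have hdiv : ∀ i, ContDiff ℝ ∞ (coordDiv b φ i) := fun i =>
      (((hb i).mul hφc).fderiv_right (m := ∞) (by simp)).clm_apply contDiff_const
    have hdivc : ∀ i, HasCompactSupport (coordDiv b φ i) := fun i => by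
      have h1 : HasCompactSupport fun z => b.coord i z * φ z := hφ.mul_left
      exact h1.fderiv_apply ℝ (b i)
    change ContDiff ℝ ((k + j : ℕ) + 1 : ℕ) _
    rw [show (((k + j : ℕ) + 1 : ℕ) : WithTop ℕ∞) = ((k + j : ℕ) : WithTop ℕ∞) + 1 by norm_cast,
      contDiff_succ_iff_fderiv_apply]
    have hdiff : ∀ y, HasFDerivAt (fun y => f y ^ (j + 1) • scaledAverage μ φ f w y)
        (f y ^ (j + 1) • fderiv ℝ (scaledAverage μ φ f w) y +
          (((j + 1 : ℕ) * f y ^ j) • fderiv ℝ f y).smulRight (scaledAverage μ φ f w y)) y := by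
      intro y
      have h1 := ((hf1.differentiable (by norm_num) y).hasFDerivAt.pow (j + 1))
      have h2 := h1.smul (hS1.differentiable (by norm_num) y).hasFDerivAt
      simp only [Nat.add_sub_cancel, nsmul_eq_mul] at h2
      exact h2
    refine ⟨fun y => (hdiff y).differentiableAt, by simp, fun v => ?_⟩
    have e : (fun y => fderiv ℝ (fun y => f y ^ (j + 1) • scaledAverage μ φ f w y) y v) =
        fun y => f y ^ j • scaledAverage μ (fun z => fderiv ℝ φ z v) f w y
          - fderiv ℝ f y v • ∑ i, f y ^ j • scaledAverage μ (coordDiv b φ i) f w y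
          + ((j + 1 : ℕ) * fderiv ℝ f y v) • (f y ^ j • scaledAverage μ φ f w y) := by
      funext y
      rw [(hdiff y).fderiv]
      have h2 := smul_fderiv_scaledAverage (μ := μ) b hφ1 hφ hf1 hw1 y v
      simp only [add_apply, smul_apply, ContinuousLinearMap.smulRight_apply, smul_eq_mul]
      rw [pow_succ, mul_smul, h2, ← Finset.smul_sum]
      module
    rw [e]
    have t1 := ih (hφ' v) (hφ.fderiv_apply ℝ v) hfj
    have t2 : ContDiff ℝ (k + j : ℕ) fun y => ∑ i, f y ^ j • scaledAverage μ (coordDiv b φ i) f w y :=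
      ContDiff.sum fun i _ => ih (hdiv i) (hdivc i) hfj
    have t3 := ih hφc hφ hfj
    have t4 : ContDiff ℝ (k + j : ℕ) fun y => ((j + 1 : ℕ) : ℝ) * fderiv ℝ f y v :=
      contDiff_const.mul (hf' v)
    exact (t1.sub ((hf' v).smul t2)).add (t4.smul t3)

end Mollifier

/-- For `w` of class `C^k`, the function `f ^ j • w` on the zero set of `f` can be corrected, without
changing its leading term, to a function of class `C^(k + j)`. -/
theorem exists_contDiff_pow_smul {E F : Type*} [NormedAddCommGroup E] [NormedSpace ℝ E]
    [FiniteDimensional ℝ E] [NormedAddCommGroup F] [NormedSpace ℝ F] [CompleteSpace F] {k : ℕ}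
    (hk : 1 ≤ k) (j : ℕ) {f : E → ℝ} {w : E → F} (hf : ContDiff ℝ (k + j : ℕ) f)
    (hw : ContDiff ℝ k w) : ∃ S : E → F, Continuous S ∧ (∀ y, f y = 0 → S y = w y) ∧
      ContDiff ℝ (k + j : ℕ) (fun y => f y ^ j • S y) := by
  let _ : MeasurableSpace E := borel E
  have : BorelSpace E := ⟨rfl⟩
  let μ : MeasureTheory.Measure E := MeasureTheory.Measure.addHaar
  let χ : ContDiffBump (0 : E) := ⟨1, 2, one_pos, one_lt_two⟩
  -- The kernel has integral 1, so where the scale f is zero the average is w itself.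
  refine ⟨scaledAverage μ (χ.normed μ) f w, ?_, ?_, ?_⟩
  · exact (contDiff_scaledAverage (n := 0) χ.continuous_normed χ.hasCompactSupport_normed
      (hf.of_le (by simp)) (hw.of_le (by simp))).continuous
  · intro y hy
    rw [scaledAverage_of_eq_zero μ _ w hy, χ.integral_normed, one_smul]
  · exact contDiff_pow_smul_scaledAverage hk j χ.contDiff_normed χ.hasCompactSupport_normed hf hw

/-! ### Raising the order of flatness by subtracting a ∂̄-exact form -/

section Correction

universe u
variable {E : Type u} [NormedAddCommGroup E] [NormedSpace ℂ E]

/-- The leading normal coefficient of a form that is flat and `∂̄`-closed to the same order along a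
hypersurface annihilates the complex tangent space. -/
theorem pd_iterate_apply_eq_zero_of_dbarForm [CompleteSpace E] {k n : ℕ} (hk : k < n) {Ω : Set E}
    (hΩ : IsOpen Ω)
    {f : E → ℝ} {ν : E} (hf : ∀ y ∈ Ω, ContDiffAt ℝ 1 f y) (hν : ∀ y ∈ Ω, fderiv ℝ f y ν ≠ 0)
    {b : E → E →L⋆[ℂ] ℂ} (hb : ∀ y ∈ Ω, ContDiffAt ℝ n b y)
    (hflat : ∀ y ∈ Ω, f y = 0 → FlatBelow (k + 1) b y)
    (hclosed : ∀ y ∈ Ω, f y = 0 → FlatBelow (k + 1) (dbarForm b) y)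
    {y : E} (hy : y ∈ Ω) (hfy : f y = 0) {v : E} (hv : fderiv ℝ f y v = 0)
    (hv' : fderiv ℝ f y (Complex.I • v) = 0) : (pd ν)^[k + 1] b y v = 0 := by
  have hk0 : ∀ x ∈ Ω, f x = 0 → (pd ν)^[k] b x = 0 := fun x hx hfx =>
    (hflat x hx hfx).pd_iterate_eq_zero ν (n := n) (by omega) (hb x hx) (by omega)
  have c1 : ContDiffAt ℝ 1 ((pd ν)^[k] b) y := by
    have := ContDiffAt.pd_iterate (n := 1) (i := k) (ν := ν) (g := b) (y := y)
      ((hb y hy).of_le (by exact_mod_cast (by omega : 1 + k ≤ n)))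
    exact_mod_cast this
  have hf0 : fderiv ℝ f y ≠ 0 := fun h0 => hν y hy (by simp [h0])
  set B := (pd ν)^[k + 1] b y with hB
  have hBν : fderiv ℝ ((pd ν)^[k] b) y ν = B := by
    rw [hB, Function.iterate_succ_apply']; rfl
  -- The k-th normal derivative of b vanishes on the hypersurface, so its differential kills tangent
  -- vectors and has the form Df ⊗ B / Df(ν).
  have hD : ∀ u, fderiv ℝ ((pd ν)^[k] b) y u = (fderiv ℝ f y u / fderiv ℝ f y ν) • B := by
    intro u
    have h0 : fderiv ℝ ((pd ν)^[k] b) y (u - (fderiv ℝ f y u / fderiv ℝ f y ν) • ν) = 0 := by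
      refine fderiv_apply_eq_zero_of_zeroSet (hf y hy) hfy hf0 c1
        (Filter.eventually_of_mem (hΩ.mem_nhds hy) hk0) ?_
      rw [map_sub, map_smul, smul_eq_mul, div_mul_cancel₀ _ (hν y hy), sub_self]
    rw [map_sub, map_smul, hBν, sub_eq_zero] at h0
    exact h0
  -- Constant-direction derivatives commute with ∂̄, and ∂̄b is flat.
  have hz : dbarForm ((pd ν)^[k] b) y = 0 := by
    have h1 := (hclosed y hy hfy).pd_iterate_eq_zero ν (n := n - 1) (by omega)
      (ContDiffAt.dbarForm ((hb y hy).of_le (by exact_mod_cast (by omega : n - 1 + 1 ≤ n))))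
      (i := k) (by omega)
    rw [dbarForm_eq, pd_iterate_clm (G := E →L⋆[ℂ] E →L⋆[ℂ] ℂ) antisymmL k
      ((hb y hy).fderiv_right (by exact_mod_cast (by omega : k + 1 ≤ n))),
      pd_iterate_fderiv_comm k ((hb y hy).of_le (by exact_mod_cast (by omega : k + 1 ≤ n)))] at h1
    exact h1
  have h2 : dbarForm ((pd ν)^[k] b) y ν v = 0 := by rw [hz]; rfl
  rw [dbarForm_apply, hD, hD, hD, hD, hv, hv', div_self (hν y hy)] at h2
  simp only [zero_div, zero_smul, one_smul, smul_apply,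
    smul_eq_mul, ← Complex.coe_smul, ← mul_assoc] at h2
  set t : ℝ := fderiv ℝ f y (Complex.I • ν) / fderiv ℝ f y ν
  -- Evaluated on (ν, v), the terms differentiating along v and iv drop out. The remaining factor
  -- has real part 1 because t is real, so B(v) = 0.
  have h3 : (1 + Complex.I * (t : ℂ)) * B v = 0 := by linear_combination 2 * h2
  refine (mul_eq_zero.1 h3).resolve_left fun h => ?_
  have := congrArg Complex.re h
  simp at this

/-- A form flat to order `< k` on a hypersurface whose leading normal coefficient annihilates the
complex tangent space is `∂̄` of a function, modulo forms flat to order `< k + 1`. -/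
theorem exists_dbar_sub_flat [FiniteDimensional ℂ E] {k n : ℕ} (hk : k + 1 ≤ n) {Ω : Set E}
    (hΩ : IsOpen Ω) {f : E → ℝ} {ν : E} (hf : ∀ y ∈ Ω, ContDiffAt ℝ (n + 1 : ℕ) f y)
    (hν : ∀ y ∈ Ω, fderiv ℝ f y ν ≠ 0)
    {b : E → E →L⋆[ℂ] ℂ} (hb : ∀ y ∈ Ω, ContDiffAt ℝ n b y)
    (hflat : ∀ y ∈ Ω, f y = 0 → FlatBelow k b y)
    (hker : ∀ y ∈ Ω, f y = 0 → ∀ v, fderiv ℝ f y v = 0 → fderiv ℝ f y (Complex.I • v) = 0 →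
      (pd ν)^[k] b y v = 0) {y₀ : E} (hy₀ : y₀ ∈ Ω) :
    ∃ e : E → ℂ, ContDiff ℝ (n + 1 : ℕ) e ∧ ∀ᶠ y in 𝓝 y₀, f y = 0 →
      e y = 0 ∧ FlatBelow (k + 1) (fun x => b x - dbar e x) y := by
  have : FiniteDimensional ℝ E := FiniteDimensional.complexToReal E
  have : CompleteSpace E := FiniteDimensional.complete ℝ E
  -- The form τ is ∂̄f. Its kernel is the complex tangent space, so the leading coefficient of b is
  -- a multiple of it.
  set τ : E → E →L⋆[ℂ] ℂ := fun y => conjPartL (Complex.ofRealCLM.comp (fderiv ℝ f y)) with hτ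
  have hτa : ∀ y v, τ y v = (1 / 2 : ℂ) * ((fderiv ℝ f y v : ℝ) +
      Complex.I * (fderiv ℝ f y (Complex.I • v) : ℝ)) := fun y v => rfl
  have hτ0 : ∀ y v, τ y v = 0 → fderiv ℝ f y v = 0 ∧ fderiv ℝ f y (Complex.I • v) = 0 := by
    intro y v h
    rw [hτa] at h
    have h1 := congrArg Complex.re h
    have h2 := congrArg Complex.im h
    simp at h1 h2
    exact ⟨h1, h2⟩
  have hτν : ∀ y ∈ Ω, τ y ν ≠ 0 := fun y hy h => hν y hy (hτ0 y ν h).1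
  have hf' : ∀ y ∈ Ω, ContDiffAt ℝ n (fderiv ℝ f) y := fun y hy =>
    (hf y hy).fderiv_right (by norm_cast)
  -- For e with leading term f^(k+1) w / (k+1)!, the k-th normal derivative of ∂̄e is Df(ν)^k w τ;
  -- this w matches it with that of b. The k normal derivatives of b leave w only of class C^(n-k).
  set w : E → ℂ := fun y => (pd ν)^[k] b y ν / (τ y ν * ((fderiv ℝ f y ν : ℝ) : ℂ) ^ k) with hw
  have hwc : ∀ y ∈ Ω, ContDiffAt ℝ (n - k : ℕ) w y := by
    intro y hy
    have hle : ((n - k : ℕ) : WithTop ℕ∞) ≤ (n : ℕ) := by exact_mod_cast Nat.sub_le n k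
    have c1 : ContDiffAt ℝ (n - k : ℕ) ((pd ν)^[k] b) y :=
      ContDiffAt.pd_iterate ((hb y hy).of_le (by exact_mod_cast (by omega : n - k + k ≤ n)))
    have c2 : ContDiffAt ℝ (n - k : ℕ) (fun y => fderiv ℝ f y) y := (hf' y hy).of_le hle
    have ev : ∀ {g : E → E →L⋆[ℂ] ℂ}, ContDiffAt ℝ (n - k : ℕ) g y →
        ContDiffAt ℝ (n - k : ℕ) (fun x => g x ν) y := fun {g} hg =>
      contDiffAt_clm_comp hg (LinearMap.mkContinuous
        ({ toFun := fun l => l ν, map_add' := fun _ _ => rfl, map_smul' := fun _ _ => rfl } :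
          (E →L⋆[ℂ] ℂ) →ₗ[ℝ] ℂ) ‖ν‖ (fun l => by simpa [mul_comm] using l.le_opNorm ν))
    have c3 : ContDiffAt ℝ (n - k : ℕ) (fun y => fderiv ℝ f y ν) y := c2.clm_apply contDiffAt_const
    have c4 : ContDiffAt ℝ (n - k : ℕ) τ y := by
      have h1 : ContDiffAt ℝ (n - k : ℕ) (fun y => Complex.ofRealCLM.comp (fderiv ℝ f y)) y :=
        contDiffAt_const.clm_comp c2
      exact contDiffAt_clm_comp (G := E →L⋆[ℂ] ℂ) h1 conjPartL
    have c5 : ContDiffAt ℝ (n - k : ℕ) (fun y => ((fderiv ℝ f y ν : ℝ) : ℂ)) y :=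
      contDiffAt_clm_comp c3 Complex.ofRealCLM
    refine (ev c1).mul (((ev c4).mul (c5.pow k)).inv ?_)
    refine mul_ne_zero (hτν y hy) (pow_ne_zero _ ?_)
    exact_mod_cast hν y hy
  obtain ⟨w', hw'c, -, hw'e⟩ := exists_contDiff_eventuallyEq (y₀ := y₀)
    (Filter.eventually_of_mem (hΩ.mem_nhds hy₀) hwc)
  obtain ⟨f', hf'c, -, hf'e⟩ := exists_contDiff_eventuallyEq (y₀ := y₀)
    (Filter.eventually_of_mem (hΩ.mem_nhds hy₀) hf)
  have hn : n - k + (k + 1) = n + 1 := by omega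
  -- The power k + 1 of f recovers exactly (n - k) + (k + 1) = n + 1 derivatives; the averaging
  -- needs n - k ≥ 1.
  obtain ⟨S, hSc, hS0, hSd⟩ := exists_contDiff_pow_smul (k := n - k) (by omega) (k + 1)
    (by rw [hn]; exact hf'c) hw'c
  rw [hn] at hSd
  set c : ℝ := ((k + 1).factorial : ℝ)⁻¹ with hc
  set e : E → ℂ := fun y => c • (f' y ^ (k + 1) • S y) with he
  have hec : ContDiff ℝ (n + 1 : ℕ) e := hSd.const_smul c
  have hfac : ((k + 1).factorial : ℝ) ≠ 0 := by exact_mod_cast (k + 1).factorial_ne_zero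
  obtain ⟨V, hVsub, hV, hy₀V⟩ := mem_nhds_iff.1 (hf'e.and hw'e)
  refine ⟨e, hec, ?_⟩
  have hpde : ∀ y ∈ V ∩ Ω, f y = 0 → (∀ i < k + 1, (pd ν)^[i] e y = 0) ∧
      (pd ν)^[k + 1] e y = (fderiv ℝ f y ν ^ (k + 1)) • w y := by
    intro y hy hfy
    have hfe : f' =ᶠ[𝓝 y] f := Filter.eventually_of_mem (hV.mem_nhds hy.1) fun x hx => (hVsub hx).1
    have hf'y : f' y = 0 := by rw [hfe.eq_of_nhds, hfy]
    obtain ⟨h1, h2⟩ := pd_iterate_of_eq_pow_smul (k := k + 1) (g := e) (s := fun y => c • S y)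
      (f := f') (y := y) ν (hec.contDiffAt.of_le (by exact_mod_cast (by omega : k + 1 ≤ n + 1)))
      (hf'c.differentiable (by simp) y) hf'y (hSc.const_smul c).continuousAt
      (Filter.Eventually.of_forall fun x => smul_comm _ _ _)
    refine ⟨h1, ?_⟩
    rw [h2, hfe.fderiv_eq, hS0 y hf'y, (hVsub hy.1).2, smul_smul, hc]
    congr 1
    field_simp
  have hflat' : ∀ y ∈ V ∩ Ω, f y = 0 → FlatBelow (k + 1) (fun x => b x - dbar e x) y := by
    have hf1 : ∀ y ∈ V ∩ Ω, ContDiffAt ℝ 1 f y := fun y hy =>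
      (hf y hy.2).of_le (by exact_mod_cast (by omega : 1 ≤ n + 1))
    have hde : ∀ y, ContDiffAt ℝ n (dbar e) y := fun y => ContDiffAt.dbar hec.contDiffAt
    refine flatBelow_of_pd_iterate (hV.inter hΩ) hf1 (fun y hy => hν y hy.2) (n := n) (by omega)
      (fun y hy => (hb y hy.2).sub (hde y)) ?_
    intro y hy hfy i hi
    have hin : (i : WithTop ℕ∞) ≤ (n : ℕ) := by exact_mod_cast (by omega : i ≤ n)
    have hde' : (pd ν)^[i] (dbar e) y = conjPartL (fderiv ℝ ((pd ν)^[i] e) y) := by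
      have hi1 : ContDiffAt ℝ (i + 1 : ℕ) e y :=
        hec.contDiffAt.of_le (by exact_mod_cast (by omega : i + 1 ≤ n + 1))
      rw [dbar_eq, pd_iterate_clm (G := E →L⋆[ℂ] ℂ) conjPartL i
        (hi1.fderiv_right (by norm_cast)), pd_iterate_fderiv_comm i hi1]
    rw [pd_iterate_sub i ((hb y hy.2).of_le hin) ((hde y).of_le hin), hde', sub_eq_zero]
    have hf0 : fderiv ℝ f y ≠ 0 := fun h0 => hν y hy.2 (by simp [h0])
    have hD : ∀ u, fderiv ℝ ((pd ν)^[i] e) y u =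
        (fderiv ℝ f y u / fderiv ℝ f y ν) • (pd ν)^[i + 1] e y := by
      intro u
      have c1 : ContDiffAt ℝ 1 ((pd ν)^[i] e) y := by
        have := ContDiffAt.pd_iterate (n := 1) (i := i) (ν := ν) (g := e) (y := y)
          (hec.contDiffAt.of_le (by exact_mod_cast (by omega : 1 + i ≤ n + 1)))
        exact_mod_cast this
      have h0 : fderiv ℝ ((pd ν)^[i] e) y (u - (fderiv ℝ f y u / fderiv ℝ f y ν) • ν) = 0 := by
        refine fderiv_apply_eq_zero_of_zeroSet (hf1 y hy) hfy hf0 c1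
          (Filter.eventually_of_mem ((hV.inter hΩ).mem_nhds hy)
            fun x hx hfx => (hpde x hx hfx).1 i hi) ?_
        rw [map_sub, map_smul, smul_eq_mul, div_mul_cancel₀ _ (hν y hy.2), sub_self]
      rw [map_sub, map_smul, sub_eq_zero] at h0
      rw [h0, Function.iterate_succ_apply']
      rfl
    -- Below order k both normal derivatives vanish separately. At order k they agree by the choice
    -- of w.
    rcases Nat.lt_succ_iff_lt_or_eq.1 hi with hik | rfl
    · have h1 : fderiv ℝ ((pd ν)^[i] e) y = 0 := by
        ext u
        rw [hD, (hpde y hy hfy).1 (i + 1) (by omega), smul_zero]; rfl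
      rw [h1, map_zero]
      exact (hflat y hy.2 hfy).pd_iterate_eq_zero ν (n := n) (by omega) (hb y hy.2) hik
    · set B := (pd ν)^[i] b y with hB
      have hνc : ((fderiv ℝ f y ν : ℝ) : ℂ) ≠ 0 := by exact_mod_cast hν y hy.2
      have h1 : ∀ u, conjPartL (fderiv ℝ ((pd ν)^[i] e) y) u =
          ((fderiv ℝ f y ν : ℝ) : ℂ) ^ i * w y * τ y u := by
        intro u
        rw [conjPartL_apply, conjPart_apply, hD, hD, (hpde y hy hfy).2, hτa]
        simp only [← Complex.coe_smul, smul_eq_mul]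
        push_cast
        field_simp
        ring
      ext u
      have hwy : w y = B ν / (τ y ν * ((fderiv ℝ f y ν : ℝ) : ℂ) ^ i) := rfl
      rw [h1, hwy]
      -- Every vector is split into a part in ker τ, where B vanishes, and a multiple of ν; the
      -- conjugate compensates for the conjugate linearity of τ.
      have hτu : τ y (u - (starRingEnd ℂ) (τ y u / τ y ν) • ν) = 0 := by
        rw [map_sub, map_smulₛₗ, Complex.conj_conj, smul_eq_mul, div_mul_cancel₀ _ (hτν y hy.2),
          sub_self]
      have h2 := hker y hy.2 hfy _ (hτ0 _ _ hτu).1 (hτ0 _ _ hτu).2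
      rw [map_sub, map_smulₛₗ, Complex.conj_conj, smul_eq_mul, sub_eq_zero] at h2
      rw [← hB] at h2
      rw [h2]
      have := hτν y hy.2
      field_simp
  filter_upwards [hV.mem_nhds hy₀V, hΩ.mem_nhds hy₀] with y hyV hyΩ hfy
  exact ⟨(hpde y ⟨hyV, hyΩ⟩ hfy).1 0 k.succ_pos, hflat' y ⟨hyV, hyΩ⟩ hfy⟩

end Correction

/-! ### The Cauchy–Pompeiu formula -/

section Pompeiu

open MeasureTheory

theorem locallyIntegrable_inv : LocallyIntegrable (fun ζ : ℂ => ζ⁻¹) := by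
  refine locallyIntegrable_of_norm_le_rpow (C := 1) (α := 1) (by simp) (by simp) ?_
    measurable_inv.aestronglyMeasurable
  refine Filter.Eventually.of_forall fun ζ => ?_
  rw [norm_inv, Real.rpow_neg_one, one_mul]

/-- **Cauchy–Pompeiu formula** for compactly supported functions. -/
theorem integral_inv_mul_dbar {h : ℂ → ℂ} (hh : ContDiff ℝ 1 h) (hc : HasCompactSupport h) :
    ∫ ζ : ℂ, ζ⁻¹ * ((1 / 2 : ℂ) * (fderiv ℝ h ζ 1 + Complex.I * fderiv ℝ h ζ Complex.I)) =
      -(Real.pi * h 0) := by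
  obtain ⟨R, hR, hsub⟩ := hc.isCompact.isBounded.subset_ball_lt 0 0
  set e : ℝ → ℂ := fun θ => Real.cos θ + Real.sin θ * Complex.I with he
  have hde : ∀ θ, HasDerivAt e (Complex.I * e θ) θ := by
    intro θ
    have h1 := (Real.hasDerivAt_cos θ).ofReal_comp
    have h2 := ((Real.hasDerivAt_sin θ).ofReal_comp).mul_const Complex.I
    refine (h1.add h2).congr_deriv ?_
    simp only [he]
    push_cast
    linear_combination (-(Complex.sin θ)) * Complex.I_sq
  have hec : Continuous e := by
    simp only [he]
    fun_prop
  set D : ℂ → ℂ →L[ℝ] ℂ := fderiv ℝ h with hD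
  have hDc : Continuous D := hh.continuous_fderiv (by norm_num)
  have hD0 : ∀ ζ, R ≤ ‖ζ‖ → D ζ = 0 := by
    intro ζ hζ
    have : ζ ∉ tsupport h := fun hm => by
      have := hsub hm
      rw [mem_ball_zero_iff] at this
      linarith
    exact image_eq_zero_of_notMem_tsupport (f := D) fun h' => this (tsupport_fderiv_subset ℝ h')
  have hne : ∀ θ, ‖e θ‖ = 1 := by
    intro θ
    simp only [he]
    rw [Complex.norm_add_mul_I, Real.cos_sq_add_sin_sq, Real.sqrt_one]
  -- In polar coordinates r ζ⁻¹ ∂h/∂ζ̄ equals (∂_r h + (i/r) ∂_θ h) / 2. Below, `A` is ∂_r h, whose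
  -- integral is -2π h(0), and `B` is (1/r) ∂_θ h, which integrates to zero by periodicity.
  rw [← Complex.integral_comp_polarCoord_symm]
  have htarget : polarCoord.target = Set.Ioi (0 : ℝ) ×ˢ Set.Ioo (-Real.pi) Real.pi := rfl
  set A : ℝ × ℝ → ℂ := fun p => D (p.1 * e p.2) (e p.2) with hA
  set B : ℝ × ℝ → ℂ := fun p => D (p.1 * e p.2) (Complex.I * e p.2) with hB
  have hAc : Continuous A := by
    simp only [hA]
    exact (hDc.comp (by fun_prop)).clm_apply (by fun_prop)
  have hBc : Continuous B := by
    simp only [hB]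
    exact (hDc.comp (by fun_prop)).clm_apply (by fun_prop)
  have hint : ∀ C : ℝ × ℝ → ℂ, Continuous C → (∀ p : ℝ × ℝ, R ≤ |p.1| → C p = 0) →
      IntegrableOn C (Set.Ioi (0 : ℝ) ×ˢ Set.Ioo (-Real.pi) Real.pi) (volume.prod volume) := by
    intro C hCc hC0
    have h1 : IntegrableOn C (Set.Icc (0 : ℝ) R ×ˢ Set.Icc (-Real.pi) Real.pi) :=
      hCc.continuousOn.integrableOn_compact (isCompact_Icc.prod isCompact_Icc)
    refine h1.of_forall_sdiff_eq_zero (measurableSet_Ioi.prod measurableSet_Ioo) ?_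
    rintro ⟨r, θ⟩ ⟨⟨hr, hθ⟩, hn⟩
    refine hC0 _ ?_
    by_contra hlt
    refine hn ⟨⟨le_of_lt hr, ?_⟩, Set.Ioo_subset_Icc_self hθ⟩
    exact ((le_abs_self r).trans_lt (not_le.1 hlt)).le
  have hA0 : ∀ p : ℝ × ℝ, R ≤ |p.1| → A p = 0 := fun p hp => by
    simp only [hA]
    rw [hD0 _ (by rw [norm_mul, hne, mul_one, Complex.norm_real]; exact hp)]; rfl
  have hB0 : ∀ p : ℝ × ℝ, R ≤ |p.1| → B p = 0 := fun p hp => by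
    simp only [hB]
    rw [hD0 _ (by rw [norm_mul, hne, mul_one, Complex.norm_real]; exact hp)]; rfl
  have iA := hint A hAc hA0
  have iB := hint B hBc hB0
  have hAI : ∫ p in Set.Ioi (0 : ℝ) ×ˢ Set.Ioo (-Real.pi) Real.pi, A p ∂(volume.prod volume) =
      -(2 * Real.pi * h 0) := by
    have iA' : Integrable A ((volume.restrict (Set.Ioi (0 : ℝ))).prod
        (volume.restrict (Set.Ioo (-Real.pi) Real.pi))) := by
      rw [Measure.prod_restrict]; exact iA
    rw [← Measure.prod_restrict, integral_prod_symm _ iA']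
    have h1 : ∀ θ : ℝ, ∫ r in Set.Ioi (0 : ℝ), A (r, θ) = -h 0 := by
      intro θ
      have h2 : ∀ r : ℝ, HasDerivAt (fun r : ℝ => h (r * e θ)) (A (r, θ)) r := by
        intro r
        have h3 : HasDerivAt (fun r : ℝ => (r : ℂ) * e θ) (e θ) r := by
          simpa using (Complex.ofRealCLM.hasDerivAt (x := r)).mul_const (e θ)
        exact (hh.differentiable (by norm_num) _).hasFDerivAt.comp_hasDerivAt r h3
      have h4 : Filter.Tendsto (fun r : ℝ => h (r * e θ)) Filter.atTop (𝓝 0) := by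
        refine tendsto_const_nhds.congr' ?_
        filter_upwards [Filter.eventually_ge_atTop R] with r hr
        refine (image_eq_zero_of_notMem_tsupport fun hm => ?_).symm
        have := hsub hm
        rw [mem_ball_zero_iff, norm_mul, hne, mul_one, Complex.norm_real] at this
        exact absurd (lt_of_le_of_lt (le_abs_self r) this) (not_lt.2 hr)
      have h5 : IntegrableOn (fun r : ℝ => A (r, θ)) (Set.Ioi 0) := by
        have h6 : Continuous fun r : ℝ => A (r, θ) := by fun_prop
        refine (h6.continuousOn.integrableOn_compact
          (isCompact_Icc (a := (0 : ℝ)) (b := R))).of_forall_sdiff_eq_zero measurableSet_Ioi ?_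
        rintro r ⟨hr, hn⟩
        refine hA0 _ ?_
        by_contra hlt
        exact hn ⟨le_of_lt hr, ((le_abs_self r).trans_lt (not_le.1 hlt)).le⟩
      have h7 := integral_Ioi_of_hasDerivAt_of_tendsto' (a := 0) (fun r _ => h2 r) h5 h4
      rw [h7]
      simp
    simp only [h1, integral_const, MeasurableSet.univ, measureReal_restrict_apply,
      Set.univ_inter, Real.volume_real_Ioo_of_le (by linarith [Real.pi_pos] : -Real.pi ≤ Real.pi)]
    rw [← Complex.coe_smul, smul_eq_mul]
    push_cast
    ring
  have hBI : ∫ p in Set.Ioi (0 : ℝ) ×ˢ Set.Ioo (-Real.pi) Real.pi, B p ∂(volume.prod volume) =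
      0 := by
    have iB' : Integrable B ((volume.restrict (Set.Ioi (0 : ℝ))).prod
        (volume.restrict (Set.Ioo (-Real.pi) Real.pi))) := by
      rw [Measure.prod_restrict]; exact iB
    rw [← Measure.prod_restrict, integral_prod _ iB']
    refine setIntegral_eq_zero_of_forall_eq_zero fun r hr => ?_
    have hr0 : (r : ℂ) ≠ 0 := by exact_mod_cast (ne_of_gt hr)
    have h2 : ∀ θ : ℝ, HasDerivAt (fun θ : ℝ => (r : ℂ)⁻¹ * h (r * e θ)) (B (r, θ)) θ := by
      intro θ
      have h3 : HasDerivAt (fun θ : ℝ => (r : ℂ) * e θ) (r * (Complex.I * e θ)) θ :=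
        (hde θ).const_mul _
      have h4 : HasDerivAt (fun θ : ℝ => h (r * e θ)) (D (r * e θ) (r * (Complex.I * e θ))) θ :=
        (hh.differentiable (by norm_num) _).hasFDerivAt.comp_hasDerivAt θ h3
      refine (h4.const_mul ((r : ℂ)⁻¹)).congr_deriv ?_
      rw [← smul_eq_mul (r : ℂ) (Complex.I * e θ), Complex.coe_smul, map_smul,
        ← Complex.coe_smul, smul_eq_mul, inv_mul_cancel_left₀ hr0]
    rw [← integral_Ioc_eq_integral_Ioo,
      ← intervalIntegral.integral_of_le (by linarith [Real.pi_pos] : -Real.pi ≤ Real.pi),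
      intervalIntegral.integral_eq_sub_of_hasDerivAt (fun θ _ => h2 θ)
        ((by fun_prop : Continuous fun θ : ℝ => B (r, θ)).intervalIntegrable _ _)]
    simp [he]
  have hsplit : ∫ p in polarCoord.target, p.1 • ((Complex.polarCoord.symm p)⁻¹ *
      ((1 / 2 : ℂ) * (D (Complex.polarCoord.symm p) 1 +
        Complex.I * D (Complex.polarCoord.symm p) Complex.I))) =
      ∫ p in Set.Ioi (0 : ℝ) ×ˢ Set.Ioo (-Real.pi) Real.pi,
        ((1 / 2 : ℂ) * A p + (1 / 2 : ℂ) * (Complex.I * B p)) ∂(volume.prod volume) := by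
    rw [htarget]
    refine setIntegral_congr_fun (measurableSet_Ioi.prod measurableSet_Ioo) ?_
    rintro ⟨r, θ⟩ ⟨hr, -⟩
    have hr0 : (r : ℂ) ≠ 0 := by exact_mod_cast (ne_of_gt hr)
    simp only [Complex.polarCoord_symm_apply, hA, hB]
    change r • ((r * e θ)⁻¹ * ((1 / 2 : ℂ) * (D (r * e θ) 1 + Complex.I * D (r * e θ) Complex.I)))
      = (1 / 2 : ℂ) * D (r * e θ) (e θ) + (1 / 2 : ℂ) * (Complex.I * D (r * e θ) (Complex.I * e θ))
    set L := D (r * e θ)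
    have hL : ∀ a b : ℝ, L (a + b * Complex.I) = a * L 1 + b * L Complex.I := by
      intro a b
      have : (a + b * Complex.I : ℂ) = a • (1 : ℂ) + b • Complex.I := by simp
      rw [this, map_add, map_smul, map_smul]
      simp
    have e1 : L (e θ) = Real.cos θ * L 1 + Real.sin θ * L Complex.I := hL _ _
    have e2 : L (Complex.I * e θ) = -(Real.sin θ : ℂ) * L 1 + Real.cos θ * L Complex.I := by
      have : Complex.I * e θ = ((-Real.sin θ : ℝ) : ℂ) + (Real.cos θ : ℝ) * Complex.I := by
        simp only [he]
        push_cast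
        linear_combination (Complex.sin θ) * Complex.I_sq
      rw [this, hL]
      push_cast
      ring
    have e3 : (e θ)⁻¹ = Real.cos θ - Real.sin θ * Complex.I := by
      refine (eq_inv_of_mul_eq_one_left ?_).symm
      simp only [he]
      have := Complex.cos_sq_add_sin_sq (θ : ℂ)
      push_cast
      linear_combination this - (Complex.sin θ) ^ 2 * Complex.I_sq
    rw [e1, e2, mul_inv, e3, ← Complex.coe_smul, smul_eq_mul]
    field_simp
    linear_combination (-(Real.sin θ : ℂ) * L Complex.I) * Complex.I_sq
  rw [hsplit, integral_add, integral_const_mul, integral_const_mul, integral_const_mul, hAI, hBI]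
  · ring
  · exact iA.const_mul _
  · exact (iB.const_mul _).const_mul _

end Pompeiu

/-! ### The Cauchy transform along a complex line, with parameters -/

section CauchyTransform

open MeasureTheory

variable {V : Type*} [NormedAddCommGroup V] [NormedSpace ℝ V]

/-- The Cauchy transform of `G` along the complex direction `ℓ`. -/
noncomputable def cauchyTransform (ℓ : ℂ →L[ℝ] V) (G : V → ℂ) (x : V) : ℂ :=
  (Real.pi : ℂ)⁻¹ * ∫ ζ : ℂ, ζ⁻¹ * G (x - ℓ ζ)

/-- The derivative `∂/∂ζ̄` along the complex direction `ℓ`. -/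
noncomputable def dbarAlong (ℓ : ℂ →L[ℝ] V) (G : V → ℂ) (x : V) : ℂ :=
  (1 / 2 : ℂ) * (fderiv ℝ G x (ℓ 1) + Complex.I * fderiv ℝ G x (ℓ Complex.I))

theorem cauchyTransform_eq_convolution (ℓ : ℂ →L[ℝ] V) (G : V → ℂ) :
    cauchyTransform ℓ G = fun x => (Real.pi : ℂ)⁻¹ * convolution (fun ζ : ℂ => ζ⁻¹)
      (fun ζ => G (x + ℓ ζ)) (ContinuousLinearMap.mul ℝ ℂ) volume 0 := by
  funext x
  simp only [cauchyTransform, convolution, zero_sub, map_neg, ContinuousLinearMap.mul_apply',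
    ← sub_eq_add_neg]

variable {ℓ : ℂ →L[ℝ] V} {lam : V →L[ℝ] ℂ} {K : Set ℂ} {G : V → ℂ}

/-- The function G is supported in the slab over K and need not have compact support. As `lam`
inverts ℓ, the slab still confines ζ to a bounded set, uniformly for x in a ball. -/
theorem exists_isCompact_support (hlam : ∀ ζ, lam (ℓ ζ) = ζ) (hK : IsCompact K)
    (hG : ∀ x, lam x ∉ K → G x = 0) (x₀ : V) : ∃ k : Set ℂ, IsCompact k ∧
      ∀ x, ∀ ζ, x ∈ Metric.ball x₀ 1 → ζ ∉ k → G (x + ℓ ζ) = 0 := by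
  obtain ⟨R, hR⟩ := hK.isBounded.exists_norm_le
  refine ⟨Metric.closedBall 0 (R + ‖lam‖ * (‖x₀‖ + 1)), isCompact_closedBall _ _, ?_⟩
  intro x ζ hx hζ
  refine hG _ fun hm => hζ ?_
  have h1 := hR _ hm
  rw [map_add, hlam] at h1
  have h2 : ‖x‖ ≤ ‖x₀‖ + 1 := by
    have := norm_le_norm_add_norm_sub' x x₀
    rw [Metric.mem_ball, dist_eq_norm] at hx
    linarith
  have h3 := (lam.le_opNorm x).trans (mul_le_mul_of_nonneg_left h2 (norm_nonneg lam))
  have h4 := norm_sub_le (lam x + ζ) (lam x)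
  rw [add_sub_cancel_left] at h4
  rw [mem_closedBall_zero_iff]
  linarith

/-- All derivatives can be put on G because the kernel 1/ζ is locally integrable, so no
differentiability is lost. -/
theorem contDiff_cauchyTransform {n : ℕ} (hlam : ∀ ζ, lam (ℓ ζ) = ζ) (hK : IsCompact K)
    (hG : ∀ x, lam x ∉ K → G x = 0) (hGc : ContDiff ℝ n G) :
    ContDiff ℝ n (cauchyTransform ℓ G) := by
  rw [contDiff_iff_contDiffAt]
  intro x₀
  obtain ⟨k, hk, hsupp⟩ := exists_isCompact_support hlam hK hG x₀
  rw [cauchyTransform_eq_convolution]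
  refine contDiffAt_const.mul ?_
  have := contDiffOn_convolution_right_with_param_comp (n := n) (μ := volume)
    (ContinuousLinearMap.mul ℝ ℂ) (v := fun _ : V => (0 : ℂ)) (g := fun x ζ => G (x + ℓ ζ))
    contDiffOn_const Metric.isOpen_ball hk hsupp locallyIntegrable_inv
    (ContDiff.contDiffOn (hGc.comp (contDiff_fst.add (ℓ.contDiff.comp contDiff_snd))))
  exact this.contDiffAt (Metric.ball_mem_nhds x₀ one_pos)

theorem fderiv_cauchyTransform (hlam : ∀ ζ, lam (ℓ ζ) = ζ) (hK : IsCompact K)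
    (hG : ∀ x, lam x ∉ K → G x = 0) (hGc : ContDiff ℝ 1 G) (x v : V) :
    fderiv ℝ (cauchyTransform ℓ G) x v = cauchyTransform ℓ (fun y => fderiv ℝ G y v) x := by
  obtain ⟨k, hk, hsupp⟩ := exists_isCompact_support hlam hK hG x
  set g : V → ℂ → ℂ := fun x ζ => G (x + ℓ ζ) with hg
  have hgc : ContDiff ℝ 1 (↿g) := hGc.comp (contDiff_fst.add (ℓ.contDiff.comp contDiff_snd))
  have hd := hasFDerivAt_convolution_right_with_param (μ := volume) (ContinuousLinearMap.mul ℝ ℂ)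
    Metric.isOpen_ball hk hsupp locallyIntegrable_inv hgc.contDiffOn (x, (0 : ℂ))
    (Metric.mem_ball_self one_pos)
  have hin : HasFDerivAt (fun y : V => (y, (0 : ℂ))) (ContinuousLinearMap.inl ℝ V ℂ) x :=
    (ContinuousLinearMap.inl ℝ V ℂ).hasFDerivAt
  have hd2 := ((hd.comp x hin).const_mul ((Real.pi : ℂ)⁻¹)).fderiv
  have e0 : cauchyTransform ℓ G = fun y => (Real.pi : ℂ)⁻¹ *
      ((fun q : V × ℂ => convolution (fun ζ : ℂ => ζ⁻¹) (g q.1)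
      (ContinuousLinearMap.mul ℝ ℂ) volume q.2) ∘ fun y : V => (y, (0 : ℂ))) y :=
    cauchyTransform_eq_convolution ℓ G
  have hGx : ∀ ζ, fderiv ℝ (↿g) (x, ζ) (v, 0) = fderiv ℝ G (x + ℓ ζ) v := by
    intro ζ
    have h1 : HasFDerivAt (fun q : V × ℂ => q.1 + ℓ q.2) (ContinuousLinearMap.fst ℝ V ℂ +
        ℓ.comp (ContinuousLinearMap.snd ℝ V ℂ)) (x, ζ) :=
      (ContinuousLinearMap.fst ℝ V ℂ + ℓ.comp (ContinuousLinearMap.snd ℝ V ℂ)).hasFDerivAt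
    have h2 := HasFDerivAt.comp (g := G) (f := fun q : V × ℂ => q.1 + ℓ q.2) (x, ζ)
      (hGc.differentiable (by norm_num) (x + ℓ ζ)).hasFDerivAt h1
    change fderiv ℝ (G ∘ fun q : V × ℂ => q.1 + ℓ q.2) (x, ζ) (v, 0) = _
    rw [h2.fderiv]
    simp
  rw [e0, hd2, smul_apply, smul_eq_mul, cauchyTransform]
  congr 1
  simp only [convolution, zero_sub]
  have hcs : ∀ ζ, ζ ∉ k → fderiv ℝ (↿g) (x, ζ) = 0 := by
    intro ζ hζ
    have : (↿g) =ᶠ[𝓝 (x, ζ)] fun _ => 0 := by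
      filter_upwards [(Metric.isOpen_ball.prod hk.isClosed.isOpen_compl).mem_nhds
        (show (x, ζ) ∈ Metric.ball x 1 ×ˢ kᶜ from ⟨Metric.mem_ball_self one_pos, hζ⟩)] with q hq
      exact hsupp q.1 q.2 hq.1 hq.2
    rw [this.fderiv_eq]
    simp
  have hexists : ConvolutionExistsAt (fun ζ : ℂ => ζ⁻¹) (fun ζ => fderiv ℝ (↿g) (x, ζ)) 0
      ((ContinuousLinearMap.mul ℝ ℂ).precompR (V × ℂ)) volume := by
    refine HasCompactSupport.convolutionExists_right _ ?_ locallyIntegrable_inv ?_ 0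
    · exact HasCompactSupport.intro hk fun ζ hζ => hcs ζ hζ
    · exact (hgc.continuous_fderiv (by norm_num)).comp (by fun_prop)
  have hint := hexists.integrable
  simp only [zero_sub] at hint
  rw [ContinuousLinearMap.comp_apply, ContinuousLinearMap.integral_apply hint]
  refine integral_congr_ae (Filter.Eventually.of_forall fun ζ => ?_)
  change ζ⁻¹ * fderiv ℝ (↿g) (x, -ζ) (v, 0) = _
  rw [hGx, map_neg, ← sub_eq_add_neg]

theorem integrable_cauchyTransform (hlam : ∀ ζ, lam (ℓ ζ) = ζ) (hK : IsCompact K)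
    (hG : ∀ x, lam x ∉ K → G x = 0) (hGc : Continuous G) (x : V) :
    Integrable fun ζ : ℂ => ζ⁻¹ * G (x - ℓ ζ) := by
  obtain ⟨k, hk, hsupp⟩ := exists_isCompact_support hlam hK hG x
  have hexists : ConvolutionExistsAt (fun ζ : ℂ => ζ⁻¹) (fun ζ => G (x + ℓ ζ)) 0
      (ContinuousLinearMap.mul ℝ ℂ) volume := by
    refine HasCompactSupport.convolutionExists_right _ ?_ locallyIntegrable_inv ?_ 0
    · exact HasCompactSupport.intro hk fun ζ hζ => hsupp x ζ (Metric.mem_ball_self one_pos) hζ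
    · exact hGc.comp (by fun_prop)
  simpa [sub_eq_add_neg] using hexists.integrable

theorem cauchyTransform_add {G₁ G₂ : V → ℂ} {x : V}
    (h₁ : Integrable fun ζ : ℂ => ζ⁻¹ * G₁ (x - ℓ ζ))
    (h₂ : Integrable fun ζ : ℂ => ζ⁻¹ * G₂ (x - ℓ ζ)) :
    cauchyTransform ℓ (fun y => G₁ y + G₂ y) x =
      cauchyTransform ℓ G₁ x + cauchyTransform ℓ G₂ x := by
  simp only [cauchyTransform, mul_add]
  rw [integral_add h₁ h₂, mul_add]

theorem cauchyTransform_const_mul (c : ℂ) (G : V → ℂ) (x : V) :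
    cauchyTransform ℓ (fun y => c * G y) x = c * cauchyTransform ℓ G x := by
  simp only [cauchyTransform, mul_left_comm _ c, integral_const_mul]

theorem fderiv_eq_zero_of_support (hK : IsCompact K) (hG : ∀ x, lam x ∉ K → G x = 0) (x : V)
    (hx : lam x ∉ K) : fderiv ℝ G x = 0 := by
  have : G =ᶠ[𝓝 x] fun _ => 0 := by
    filter_upwards [(hK.isClosed.isOpen_compl.preimage lam.continuous).mem_nhds hx] with y hy
    exact hG y hy
  rw [this.fderiv_eq]
  simp

theorem dbarAlong_cauchyTransform (hlam : ∀ ζ, lam (ℓ ζ) = ζ) (hK : IsCompact K)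
    (hG : ∀ x, lam x ∉ K → G x = 0) (hGc : ContDiff ℝ 1 G) (κ : ℂ →L[ℝ] V) (x : V) :
    dbarAlong κ (cauchyTransform ℓ G) x = cauchyTransform ℓ (dbarAlong κ G) x := by
  have hint : ∀ v, Integrable fun ζ : ℂ => ζ⁻¹ * fderiv ℝ G (x - ℓ ζ) v := fun v =>
    integrable_cauchyTransform (G := fun y => fderiv ℝ G y v) hlam hK
      (fun y hy => by simp [fderiv_eq_zero_of_support hK hG y hy])
      ((hGc.continuous_fderiv (by norm_num)).clm_apply continuous_const) x
  have hI : Integrable fun ζ : ℂ => ζ⁻¹ * (Complex.I * fderiv ℝ G (x - ℓ ζ) (κ Complex.I)) :=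
    ((hint (κ Complex.I)).const_mul Complex.I).congr
      (Filter.Eventually.of_forall fun ζ => mul_left_comm _ _ _)
  have h1 := cauchyTransform_const_mul (ℓ := ℓ) (1 / 2)
    (fun y => fderiv ℝ G y (κ 1) + Complex.I * fderiv ℝ G y (κ Complex.I)) x
  have h2 := cauchyTransform_add (G₁ := fun y => fderiv ℝ G y (κ 1))
    (G₂ := fun y => Complex.I * fderiv ℝ G y (κ Complex.I)) (hint (κ 1)) hI
  have h3 := cauchyTransform_const_mul (ℓ := ℓ) Complex.I (fun y => fderiv ℝ G y (κ Complex.I)) x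
  have h4 : dbarAlong κ G = fun y => (1 / 2 : ℂ) *
    (fderiv ℝ G y (κ 1) + Complex.I * fderiv ℝ G y (κ Complex.I)) := rfl
  rw [h4, h1, h2, h3, dbarAlong, fderiv_cauchyTransform hlam hK hG hGc,
    fderiv_cauchyTransform hlam hK hG hGc]

/-- This is the Cauchy–Pompeiu formula for ζ ↦ G(x - ℓ ζ). As ∂̄ commutes with the transform, it
says that the transform solves ∂U/∂ζ̄ = G. -/
theorem cauchyTransform_dbarAlong (hlam : ∀ ζ, lam (ℓ ζ) = ζ) (hK : IsCompact K)
    (hG : ∀ x, lam x ∉ K → G x = 0) (hGc : ContDiff ℝ 1 G) (x : V) :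
    cauchyTransform ℓ (dbarAlong ℓ G) x = G x := by
  obtain ⟨k, hk, hsupp⟩ := exists_isCompact_support hlam hK hG x
  set h : ℂ → ℂ := fun ζ => G (x - ℓ ζ) with hh
  have hc : HasCompactSupport h := by
    refine HasCompactSupport.intro (hk.neg) fun ζ hζ => ?_
    have := hsupp x (-ζ) (Metric.mem_ball_self one_pos) (by simpa using hζ)
    simpa [hh, sub_eq_add_neg] using this
  have hhc : ContDiff ℝ 1 h := hGc.comp (by fun_prop)
  have hP := integral_inv_mul_dbar hhc hc
  have hd : ∀ ζ v, fderiv ℝ h ζ v = -fderiv ℝ G (x - ℓ ζ) (ℓ v) := by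
    intro ζ v
    have h1 : HasFDerivAt (fun ζ => x - ℓ ζ) (-ℓ) ζ := ℓ.hasFDerivAt.const_sub x
    have h2 : HasFDerivAt h _ ζ :=
      (hGc.differentiable (by norm_num) (x - ℓ ζ)).hasFDerivAt.comp ζ h1
    rw [h2.fderiv]
    simp
  have e : ∀ ζ : ℂ, ζ⁻¹ * ((1 / 2 : ℂ) * (fderiv ℝ h ζ 1 + Complex.I * fderiv ℝ h ζ Complex.I)) =
      -(ζ⁻¹ * dbarAlong ℓ G (x - ℓ ζ)) := by
    intro ζ
    rw [hd, hd, dbarAlong]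
    ring
  simp only [e, integral_neg, neg_inj] at hP
  rw [cauchyTransform, hP]
  have : h 0 = G x := by simp [hh]
  rw [this, inv_mul_cancel_left₀]
  exact_mod_cast Real.pi_ne_zero

end CauchyTransform

/-! ### The Dolbeault–Poincaré lemma along leaves -/

section Poincare

variable {V ι : Type*} [NormedAddCommGroup V] [NormedSpace ℝ V]

theorem dbarAlong_mul {ℓ : ℂ →L[ℝ] V} {g₁ g₂ : V → ℂ} {x : V} (h₁ : DifferentiableAt ℝ g₁ x)
    (h₂ : DifferentiableAt ℝ g₂ x) : dbarAlong ℓ (fun y => g₁ y * g₂ y) x =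
      dbarAlong ℓ g₁ x * g₂ x + g₁ x * dbarAlong ℓ g₂ x := by
  simp only [dbarAlong, fderiv_fun_mul h₁ h₂, add_apply, smul_apply, smul_eq_mul]
  ring

theorem dbarAlong_add {ℓ : ℂ →L[ℝ] V} {g₁ g₂ : V → ℂ} {x : V} (h₁ : DifferentiableAt ℝ g₁ x)
    (h₂ : DifferentiableAt ℝ g₂ x) : dbarAlong ℓ (fun y => g₁ y + g₂ y) x =
      dbarAlong ℓ g₁ x + dbarAlong ℓ g₂ x := by
  simp only [dbarAlong, fderiv_fun_add h₁ h₂, add_apply]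
  ring

theorem dbarAlong_sub {ℓ : ℂ →L[ℝ] V} {g₁ g₂ : V → ℂ} {x : V} (h₁ : DifferentiableAt ℝ g₁ x)
    (h₂ : DifferentiableAt ℝ g₂ x) : dbarAlong ℓ (fun y => g₁ y - g₂ y) x =
      dbarAlong ℓ g₁ x - dbarAlong ℓ g₂ x := by
  simp only [dbarAlong, fderiv_fun_sub h₁ h₂, sub_apply]
  ring

/-- An identity valid only on S may be differentiated along ℓ, because S contains the whole ℓ-line
through each of its points. -/
theorem dbarAlong_congr_of_translate {ℓ : ℂ →L[ℝ] V} {g₁ g₂ : V → ℂ} {x : V} {S : Set V}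
    (hS : ∀ y ∈ S, ∀ ζ, y + ℓ ζ ∈ S) (hx : x ∈ S) (h₁ : DifferentiableAt ℝ g₁ x)
    (h₂ : DifferentiableAt ℝ g₂ x) (h : ∀ᶠ y in 𝓝 x, y ∈ S → g₁ y = g₂ y) :
    dbarAlong ℓ g₁ x = dbarAlong ℓ g₂ x := by
  have hc : Filter.Tendsto (fun ζ => x + ℓ ζ) (𝓝 0) (𝓝 x) := by
    have : Continuous fun ζ => x + ℓ ζ := by fun_prop
    simpa using this.tendsto 0
  have he : (fun ζ => g₁ (x + ℓ ζ)) =ᶠ[𝓝 0] fun ζ => g₂ (x + ℓ ζ) := by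
    filter_upwards [hc.eventually h] with ζ hζ
    exact hζ (hS x hx ζ)
  have hd : ∀ g : V → ℂ, DifferentiableAt ℝ g x → ∀ v,
      fderiv ℝ (fun ζ => g (x + ℓ ζ)) 0 v = fderiv ℝ g x (ℓ v) := by
    intro g hg v
    have h1 : HasFDerivAt (fun ζ => x + ℓ ζ) ℓ 0 := ℓ.hasFDerivAt.const_add x
    have h2 : HasFDerivAt g (fderiv ℝ g x) (x + ℓ 0) := by simpa using hg.hasFDerivAt
    rw [(HasFDerivAt.comp (0 : ℂ) h2 h1).fderiv (f := fun ζ => g (x + ℓ ζ))]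
    rfl
  have := he.fderiv_eq (𝕜 := ℝ)
  simp only [dbarAlong, ← hd _ h₁, ← hd _ h₂, this]

theorem contDiff_dbarAlong {n : ℕ} (ℓ : ℂ →L[ℝ] V) {g : V → ℂ} (hg : ContDiff ℝ (n + 1 : ℕ) g) :
    ContDiff ℝ n (dbarAlong ℓ g) := by
  have h : ∀ v, ContDiff ℝ n fun x => fderiv ℝ g x v := fun v =>
    (hg.fderiv_right (m := n) (by norm_cast)).clm_apply contDiff_const
  exact contDiff_const.mul ((h _).add (contDiff_const.mul (h _)))

theorem dbarAlong_comm {ℓ κ : ℂ →L[ℝ] V} {g : V → ℂ} (hg : ContDiff ℝ 2 g) (x : V) :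
    dbarAlong ℓ (dbarAlong κ g) x = dbarAlong κ (dbarAlong ℓ g) x := by
  have hsym : IsSymmSndFDerivAt ℝ g x := hg.contDiffAt.isSymmSndFDerivAt (by simp)
  have hd : DifferentiableAt ℝ (fderiv ℝ g) x :=
    (hg.fderiv_right (m := 1) (by norm_num)).differentiable (by norm_num) x
  have h1 : ∀ v, HasFDerivAt (fun y => fderiv ℝ g y v) ((fderiv ℝ (fderiv ℝ g) x).flip v) x := by
    intro v
    exact (ContinuousLinearMap.apply ℝ ℂ v).hasFDerivAt.comp x hd.hasFDerivAt
  have h2 : ∀ (κ : ℂ →L[ℝ] V) (u : V), fderiv ℝ (dbarAlong κ g) x u = (1 / 2 : ℂ) *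
      (fderiv ℝ (fderiv ℝ g) x u (κ 1) + Complex.I * fderiv ℝ (fderiv ℝ g) x u (κ Complex.I)) := by
    intro κ u
    have h3 := (((h1 (κ 1)).fun_add ((h1 (κ Complex.I)).const_mul Complex.I)).const_mul
      (1 / 2 : ℂ)).fderiv
    change fderiv ℝ (fun y => (1 / 2 : ℂ) * (fderiv ℝ g y (κ 1) +
      Complex.I * fderiv ℝ g y (κ Complex.I))) x u = _
    rw [h3]
    rfl
  simp only [dbarAlong] at h2 ⊢
  rw [h2 κ, h2 κ, h2 ℓ, h2 ℓ, hsym.eq (ℓ 1) (κ 1), hsym.eq (ℓ 1) (κ Complex.I),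
    hsym.eq (ℓ Complex.I) (κ 1), hsym.eq (ℓ Complex.I) (κ Complex.I)]
  ring

/-- **The Dolbeault–Poincaré lemma with parameters**: a system `∂u/∂ζ̄ᵢ = aᵢ` whose compatibility
conditions hold along the leaves contained in a set `S` is solvable along these leaves, without
loss of differentiability. -/
theorem exists_dbarAlong_eq [FiniteDimensional ℝ V] [Finite ι] {m : ℕ} (hm : 2 ≤ m)
    (ℓ : ι → ℂ →L[ℝ] V) (lam : ι → V →L[ℝ] ℂ)
    (hlam : ∀ i ζ, lam i (ℓ i ζ) = ζ) (hoff : ∀ i j, i ≠ j → ∀ ζ, lam i (ℓ j ζ) = 0) {S : Set V}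
    (hS : ∀ i, ∀ y ∈ S, ∀ ζ, y + ℓ i ζ ∈ S) (a : ι → V → ℂ) (ha : ∀ i, ContDiff ℝ m (a i))
    (hcl : ∀ᶠ x in 𝓝 (0 : V), x ∈ S →
      ∀ i j, dbarAlong (ℓ i) (a j) x = dbarAlong (ℓ j) (a i) x) :
    ∃ u : V → ℂ, ContDiff ℝ m u ∧ ∀ᶠ x in 𝓝 (0 : V), x ∈ S → ∀ i, dbarAlong (ℓ i) u x = a i x := by
  classical
  have := Fintype.ofFinite ι
  -- Induction on the set s of indices whose right-hand side may be nonzero on S near 0; each step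
  -- eliminates one index.
  suffices H : ∀ (s : Finset ι) (a : ι → V → ℂ), (∀ i, ContDiff ℝ m (a i)) →
      (∀ᶠ x in 𝓝 (0 : V), x ∈ S → ∀ i j, dbarAlong (ℓ i) (a j) x = dbarAlong (ℓ j) (a i) x) →
      (∀ᶠ x in 𝓝 (0 : V), x ∈ S → ∀ i ∉ s, a i x = 0) →
      ∃ u : V → ℂ, ContDiff ℝ m u ∧
        ∀ᶠ x in 𝓝 (0 : V), x ∈ S → ∀ i, dbarAlong (ℓ i) u x = a i x from
    H Finset.univ a ha hcl (Filter.Eventually.of_forall fun x _ i hi => absurd (Finset.mem_univ i) hi)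
  clear hcl ha a
  intro s
  induction s using Finset.induction_on with
  | empty =>
    intro a _ _ h0
    refine ⟨fun _ => 0, contDiff_const, h0.mono fun x hx hxS i => ?_⟩
    rw [hx hxS i (by simp)]
    simp [dbarAlong]
  | insert k s hks ih =>
    intro a ha hcl h0
    have hm1 : (1 : WithTop ℕ∞) ≤ (m : ℕ) := by exact_mod_cast (by omega : 1 ≤ m)
    have hm2 : (2 : WithTop ℕ∞) ≤ (m : ℕ) := by exact_mod_cast hm
    obtain ⟨δ, hδ, hball⟩ := Metric.eventually_nhds_iff_ball.1 (hcl.and h0)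
    -- With ‖ℓ k‖ ε ≤ δ/2, the points of the slab on the line through a point x near 0 stay in the
    -- ball where the hypotheses hold.
    set ε : ℝ := δ / (2 * (‖ℓ k‖ + 1)) with hε
    have hεp : 0 < ε := by positivity
    let χ : ContDiffBump (0 : ℂ) := ⟨ε / 2, ε, by positivity, by linarith⟩
    set X : V → ℂ := fun x => ((χ (lam k x) : ℝ) : ℂ) with hX
    have hXc : ContDiff ℝ ∞ X := Complex.ofRealCLM.contDiff.comp (χ.contDiff.comp (lam k).contDiff)
    have hXm : ContDiff ℝ (m + 1 : ℕ) X := hXc.of_le (by exact_mod_cast le_top)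
    set Y : V → ℂ := dbarAlong (ℓ k) X with hY
    have hYc : ContDiff ℝ m Y := contDiff_dbarAlong (ℓ k) hXm
    set K : Set ℂ := Metric.closedBall 0 ε with hK
    have hKc : IsCompact K := isCompact_closedBall _ _
    have hX0 : ∀ x, lam k x ∉ K → X x = 0 := by
      intro x hx
      have : χ (lam k x) = 0 := image_eq_zero_of_notMem_tsupport (by rw [χ.tsupport_eq]; exact hx)
      simp [hX, this]
    have hY0 : ∀ x, lam k x ∉ K → Y x = 0 := by
      intro x hx
      simp [hY, dbarAlong, fderiv_eq_zero_of_support hKc hX0 x hx]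
    have hXoff : ∀ j, j ≠ k → ∀ x, dbarAlong (ℓ j) X x = 0 := by
      intro j hj x
      have h1 : ∀ ζ, fderiv ℝ X x (ℓ j ζ) = 0 := by
        intro ζ
        have h2 : DifferentiableAt ℝ (fun z : ℂ => ((χ z : ℝ) : ℂ)) (lam k x) :=
          (Complex.ofRealCLM.contDiff.comp (χ.contDiff (n := 1))).differentiable (by norm_num) _
        have h3 : HasFDerivAt X _ x := h2.hasFDerivAt.comp x (lam k).hasFDerivAt
        rw [h3.fderiv, ContinuousLinearMap.comp_apply, hoff k j hj.symm, map_zero]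
      simp [dbarAlong, h1]
    have hX1 : ∀ᶠ x in 𝓝 (0 : V), X x = 1 := by
      have h1 : Filter.Tendsto (lam k) (𝓝 0) (𝓝 0) := by
        simpa using (lam k).continuous.tendsto 0
      filter_upwards [h1.eventually χ.eventuallyEq_one] with x hx
      simp [hX, hx]
    have had : ∀ i x, DifferentiableAt ℝ (a i) x := fun i x =>
      (ha i).differentiable (by positivity) x
    have hXd : ∀ x, DifferentiableAt ℝ X x := fun x => hXc.differentiable (by simp) x
    set G : ι → V → ℂ := fun i x => X x * a i x with hG
    set H : ι → V → ℂ := fun i x => Y x * a i x with hH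
    have hGc : ∀ i, ContDiff ℝ m (G i) := fun i =>
      (hXm.of_le (by exact_mod_cast Nat.le_succ m)).mul (ha i)
    have hHc : ∀ i, ContDiff ℝ m (H i) := fun i => hYc.mul (ha i)
    have hG0 : ∀ i x, lam k x ∉ K → G i x = 0 := fun i x hx => by simp [hG, hX0 x hx]
    have hH0 : ∀ i x, lam k x ∉ K → H i x = 0 := fun i x hx => by simp [hH, hY0 x hx]
    set U : V → ℂ := cauchyTransform (ℓ k) (G k) with hU
    have hUc : ContDiff ℝ m U := contDiff_cauchyTransform (hlam k) hKc (hG0 k) (hGc k)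
    -- On S near 0 this is the remainder aᵢ - ∂̄ᵢU, with the k-th one gone. Defined by the
    -- difference it would be visibly only C^(m-1); as a Cauchy transform of (∂̄ₖX) aᵢ it is C^m.
    set a' : ι → V → ℂ := fun i => if i = k then fun _ => 0 else cauchyTransform (ℓ k) (H i)
      with ha'
    have ha'c : ∀ i, ContDiff ℝ m (a' i) := by
      intro i
      by_cases hi : i = k
      · simp only [ha', hi, if_true]
        exact contDiff_const
      · simp only [ha', hi, if_false]
        exact contDiff_cauchyTransform (hlam k) hKc (hH0 i) (hHc i)
    -- points on which the Cauchy transform depends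
    have hnear : ∀ᶠ x in 𝓝 (0 : V), ∀ ζ, lam k (x - ℓ k ζ) ∈ K → x - ℓ k ζ ∈ Metric.ball 0 δ := by
      have hcont : Filter.Tendsto (fun x : V => ‖x‖ + ‖ℓ k‖ * ‖lam k x‖) (𝓝 0) (𝓝 0) := by
        have : Continuous fun x : V => ‖x‖ + ‖ℓ k‖ * ‖lam k x‖ := by fun_prop
        simpa using this.tendsto 0
      filter_upwards [hcont.eventually (gt_mem_nhds (half_pos hδ))] with x hx ζ hζ
      rw [map_sub, hlam, hK, mem_closedBall_zero_iff] at hζ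
      have h1 : ‖ζ‖ ≤ ‖lam k x‖ + ε := by
        have := norm_sub_le (lam k x) (lam k x - ζ)
        rw [sub_sub_cancel] at this
        linarith
      have h2 := (ℓ k).le_opNorm ζ
      have h3 := mul_le_mul_of_nonneg_left h1 (norm_nonneg (ℓ k))
      have h4 := norm_sub_le x (ℓ k ζ)
      have h5 : ‖ℓ k‖ * ε ≤ δ / 2 := by
        have : (‖ℓ k‖ + 1) * ε = δ / 2 := by
          rw [hε]
          field_simp
        nlinarith
      rw [mem_ball_zero_iff]
      rw [mul_add] at h3
      linarith
    have htrans : ∀ x ∈ S, ∀ ζ, x - ℓ k ζ ∈ S := fun x hx ζ => by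
      have := hS k x hx (-ζ)
      rwa [map_neg, ← sub_eq_add_neg] at this
    have hUd : ∀ᶠ x in 𝓝 (0 : V), x ∈ S → ∀ i, dbarAlong (ℓ i) U x = a i x - a' i x := by
      filter_upwards [hnear, hX1] with x hx hx1 hxS i
      have hGx : ∀ i, G i x = a i x := fun i => by simp [hG, hx1]
      rw [hU, dbarAlong_cauchyTransform (hlam k) hKc (hG0 k) ((hGc k).of_le hm1)]
      by_cases hi : i = k
      · subst hi
        rw [cauchyTransform_dbarAlong (hlam i) hKc (hG0 i) ((hGc i).of_le hm1), hGx]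
        simp [ha']
      -- The cutoff X depends only on the k-th coordinate, so compatibility on S gives ∂̄ᵢ(X aₖ) = X
      -- ∂̄ₖaᵢ = ∂̄ₖ(X aᵢ) - (∂̄ₖX) aᵢ.
      · have e1 : cauchyTransform (ℓ k) (dbarAlong (ℓ i) (G k)) x =
            cauchyTransform (ℓ k) (fun y => dbarAlong (ℓ k) (G i) y + (-1) * H i y) x := by
          simp only [cauchyTransform]
          congr 2
          funext ζ
          congr 1
          set y := x - ℓ k ζ with hy
          by_cases hyK : lam k y ∈ K
          · have hyb := (hball y (hx ζ hyK)).1 (htrans x hxS ζ)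
            simp only [hG, hH]
            rw [dbarAlong_mul (hXd y) (had k y), dbarAlong_mul (hXd y) (had i y), hXoff i hi,
              hyb i k]
            simp only [← hY]
            ring
          · have h1 : ∀ j, fderiv ℝ (G j) y = 0 := fun j =>
              fderiv_eq_zero_of_support hKc (hG0 j) y hyK
            simp [dbarAlong, h1, hH0 i y hyK]
        have hm1' : ContDiff ℝ (0 + 1 : ℕ) (G i) := (hGc i).of_le (by simpa using hm1)
        rw [e1, cauchyTransform_add, cauchyTransform_const_mul,
          cauchyTransform_dbarAlong (hlam k) hKc (hG0 i) ((hGc i).of_le hm1), hGx]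
        · simp only [ha', hi, if_false]
          ring
        · refine integrable_cauchyTransform (hlam k) hKc (fun y hy => ?_)
            (contDiff_dbarAlong (n := 0) (ℓ k) hm1').continuous x
          simp [dbarAlong, fderiv_eq_zero_of_support hKc (hG0 i) y hy]
        · refine integrable_cauchyTransform (G := fun y => -1 * H i y) (hlam k) hKc
            (fun y hy => ?_) (continuous_const.mul (hHc i).continuous) x
          simp [hH0 i y hy]
    have ha'd : ∀ i x, DifferentiableAt ℝ (a' i) x := fun i x =>
      (ha'c i).differentiable (by positivity) x
    have hUdd : ∀ i x, DifferentiableAt ℝ (dbarAlong (ℓ i) U) x := fun i x =>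
      (contDiff_dbarAlong (n := 1) (ℓ i) (hUc.of_le (by exact_mod_cast hm))).differentiable
        (by norm_num) x
    obtain ⟨u, huc, hu⟩ := ih a' ha'c (by
      filter_upwards [hcl, hUd.eventually_nhds] with x hx hx2 hxS i j
      -- Compatibility passes to the remainders because ∂̄ᵢ∂̄ⱼU is symmetric, which uses m ≥ 2.
      have key : ∀ i j, dbarAlong (ℓ i) (a' j) x =
          dbarAlong (ℓ i) (a j) x - dbarAlong (ℓ i) (dbarAlong (ℓ j) U) x := by
        intro i j
        rw [← dbarAlong_sub (had j x) (hUdd j x)]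
        refine dbarAlong_congr_of_translate (hS i) hxS (ha'd j x) ((had j x).sub (hUdd j x)) ?_
        filter_upwards [hx2] with y hy hyS
        rw [hy hyS j]
        ring
      rw [key, key, hx hxS i j, dbarAlong_comm (hUc.of_le hm2)]) (by
      filter_upwards [hnear] with x hx hxS i hi
      by_cases hik : i = k
      · simp [ha', hik]
      · simp only [ha', hik, if_false, cauchyTransform]
        rw [MeasureTheory.integral_eq_zero_of_ae, mul_zero]
        refine Filter.Eventually.of_forall fun ζ => ?_
        by_cases hyK : lam k (x - ℓ k ζ) ∈ K
        · have := (hball _ (hx ζ hyK)).2 (htrans x hxS ζ) i (by simp [hik, hi])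
          simp [hH, this]
        · simp [hH0 i _ hyK])
    refine ⟨fun x => U x + u x, hUc.add huc, ?_⟩
    filter_upwards [hUd, hu] with x h1 h2 hxS i
    rw [dbarAlong_add (hUc.differentiable (by positivity) x) (huc.differentiable (by positivity) x),
      h1 hxS i, h2 hxS i]
    ring

end Poincare

/-! ### Superposition operators on spaces of continuous curves -/

section Nemytskii

open Set ContinuousMap

universe u

/-- Pointwise application of continuous families of continuous linear maps. -/
noncomputable def pointwiseApply (T E F : Type*) [TopologicalSpace T] [CompactSpace T]
    [NormedAddCommGroup E] [NormedSpace ℝ E] [NormedAddCommGroup F] [NormedSpace ℝ F] :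
    C(T, E →L[ℝ] F) →L[ℝ] C(T, E) →L[ℝ] C(T, F) :=
  LinearMap.mkContinuous₂
    (LinearMap.mk₂ ℝ
      (fun (A : C(T, E →L[ℝ] F)) (h : C(T, E)) =>
        (⟨fun t => A t (h t), A.continuous.clm_apply h.continuous⟩ : C(T, F)))
      (fun _ _ _ => by ext; simp) (fun _ _ _ => by ext; simp) (fun _ _ _ => by ext; simp)
      (fun _ _ _ => by ext; simp)) 1 fun A h => by
    rw [one_mul]
    refine (ContinuousMap.norm_le _ (by positivity)).2 fun t => ?_
    exact (ContinuousLinearMap.le_opNorm _ _).trans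
      (mul_le_mul (A.norm_coe_le_norm t) (h.norm_coe_le_norm t) (norm_nonneg _) (by positivity))

/-- The embedding of a space as the constant functions. -/
noncomputable def constCLM (T E : Type*) [TopologicalSpace T] [CompactSpace T]
    [NormedAddCommGroup E] [NormedSpace ℝ E] : E →L[ℝ] C(T, E) :=
  LinearMap.mkContinuous
    { toFun := fun x => ContinuousMap.const T x
      map_add' := fun _ _ => rfl
      map_smul' := fun _ _ => rfl } 1 fun x => by
    rw [one_mul]
    exact (ContinuousMap.norm_le _ (norm_nonneg x)).2 fun t => le_rfl

variable {T : Type*} [TopologicalSpace T] [CompactSpace T]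

/-- The mean value inequality on the segments from γ(t) to γ(t) + h(t) is uniform in t, since γ ↦ g'
∘ γ is continuous for the sup norm. -/
theorem hasFDerivAt_postcomp {E F : Type*} [NormedAddCommGroup E] [NormedSpace ℝ E]
    [NormedAddCommGroup F] [NormedSpace ℝ F] (g : C(E, F)) (g' : C(E, E →L[ℝ] F))
    (hg : ∀ x, HasFDerivAt g (g' x) x) (γ : C(T, E)) :
    HasFDerivAt (fun γ : C(T, E) => g.comp γ) (pointwiseApply T E F (g'.comp γ)) γ := by
  rw [hasFDerivAt_iff_isLittleO_nhds_zero, Asymptotics.isLittleO_iff]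
  intro ε hε
  have hc : Continuous fun h : C(T, E) => g'.comp (γ + h) :=
    (continuous_postcomp g').comp (continuous_const.add continuous_id)
  have hev : ∀ᶠ h in 𝓝 (0 : C(T, E)), g'.comp (γ + h) ∈ Metric.ball (g'.comp (γ + 0)) ε :=
    hc.continuousAt (Metric.ball_mem_nhds (g'.comp (γ + 0)) hε)
  obtain ⟨δ, hδ, hb⟩ := Metric.eventually_nhds_iff.1 hev
  filter_upwards [Metric.ball_mem_nhds (0 : C(T, E)) hδ] with h hh
  rw [mem_ball_zero_iff] at hh
  refine (ContinuousMap.norm_le _ (by positivity)).2 fun t => ?_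
  have key : ∀ y ∈ segment ℝ (γ t) (γ t + h t), ‖g' y - g' (γ t)‖ ≤ ε := by
    intro y hy
    rw [segment_eq_image'] at hy
    obtain ⟨s, hs, rfl⟩ := hy
    have h1 : dist (s • h) 0 < δ := by
      rw [dist_zero_right, norm_smul, Real.norm_of_nonneg hs.1]
      exact (mul_le_of_le_one_left (norm_nonneg _) hs.2).trans_lt hh
    have h2 := ((ContinuousMap.dist_lt_iff hε).1 (hb h1) t).le
    simpa [dist_eq_norm] using h2
  have h3 := (convex_segment (γ t) (γ t + h t)).norm_image_sub_le_of_norm_hasFDerivWithin_le'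
    (fun y _ => (hg y).hasFDerivWithinAt) key (left_mem_segment ℝ _ _) (right_mem_segment ℝ _ _)
  rw [add_sub_cancel_left] at h3
  exact h3.trans (mul_le_mul_of_nonneg_left (h.norm_coe_le_norm t) hε.le)

/-- Superposition operators on spaces of continuous functions are as smooth as their symbol. -/
theorem contDiff_postcomp {E : Type u} [NormedAddCommGroup E] [NormedSpace ℝ E] (n : ℕ) :
    ∀ {F : Type u} [NormedAddCommGroup F] [NormedSpace ℝ F] (g : C(E, F)),
      ContDiff ℝ n g → ContDiff ℝ n fun γ : C(T, E) => g.comp γ := by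
  induction n with
  | zero =>
    intro F _ _ g _
    exact contDiff_zero.2 (continuous_postcomp g)
  | succ n ih =>
    intro F _ _ g hg
    have hg1 := hg.fderiv_right (m := n) (by norm_cast)
    let g' : C(E, E →L[ℝ] F) := ⟨fderiv ℝ g, hg1.continuous⟩
    have hL : ContDiff ℝ n (pointwiseApply T E F) :=
      ContinuousLinearMap.contDiff (𝕜 := ℝ) (E := C(T, E →L[ℝ] F)) (F := C(T, E) →L[ℝ] C(T, F))
        (pointwiseApply T E F)
    have h : ContDiff ℝ n fun γ : C(T, E) => pointwiseApply T E F (g'.comp γ) :=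
      hL.comp (ih g' hg1)
    refine (contDiff_succ_iff_hasFDerivAt (𝕜 := ℝ) (n := n)).2 ⟨_, h, fun γ => ?_⟩
    exact hasFDerivAt_postcomp g _
      (fun x => (hg.differentiable (by simp) x).hasFDerivAt) γ

end Nemytskii

/-! ### Smooth dependence of integral curves, by the implicit function theorem -/

section RadialFlow

open Set MeasureTheory

universe u

/-- The primitive vanishing at `0` of a continuous function on the unit interval. -/
noncomputable def primitive (E : Type*) [NormedAddCommGroup E] [NormedSpace ℝ E] :
    C(Icc (0 : ℝ) 1, E) →L[ℝ] C(Icc (0 : ℝ) 1, E) :=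
  LinearMap.mkContinuous
    { toFun := fun γ => ⟨fun t => ∫ s in (0 : ℝ)..t, γ (projIcc 0 1 zero_le_one s),
        (intervalIntegral.continuous_primitive (fun a b =>
          (γ.continuous.comp continuous_projIcc).intervalIntegrable a b) 0).comp
            continuous_subtype_val⟩
      map_add' := fun γ₁ γ₂ => by
        ext t
        exact intervalIntegral.integral_add
          ((γ₁.continuous.comp continuous_projIcc).intervalIntegrable _ _)
          ((γ₂.continuous.comp continuous_projIcc).intervalIntegrable _ _)
      map_smul' := fun c γ => by
        ext t
        exact intervalIntegral.integral_smul c _ } 1 fun γ => by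
    rw [one_mul]
    refine (ContinuousMap.norm_le _ (by positivity)).2 fun t => ?_
    refine (intervalIntegral.norm_integral_le_of_norm_le_const
      (fun s _ => γ.norm_coe_le_norm _)).trans ?_
    rw [sub_zero, abs_of_nonneg t.2.1]
    exact mul_le_of_le_one_right (norm_nonneg _) t.2.2

variable {E K : Type u} {Q : Type*} [NormedAddCommGroup E] [NormedSpace ℝ E] [CompleteSpace E]
  [NormedAddCommGroup K] [NormedSpace ℝ K] [CompleteSpace K]
  [NormedAddCommGroup Q] [NormedSpace ℝ Q] [CompleteSpace Q]

/-- Integral curves of the vector fields `A(·) z`, `z ∈ K`, written in terms of their end points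
`Ψ`: for a `C^m` field `A` there is a `C^m` solution of the radial equation
`DΨ(z, q)(z, 0) = A(Ψ(z, q)) z` with `Ψ(0, q) = y₀ + B q`. -/
theorem exists_radial_solution {m : ℕ} (hm : 1 ≤ m) {A : E → K →L[ℝ] E} (hA : ContDiff ℝ m A)
    (y₀ : E) (B : Q →L[ℝ] E) : ∃ Ψ : K × Q → E, ContDiffAt ℝ m Ψ 0 ∧
      (∀ᶠ q in 𝓝 (0 : Q), Ψ (0, q) = y₀ + B q) ∧
      ∀ᶠ p in 𝓝 (0 : K × Q), fderiv ℝ Ψ p (p.1, 0) = A (Ψ p) p.1 := by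
  have hm0 : (m : WithTop ℕ∞) ≠ 0 := by exact_mod_cast (by omega : m ≠ 0)
  let I := Icc (0 : ℝ) 1
  let cst : E →L[ℝ] C(I, E) := constCLM I E
  let cstK : K →L[ℝ] C(I, K) := constCLM I K
  let A' : C(E, K →L[ℝ] E) := ⟨A, hA.continuous⟩
  -- Zeros of F are the curves with γ(t) = y₀ + Bq + ∫₀ᵗ A(γ) z; the implicit function theorem in
  -- the space of curves gives C^m dependence on (z, q).
  let F : (K × Q) × C(I, E) → C(I, E) := fun x =>
    x.2 - cst (y₀ + B x.1.2) - primitive E (pointwiseApply I K E (A'.comp x.2) (cstK x.1.1))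
  have hNA : ContDiff ℝ m fun γ : C(I, E) => A'.comp γ := contDiff_postcomp m A' hA
  have hF : ContDiff ℝ m F := by
    refine (contDiff_snd.sub ?_).sub ?_
    · exact cst.contDiff.comp (contDiff_const.add (B.contDiff.comp (contDiff_snd.comp contDiff_fst)))
    · exact (primitive E).contDiff.comp
        (((pointwiseApply I K E).contDiff.comp (hNA.comp contDiff_snd)).clm_apply
          (cstK.contDiff.comp (contDiff_fst.comp contDiff_fst)))
  have hF0 : ∀ q γ, F ((0, q), γ) = γ - cst (y₀ + B q) := by
    intro q γ
    simp only [F, map_zero, sub_zero]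
  set u₀ : (K × Q) × C(I, E) := (0, cst y₀) with hu₀
  have hFu : F u₀ = 0 := by
    have := hF0 0 (cst y₀)
    rwa [map_zero, add_zero, sub_self] at this
  -- For z = 0 the integral term vanishes identically, so F is a translation in γ.
  have hpart : fderiv ℝ F u₀ ∘L .inr ℝ (K × Q) C(I, E) = ContinuousLinearMap.id ℝ C(I, E) := by
    have h1 : HasFDerivAt (fun γ : C(I, E) => F ((0 : K × Q), γ))
        (fderiv ℝ F u₀ ∘L .inr ℝ (K × Q) C(I, E)) (cst y₀) :=
      HasFDerivAt.comp (cst y₀) (hF.differentiable hm0 u₀).hasFDerivAt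
        (hasFDerivAt_prodMk_right (0 : K × Q) (cst y₀))
    have h2 : (fun γ : C(I, E) => F ((0 : K × Q), γ)) = fun γ => γ - cst (y₀ + B 0) := by
      funext γ
      exact hF0 0 γ
    rw [h2] at h1
    exact h1.unique ((hasFDerivAt_id _).sub_const _)
  have hinv : (fderiv ℝ F u₀ ∘L .inr ℝ (K × Q) C(I, E)).IsInvertible := by
    rw [hpart]
    exact ⟨ContinuousLinearEquiv.refl ℝ _, rfl⟩
  set Γ : K × Q → C(I, E) := hF.contDiffAt.implicitFunction hm0 hinv with hΓ
  have hΓs : ContDiffAt ℝ m Γ 0 := hF.contDiffAt.contDiffAt_implicitFunction hm0 hinv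
  have hΓ0 : Γ 0 = cst y₀ := hF.contDiffAt.implicitFunction_apply_self hm0 hinv
  have hΓF : ∀ᶠ p in 𝓝 (0 : K × Q), F (p, Γ p) = 0 := by
    have := hF.contDiffAt.eventually_apply_implicitFunction (u := u₀) hm0 hinv
    rw [hFu] at this
    exact this
  have huniq : ∀ᶠ v in 𝓝 u₀, F v = 0 → Γ v.1 = v.2 := by
    have := hF.contDiffAt.eventually_apply_eq_iff_implicitFunction (u := u₀) hm0 hinv
    rw [hFu] at this
    exact this.mono fun v hv => hv.1
  have hFapp : ∀ z q γ t, F ((z, q), γ) t = γ t - (y₀ + B q) -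
      ∫ s in (0 : ℝ)..t, A (γ (projIcc 0 1 zero_le_one s)) z := fun z q γ t => rfl
  obtain ⟨δ₁, hδ₁, huniq⟩ := Metric.eventually_nhds_iff.1 huniq
  have hgood : ∀ᶠ p in 𝓝 (0 : K × Q), dist (Γ p) (cst y₀) < δ₁ ∧ dist p 0 < δ₁ ∧
      F (p, Γ p) = 0 ∧ ContDiffAt ℝ 1 Γ p := by
    have h1 : ∀ᶠ p in 𝓝 (0 : K × Q), dist (Γ p) (cst y₀) < δ₁ := by
      have := hΓs.continuousAt.eventually (Metric.ball_mem_nhds (Γ 0) hδ₁)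
      rwa [hΓ0] at this
    have h2 := (hΓs.of_le (m := ((1 : ℕ) : WithTop ℕ∞)) (by exact_mod_cast hm)).eventually (by simp)
    filter_upwards [h1, Metric.ball_mem_nhds _ hδ₁, hΓF, h2] with p h1 h2 h3 h4
    exact ⟨h1, h2, h3, h4⟩
  obtain ⟨δ, hδ, hgood⟩ := Metric.eventually_nhds_iff.1 hgood
  let one : I := ⟨1, zero_le_one, le_rfl⟩
  let ev : C(I, E) →L[ℝ] E := ContinuousMap.evalCLM ℝ one
  refine ⟨fun p => Γ p one, ev.contDiff.contDiffAt.comp 0 hΓs, ?_, ?_⟩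
  · have hc : Filter.Tendsto (fun q : Q => ((0 : K), q)) (𝓝 0) (𝓝 0) :=
      (Continuous.prodMk_right (0 : K)).tendsto 0
    filter_upwards [hc.eventually hΓF] with q hq
    rw [hF0, sub_eq_zero] at hq
    rw [hq]
    rfl
  · filter_upwards [Metric.ball_mem_nhds _ hδ] with p hp
    obtain ⟨z, q⟩ := p
    set γ := Γ (z, q) with hγ
    have hflow : ∀ t : I, γ t = y₀ + B q +
        ∫ s in (0 : ℝ)..t, A (γ (projIcc 0 1 zero_le_one s)) z := by
      intro t
      have := DFunLike.congr_fun (hgood hp).2.2.1 t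
      rw [hFapp, ContinuousMap.zero_apply, sub_sub, sub_eq_zero] at this
      exact this
    -- The curve s ↦ γ(ts) solves the equation for tz, so local uniqueness identifies it with the
    -- curve of tz; thus Ψ(tz, q) = γ(t). Differentiating at t = 1 gives the radial equation.
    have hscale : ∀ t : I, Γ ((t : ℝ) • z, q) one = γ t := by
      intro t
      let mt : C(I, I) := ⟨fun s => t * s, by fun_prop⟩
      have hp' : dist ((t : ℝ) • z, q) (0 : K × Q) < δ := by
        rw [Metric.mem_ball] at hp
        refine lt_of_le_of_lt ?_ hp
        rw [dist_zero_right, dist_zero_right]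
        refine max_le_max ?_ le_rfl
        rw [norm_smul, Real.norm_of_nonneg t.2.1]
        exact mul_le_of_le_one_left (norm_nonneg _) t.2.2
      have h1 : Γ ((t : ℝ) • z, q) = γ.comp mt := by
        refine @huniq (((t : ℝ) • z, q), γ.comp mt) ?_ ?_
        · refine max_lt (hgood hp').2.1 ?_
          refine (ContinuousMap.dist_lt_iff hδ₁).2 fun s => ?_
          exact (ContinuousMap.dist_apply_le_dist (f := γ) (g := cst y₀) (mt s)).trans_lt
            (hgood hp).1
        · ext s
          rw [hFapp, ContinuousMap.zero_apply, ContinuousMap.comp_apply, hflow (mt s), sub_sub,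
            sub_eq_zero]
          congr 1
          have h2 := intervalIntegral.smul_integral_comp_mul_left (a := 0) (b := (s : ℝ))
            (fun σ => A (γ (projIcc 0 1 zero_le_one σ)) z) (t : ℝ)
          rw [mul_zero] at h2
          refine h2.symm.trans ?_
          rw [← intervalIntegral.integral_smul]
          refine intervalIntegral.integral_congr fun σ hσ => ?_
          rw [uIcc_of_le s.2.1] at hσ
          have hσ1 : σ ∈ Icc (0 : ℝ) 1 := ⟨hσ.1, hσ.2.trans s.2.2⟩
          have hσt : (t : ℝ) * σ ∈ Icc (0 : ℝ) 1 :=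
            ⟨mul_nonneg t.2.1 hσ1.1, mul_le_one₀ t.2.2 hσ1.1 hσ1.2⟩
          simp only [map_smul]
          rw [projIcc_of_mem _ hσt, projIcc_of_mem _ hσ1]
          rfl
      rw [h1]
      have : mt one = t := Subtype.ext (mul_one _)
      rw [ContinuousMap.comp_apply, this]
    have hcont : Continuous fun s => A (γ (projIcc 0 1 zero_le_one s)) z :=
      (hA.continuous.comp (γ.continuous.comp continuous_projIcc)).clm_apply continuous_const
    have hd1 : HasDerivAt (fun t : ℝ => y₀ + B q +
        ∫ s in (0 : ℝ)..t, A (γ (projIcc 0 1 zero_le_one s)) z) (A (γ one) z) 1 := by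
      have h := (intervalIntegral.integral_hasDerivAt_right (hcont.intervalIntegrable 0 1)
        (hcont.stronglyMeasurableAtFilter _ _) hcont.continuousAt).const_add (y₀ + B q)
      rwa [projIcc_of_mem zero_le_one one.2] at h
    have hd2 : HasDerivAt (fun t : ℝ => Γ (t • z, q) one)
        (fderiv ℝ (fun p => Γ p one) (z, q) (z, 0)) 1 := by
      have h1 : HasFDerivAt (fun p => Γ p one) (fderiv ℝ (fun p => Γ p one) (z, q))
          ((1 : ℝ) • z, q) := by
        rw [one_smul]
        exact (ev.contDiff.contDiffAt.comp (z, q) (hgood hp).2.2.2).differentiableAt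
          (by norm_num) |>.hasFDerivAt
      have h2 : HasDerivAt (fun t : ℝ => (t • z, q)) (z, (0 : Q)) 1 := by
        have := ((hasDerivAt_id (1 : ℝ)).smul_const z).prodMk (hasDerivAt_const (1 : ℝ) q)
        rwa [one_smul] at this
      exact h1.comp_hasDerivAt (1 : ℝ) h2
    -- The two curves are compared only on [0, 1], hence by one-sided derivatives at the end point.
    have hU : UniqueDiffWithinAt ℝ (Icc (0 : ℝ) 1) 1 :=
      uniqueDiffOn_Icc zero_lt_one 1 ⟨zero_le_one, le_rfl⟩
    refine hU.eq_deriv _ hd2.hasDerivWithinAt ?_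
    refine hd1.hasDerivWithinAt.congr (fun t ht => ?_) ?_
    · exact (hscale ⟨t, ht⟩).trans (hflow ⟨t, ht⟩)
    · exact (hscale one).trans (hflow one)

end RadialFlow

/-! ### Frobenius integrability along a radius -/

section Frobenius

open Set

variable {E K Q : Type*} [NormedAddCommGroup E] [NormedSpace ℝ E]
  [NormedAddCommGroup K] [NormedSpace ℝ K] [NormedAddCommGroup Q] [NormedSpace ℝ Q]

/-- **Frobenius**: along a radius on which the field of subspaces `A(y) K` is involutive, a
solution of the radial equation `DΨ(z, q)(z, 0) = A(Ψ(z, q)) z` is tangent to `A(y) K`. -/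
theorem fderiv_radial_solution {Ψ : K × Q → E} {A : E → K →L[ℝ] E} {z : K} {q : Q} {C : ℝ}
    (hΨ : ∀ t ∈ Icc (0 : ℝ) 1, ContDiffAt ℝ 2 Ψ (t • z, q))
    (hA : ∀ t ∈ Icc (0 : ℝ) 1, ContDiffAt ℝ 1 A (Ψ (t • z, q)))
    (hrad : ∀ t ∈ Icc (0 : ℝ) 1, ∀ᶠ p in 𝓝 (t • z, q), fderiv ℝ Ψ p (p.1, 0) = A (Ψ p) p.1)
    (hinv : ∀ t ∈ Icc (0 : ℝ) 1, ∀ v w, fderiv ℝ A (Ψ (t • z, q)) (A (Ψ (t • z, q)) v) w =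
      fderiv ℝ A (Ψ (t • z, q)) (A (Ψ (t • z, q)) w) v)
    (hC : ∀ t ∈ Icc (0 : ℝ) 1, ‖fderiv ℝ A (Ψ (t • z, q))‖ ≤ C) (v : K) :
    fderiv ℝ Ψ (z, q) (v, 0) = A (Ψ (z, q)) v := by
  -- R measures the failure of tangency. Differentiating the radial equation in the direction v and
  -- using involutivity gives the linear equation k' = DA(k) z for k = tR(tz, q). As k(0) = 0,
  -- Gronwall forces k = 0, and t = 1 gives the claim.
  set R : K × Q → E := fun p => fderiv ℝ Ψ p (v, 0) - A (Ψ p) v with hR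
  set k : ℝ → E := fun t => t • R (t • z, q) with hk
  have hderiv : ∀ t ∈ Icc (0 : ℝ) 1,
      HasDerivAt k (fderiv ℝ A (Ψ (t • z, q)) (k t) z) t := by
    intro t ht
    set w : K × Q := (t • z, q) with hw
    have hΨd : HasFDerivAt Ψ (fderiv ℝ Ψ w) w :=
      ((hΨ t ht).differentiableAt (by norm_num)).hasFDerivAt
    have hΨ2 : HasFDerivAt (fderiv ℝ Ψ) (fderiv ℝ (fderiv ℝ Ψ) w) w :=
      (((hΨ t ht).fderiv_right (m := 1) (by norm_num)).differentiableAt (by norm_num)).hasFDerivAt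
    have hAd : HasFDerivAt (fun p => A (Ψ p)) (fderiv ℝ A (Ψ w) ∘L fderiv ℝ Ψ w) w :=
      HasFDerivAt.comp w ((hA t ht).differentiableAt (by norm_num)).hasFDerivAt hΨd
    have hline : HasDerivAt (fun t : ℝ => (t • z, q)) (z, (0 : Q)) t := by
      have := ((hasDerivAt_id t).smul_const z).prodMk (hasDerivAt_const t q)
      rwa [one_smul] at this
    have hRd : HasFDerivAt R ((fderiv ℝ (fderiv ℝ Ψ) w).flip (v, 0) -
        (fderiv ℝ A (Ψ w) ∘L fderiv ℝ Ψ w).flip v) w := by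
      have h1 := hΨ2.clm_apply (hasFDerivAt_const ((v, 0) : K × Q) w)
      have h2 := hAd.clm_apply (hasFDerivAt_const v w)
      have h3 := h1.fun_sub h2
      simpa using h3
    -- differentiate the radial equation
    have hdiff : fderiv ℝ (fderiv ℝ Ψ) w (v, 0) (w.1, 0) + fderiv ℝ Ψ w (v, 0) =
        fderiv ℝ A (Ψ w) (fderiv ℝ Ψ w (v, 0)) w.1 + A (Ψ w) v := by
      have hfst : HasFDerivAt (fun p : K × Q => (p.1, (0 : Q)))
          ((ContinuousLinearMap.fst ℝ K Q).prod 0) w :=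
        ((ContinuousLinearMap.fst ℝ K Q).prod (0 : K × Q →L[ℝ] Q)).hasFDerivAt
      have h1 := hΨ2.clm_apply hfst
      have h2 := hAd.clm_apply (ContinuousLinearMap.fst ℝ K Q).hasFDerivAt
      have h3 := (h1.congr_of_eventuallyEq ((hrad t ht).mono fun p hp => hp.symm)).unique h2
      have h4 := DFunLike.congr_fun h3 (v, 0)
      simp only [add_apply, ContinuousLinearMap.comp_apply, ContinuousLinearMap.flip_apply,
        ContinuousLinearMap.prod_apply, ContinuousLinearMap.coe_fst', zero_apply] at h4
      rw [add_comm, h4, add_comm]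
    have hsym : IsSymmSndFDerivAt ℝ Ψ w := (hΨ t ht).isSymmSndFDerivAt (by simp)
    have h1 : HasDerivAt (fun t => R (t • z, q)) (((fderiv ℝ (fderiv ℝ Ψ) w).flip (v, 0) -
        (fderiv ℝ A (Ψ w) ∘L fderiv ℝ Ψ w).flip v) (z, 0)) t :=
      HasFDerivAt.comp_hasDerivAt (f := fun t : ℝ => (t • z, q)) t hRd hline
    have h2 := (hasDerivAt_id t).smul h1
    have hw1 : fderiv ℝ Ψ w (t • z, 0) = A (Ψ w) (t • z) := (hrad t ht).self_of_nhds
    have hz : fderiv ℝ Ψ w (t • z, 0) = t • fderiv ℝ Ψ w (z, 0) := by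
      rw [← map_smul]; simp
    have hz2 : fderiv ℝ (fderiv ℝ Ψ) w (v, 0) (t • z, 0) =
        t • fderiv ℝ (fderiv ℝ Ψ) w (z, 0) (v, 0) := by
      rw [hsym.eq (z, 0) (v, 0), ← map_smul]; simp
    convert! h2 using 1
    simp only [id, one_smul, sub_apply, ContinuousLinearMap.flip_apply,
      ContinuousLinearMap.comp_apply, smul_sub, ← hz2]
    -- The only use of involutivity: it exchanges the roles of v and tz.
    have h5 : t • (fderiv ℝ A (Ψ w) (fderiv ℝ Ψ w (z, 0))) v =
        fderiv ℝ A (Ψ w) (A (Ψ w) v) (t • z) := by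
      rw [hinv t ht v (t • z), ← hw1, hz, map_smul, smul_apply]
    rw [h5]
    have h6 : fderiv ℝ (fderiv ℝ Ψ) w (v, 0) (t • z, 0) =
        fderiv ℝ A (Ψ w) (fderiv ℝ Ψ w (v, 0)) (t • z) - R w := by
      rw [hR]
      have : w.1 = t • z := rfl
      rw [this] at hdiff
      rw [eq_sub_iff_add_eq]
      simp only
      rw [← add_sub_assoc, hdiff, add_sub_cancel_right]
    rw [h6, hk]
    simp only [hR, map_sub, sub_apply, map_smul, smul_apply, smul_sub]
    abel
  have hg := eq_zero_of_abs_deriv_le_mul_abs_self_of_eq_zero_right (f := k)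
    (f' := fun t => fderiv ℝ A (Ψ (t • z, q)) (k t) z) (K := C * ‖z‖) (a := 0) (b := 1)
    (fun t ht => (hderiv t ht).continuousAt.continuousWithinAt)
    (fun t ht => (hderiv t ⟨ht.1, ht.2.le⟩).hasDerivWithinAt) (by simp [hk])
    (fun t ht => by
      refine (ContinuousLinearMap.le_opNorm _ _).trans ?_
      refine (mul_le_mul_of_nonneg_right (ContinuousLinearMap.le_opNorm _ _)
        (norm_nonneg _)).trans ?_
      rw [mul_right_comm]
      gcongr
      exact hC t ⟨ht.1, ht.2.le⟩) 1 ⟨zero_le_one, le_rfl⟩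
  simpa [hk, hR, sub_eq_zero] using hg

end Frobenius

/-! ### Behaviour of a radial solution along radii -/

section Radial

open Set

variable {E F K Q : Type*} [NormedAddCommGroup E] [NormedSpace ℝ E]
  [NormedAddCommGroup F] [NormedSpace ℝ F]
  [NormedAddCommGroup K] [NormedSpace ℝ K] [NormedAddCommGroup Q] [NormedSpace ℝ Q]

theorem hasDerivAt_radius (z : K) (q : Q) (t : ℝ) :
    HasDerivAt (fun t : ℝ => (t • z, q)) (z, (0 : Q)) t := by
  have := ((hasDerivAt_id t).smul_const z).prodMk (hasDerivAt_const t q)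
  rwa [one_smul] at this

/-- At z = 0 the radial equation is empty. It is divided by t at the points (tv, q) and passed to
the limit t → 0; no involutivity is needed. -/
theorem fderiv_radial_solution_zero {Ψ : K × Q → E} {A : E → K →L[ℝ] E} {q : Q}
    (hΨ : ContDiffAt ℝ 1 Ψ (0, q)) (hA : ContinuousAt A (Ψ (0, q)))
    (hrad : ∀ᶠ p in 𝓝 (0, q), fderiv ℝ Ψ p (p.1, 0) = A (Ψ p) p.1) (v : K) :
    fderiv ℝ Ψ (0, q) (v, 0) = A (Ψ (0, q)) v := by
  have hc : Filter.Tendsto (fun t : ℝ => (t • v, q)) (𝓝 0) (𝓝 (0, q)) := by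
    have := (hasDerivAt_radius v q 0).continuousAt.tendsto
    rwa [zero_smul] at this
  have h1 : Filter.Tendsto (fun t : ℝ => fderiv ℝ Ψ (t • v, q) (v, 0)) (𝓝[≠] 0)
      (𝓝 (fderiv ℝ Ψ (0, q) (v, 0))) := by
    have h : ContinuousAt (fderiv ℝ Ψ) (0, q) :=
      (hΨ.fderiv_right (m := 0) (by norm_num)).continuousAt
    exact (((ContinuousLinearMap.apply ℝ E (v, (0 : Q))).continuous.tendsto _).comp
      (h.tendsto.comp hc)).mono_left nhdsWithin_le_nhds
  have h2 : Filter.Tendsto (fun t : ℝ => A (Ψ (t • v, q)) v) (𝓝[≠] 0) (𝓝 (A (Ψ (0, q)) v)) := by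
    have h : ContinuousAt (fun p => A (Ψ p)) (0, q) :=
      ContinuousAt.comp (f := Ψ) (g := A) hA hΨ.continuousAt
    exact (((ContinuousLinearMap.apply ℝ E v).continuous.tendsto _).comp
      (h.tendsto.comp hc)).mono_left nhdsWithin_le_nhds
  refine tendsto_nhds_unique_of_eventuallyEq h1 h2 ?_
  filter_upwards [nhdsWithin_le_nhds (hc.eventually hrad), self_mem_nhdsWithin] with t ht ht0
  have e : ((t • v, (0 : Q)) : K × Q) = t • (v, 0) := by simp
  rw [e, map_smul, map_smul] at ht
  exact smul_right_injective E ht0 ht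

theorem comp_eq_of_fderiv_radius_eq_zero {Ψ : K × Q → E} {r : E → F} {z : K} {q : Q}
    (hΨ : ∀ t ∈ Icc (0 : ℝ) 1, DifferentiableAt ℝ Ψ (t • z, q))
    (hr : ∀ t ∈ Icc (0 : ℝ) 1, DifferentiableAt ℝ r (Ψ (t • z, q)))
    (hd : ∀ t ∈ Icc (0 : ℝ) 1, fderiv ℝ r (Ψ (t • z, q)) (fderiv ℝ Ψ (t • z, q) (z, 0)) = 0) :
    r (Ψ (z, q)) = r (Ψ (0, q)) := by
  have h : ∀ t ∈ Icc (0 : ℝ) 1, HasDerivAt (fun t : ℝ => r (Ψ (t • z, q))) 0 t := by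
    intro t ht
    have h1 := HasFDerivAt.comp_hasDerivAt (f := fun t : ℝ => (t • z, q)) t
      ((hr t ht).hasFDerivAt.comp (t • z, q) (hΨ t ht).hasFDerivAt) (hasDerivAt_radius z q t)
    rw [ContinuousLinearMap.comp_apply, hd t ht] at h1
    exact h1
  have := constant_of_has_deriv_right_zero
    (fun t ht => (h t ht).continuousAt.continuousWithinAt)
    (fun t ht => (h t ⟨ht.1, ht.2.le⟩).hasDerivWithinAt) 1 ⟨zero_le_one, le_rfl⟩
  simpa using this

/-- Balls for the sup norm of the product contain the whole radius ending at each of their points.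
-/
theorem eventually_radius {K Q : Type*} [NormedAddCommGroup K] [NormedSpace ℝ K]
    [NormedAddCommGroup Q] {P : K × Q → Prop} (h : ∀ᶠ p in 𝓝 (0 : K × Q), P p) :
    ∀ᶠ p in 𝓝 (0 : K × Q), ∀ t ∈ Icc (0 : ℝ) 1, P (t • p.1, p.2) := by
  obtain ⟨δ, hδ, hP⟩ := Metric.eventually_nhds_iff.1 h
  filter_upwards [Metric.ball_mem_nhds _ hδ] with p hp t ht
  refine hP (lt_of_le_of_lt ?_ hp)
  rw [dist_zero_right, dist_zero_right]
  refine max_le_max ?_ le_rfl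
  rw [norm_smul, Real.norm_of_nonneg ht.1]
  exact mul_le_of_le_one_left (norm_nonneg _) ht.2

end Radial

/-! ### Projections onto the kernels of ∂g, and Levi-flatness as involutivity -/

section CRProjection

variable {E F : Type*} [NormedAddCommGroup E] [NormedSpace ℂ E]
  [NormedAddCommGroup F] [NormedSpace ℂ F]

theorem linPart_add (L L' : E →L[ℝ] F) : linPart (L + L') = linPart L + linPart L' := by
  ext v
  simp only [linPart_apply, add_apply, smul_add, smul_sub]
  abel

theorem linPart_smul (c : ℝ) (L : E →L[ℝ] F) : linPart (c • L) = c • linPart L := by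
  ext v
  simp only [linPart_apply, smul_apply]
  rw [smul_comm Complex.I c, ← smul_sub, smul_comm]

theorem norm_linPart_le (L : E →L[ℝ] F) : ‖linPart L‖ ≤ ‖L‖ := by
  refine ContinuousLinearMap.opNorm_le_bound _ (norm_nonneg _) fun v => ?_
  rw [linPart_apply, norm_smul]
  have h1 := L.le_opNorm v
  have h2 := L.le_opNorm (Complex.I • v)
  rw [norm_smul, Complex.norm_I, one_mul] at h2
  have h3 := norm_sub_le (L v) (Complex.I • L (Complex.I • v))
  rw [norm_smul Complex.I, Complex.norm_I, one_mul] at h3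
  have : ‖(1 / 2 : ℂ)‖ = 1 / 2 := by norm_num
  rw [this]
  linarith

/-- The complex linear part, as a continuous linear operator. -/
noncomputable def linPartL : (E →L[ℝ] F) →L[ℝ] (E →L[ℂ] F) :=
  LinearMap.mkContinuous
    { toFun := linPart
      map_add' := linPart_add
      map_smul' := linPart_smul } 1 fun L => by
    rw [one_mul]
    exact norm_linPart_le L

theorem ContDiffAt.del {n : ℕ} {g : E → F} {y : E} (h : ContDiffAt ℝ (n + 1 : ℕ) g y) :
    ContDiffAt ℝ n (del g) y :=
  contDiffAt_clm_comp (h.fderiv_right (m := n) (by norm_cast)) linPartL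

theorem del_apply (g : E → F) (y v : E) : del g y v =
    (1 / 2 : ℂ) • (fderiv ℝ g y v - Complex.I • fderiv ℝ g y (Complex.I • v)) := rfl

theorem fderiv_del_apply {u : E → F} {y : E} (h : ContDiffAt ℝ 2 u y) (v w : E) :
    fderiv ℝ (del u) y v w = (1 / 2 : ℂ) • (fderiv ℝ (fderiv ℝ u) y v w -
      Complex.I • fderiv ℝ (fderiv ℝ u) y v (Complex.I • w)) := by
  have hd : DifferentiableAt ℝ (fderiv ℝ u) y :=
    (h.fderiv_right (m := 1) (by norm_num)).differentiableAt (by norm_num)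
  have h1 : HasFDerivAt (del u) (linPartL.comp (fderiv ℝ (fderiv ℝ u) y)) y :=
    hasFDerivAt_clm_comp (G := E →L[ℂ] F) hd.hasFDerivAt linPartL
  rw [h1.fderiv]; rfl

/-- If the Levi form of `g` vanishes on the kernel of `∂g`, the derivative of `∂g` is symmetric
there. -/
theorem fderiv_del_symm {g : E → ℂ} {y : E} (h : ContDiffAt ℝ 2 g y)
    (hlevi : ∀ v w, del g y v = 0 → del g y w = 0 → del (dbar g) y v w = 0) {v w : E}
    (hv : del g y v = 0) (hw : del g y w = 0) :
    fderiv ℝ (del g) y v w = fderiv ℝ (del g) y w v := by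
  have hsym : IsSymmSndFDerivAt ℝ g y := h.isSymmSndFDerivAt (by simp)
  have hL : ∀ v w, del (dbar g) y v w = (1 / 2 : ℂ) • (fderiv ℝ (dbar g) y v w -
      Complex.I • fderiv ℝ (dbar g) y (Complex.I • v) w) := fun v w => rfl
  have h1 := hlevi v w hv hw
  have h2 := hlevi w v hw hv
  rw [hL, fderiv_dbar_apply h, fderiv_dbar_apply h] at h1 h2
  rw [fderiv_del_apply h, fderiv_del_apply h]
  rw [hsym.eq w v, hsym.eq w (Complex.I • v), hsym.eq (Complex.I • w) v,
    hsym.eq (Complex.I • w) (Complex.I • v)] at h2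
  rw [hsym.eq w v, hsym.eq w (Complex.I • v)]
  simp only [smul_eq_mul] at h1 h2 ⊢
  -- The antisymmetric part of D(∂g) is a difference of two Levi forms, with the arguments in either
  -- order.
  linear_combination h2 - h1

theorem del_ofReal_apply {r : E → ℝ} {y : E} (hr : DifferentiableAt ℝ r y) (v : E) :
    del (fun x => ((r x : ℝ) : ℂ)) y v = (1 / 2 : ℂ) *
      ((fderiv ℝ r y v : ℂ) - Complex.I * (fderiv ℝ r y (Complex.I • v) : ℂ)) := by
  have h : HasFDerivAt (fun x => ((r x : ℝ) : ℂ)) (Complex.ofRealCLM ∘L fderiv ℝ r y) y :=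
    Complex.ofRealCLM.hasFDerivAt.comp y hr.hasFDerivAt
  rw [del_apply, h.fderiv]
  rfl

theorem del_ofReal_eq_zero_iff {r : E → ℝ} {y : E} (hr : DifferentiableAt ℝ r y) (v : E) :
    del (fun x => ((r x : ℝ) : ℂ)) y v = 0 ↔
      fderiv ℝ r y v = 0 ∧ fderiv ℝ r y (Complex.I • v) = 0 := by
  rw [del_ofReal_apply hr]
  constructor
  · intro h
    have h' : (fderiv ℝ r y v : ℂ) - Complex.I * (fderiv ℝ r y (Complex.I • v) : ℂ) = 0 := by
      simpa using h
    have h1 := congrArg Complex.re h'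
    have h2 := congrArg Complex.im h'
    simp at h1 h2
    exact ⟨h1, h2⟩
  · rintro ⟨h1, h2⟩
    simp [h1, h2]

/-- The projection onto the kernel of the linear form `θ` along `e`. -/
noncomputable def kerProj (θ : E →L[ℂ] ℂ) (e : E) : E →L[ℂ] E :=
  ContinuousLinearMap.id ℂ E - (θ e)⁻¹ • θ.smulRight e

theorem kerProj_apply (θ : E →L[ℂ] ℂ) (e v : E) : kerProj θ e v = v - ((θ e)⁻¹ * θ v) • e := by
  simp [kerProj, smul_smul]

theorem apply_kerProj {θ : E →L[ℂ] ℂ} {e : E} (h : θ e ≠ 0) (v : E) : θ (kerProj θ e v) = 0 := by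
  rw [kerProj_apply, map_sub, map_smul, smul_eq_mul]
  field_simp
  ring

/-- The derivative is a multiple of the fixed vector e, with coefficient Dθ evaluated on a vector of
the kernel. Involutivity of the projections thus reduces to symmetry of Dθ on ker θ. -/
theorem fderiv_kerProj_apply {θ : E → E →L[ℂ] ℂ} {e y : E} (hθ : DifferentiableAt ℝ θ y)
    (he : θ y e ≠ 0) (w h : E) : fderiv ℝ (fun x => kerProj (θ x) e w) y h =
      -((θ y e)⁻¹ * fderiv ℝ θ y h (kerProj (θ y) e w)) • e := by
  have hev : ∀ v : E, HasFDerivAt (fun x => θ x v) ((((ContinuousLinearMap.apply ℂ ℂ v :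
      (E →L[ℂ] ℂ) →L[ℂ] ℂ).restrictScalars ℝ)).comp (fderiv ℝ θ y)) y := fun v =>
    ((ContinuousLinearMap.apply ℂ ℂ v : (E →L[ℂ] ℂ) →L[ℂ] ℂ).restrictScalars
      ℝ).hasFDerivAt.comp y hθ.hasFDerivAt
  have e1 : (fun x => kerProj (θ x) e w) = fun x => w - ((θ x e)⁻¹ * θ x w) • e := by
    funext x
    exact kerProj_apply _ _ _
  have hi := HasFDerivAt.comp y (hasFDerivAt_inv' (𝕜 := ℝ) he) (hev e)
  have h1 : HasFDerivAt (fun x => w - ((θ x e)⁻¹ * θ x w) • e) _ y :=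
    ((hi.mul (hev w)).smul_const e).const_sub w
  rw [e1, h1.fderiv]
  simp only [neg_apply, add_apply, smul_apply, ContinuousLinearMap.smulRight_apply,
    ContinuousLinearMap.comp_apply, ContinuousLinearMap.coe_restrictScalars',
    ContinuousLinearMap.apply_apply, ContinuousLinearMap.mulLeftRight_apply, kerProj_apply, map_sub,
    map_smul, smul_eq_mul, Function.comp_apply]
  rw [← neg_smul]
  congr 1
  field_simp
  ring

/-- Involutivity of the field of projections onto the kernels of `∂g`. -/
theorem fderiv_kerProj_symm {g : E → ℂ} {e y : E} (h : ContDiffAt ℝ 2 g y) (he : del g y e ≠ 0)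
    (hlevi : ∀ v w, del g y v = 0 → del g y w = 0 → del (dbar g) y v w = 0) (v w : E) :
    fderiv ℝ (fun x => kerProj (del g x) e w) y (kerProj (del g y) e v) =
      fderiv ℝ (fun x => kerProj (del g x) e v) y (kerProj (del g y) e w) := by
  have hd : DifferentiableAt ℝ (del g) y :=
    (ContDiffAt.del (n := 1) h).differentiableAt (by norm_num)
  rw [fderiv_kerProj_apply hd he, fderiv_kerProj_apply hd he,
    fderiv_del_symm h hlevi (apply_kerProj he v) (apply_kerProj he w)]

/-- The restriction of the projections `kerProj` to a real subspace, as a smooth field. -/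
theorem contDiffAt_kerProj_comp {K : Type*} [NormedAddCommGroup K] [NormedSpace ℝ K] {n : ℕ}
    {θ : E → E →L[ℂ] ℂ} {e y : E} (hθ : ContDiffAt ℝ n θ y) (he : θ y e ≠ 0) (ι : K →L[ℝ] E) :
    ContDiffAt ℝ n (fun x => ((kerProj (θ x) e).restrictScalars ℝ).comp ι) y := by
  let res : (E →L[ℂ] ℂ) →L[ℝ] (E →L[ℝ] ℂ) := ContinuousLinearMap.restrictScalarsL ℂ E ℂ ℝ ℝ
  let sp : ℂ →L[ℝ] E := (ContinuousLinearMap.toSpanSingleton ℂ e).restrictScalars ℝ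
  have h1 : ContDiffAt ℝ n (fun x => res (θ x)) y := contDiffAt_clm_comp hθ res
  have h2 : ContDiffAt ℝ n (fun x => res (θ x) e) y := h1.clm_apply contDiffAt_const
  have h3 : ContDiffAt ℝ n (fun x => (res (θ x) e)⁻¹) y := h2.inv he
  have h4 : ContDiffAt ℝ n (fun x => ι - (res (θ x) e)⁻¹ • (sp.comp ((res (θ x)).comp ι))) y :=
    contDiffAt_const.sub (h3.smul (contDiffAt_const.clm_comp (h1.clm_comp contDiffAt_const)))
  refine h4.congr_of_eventuallyEq (Filter.Eventually.of_forall fun x => ?_)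
  ext w
  simp only [ContinuousLinearMap.comp_apply, ContinuousLinearMap.coe_restrictScalars',
    kerProj_apply, sub_apply, smul_apply, mul_smul]
  rfl

end CRProjection

/-! ### Coordinates adapted to the Levi foliation -/

section Leaves

open Set

universe u

variable {E : Type u} [NormedAddCommGroup E] [NormedSpace ℂ E] [FiniteDimensional ℂ E]

/-- Coordinates `Ψ : K × ℂ → E` adapted to the Levi foliation of the hypersurface `r = 0`: the
leaves are the images of the sets `K × {c}`, and `Ψ` is as smooth as `∂r`. -/
theorem exists_leaf_coordinates {m : ℕ} (hm : 2 ≤ m) {r : E → ℝ} {y₀ : E}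
    (hr : ContDiffAt ℝ (m + 1 : ℕ) r y₀)
    {K : Type u} [NormedAddCommGroup K] [NormedSpace ℂ K] [FiniteDimensional ℂ K]
    {ι : K →L[ℂ] E} (hinj : Function.Injective ι)
    (hι : ∀ v, del (fun x => ((r x : ℝ) : ℂ)) y₀ v = 0 ↔ ∃ z, ι z = v)
    {e : E} (he : del (fun x => ((r x : ℝ) : ℂ)) y₀ e = 1)
    (hlevi : ∀ᶠ y in 𝓝 y₀, r y = 0 → ∀ v w, del (fun x => ((r x : ℝ) : ℂ)) y v = 0 →
      del (fun x => ((r x : ℝ) : ℂ)) y w = 0 →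
      del (dbar fun x => ((r x : ℝ) : ℂ)) y v w = 0) :
    ∃ (Ψ : K × ℂ → E) (Φ : E → K × ℂ),
      ContDiffAt ℝ m Ψ 0 ∧ Ψ 0 = y₀ ∧ ContDiffAt ℝ m Φ y₀ ∧ Φ y₀ = 0 ∧
      (∀ᶠ p in 𝓝 (0 : K × ℂ), Φ (Ψ p) = p) ∧ (∀ᶠ y in 𝓝 y₀, Ψ (Φ y) = y) ∧
      (∀ᶠ p in 𝓝 (0 : K × ℂ), r (Ψ p) = r (y₀ + p.2 • e)) ∧
      (∀ᶠ p in 𝓝 (0 : K × ℂ), r (Ψ p) = 0 → ∀ v : K,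
        fderiv ℝ Ψ p (v, 0) = kerProj (del (fun x => ((r x : ℝ) : ℂ)) (Ψ p)) e (ι v)) ∧
      (∀ᶠ y in 𝓝 y₀, ContDiffAt ℝ m (fun x => ((kerProj (del (fun x => ((r x : ℝ) : ℂ)) x)
        e).restrictScalars ℝ).comp (ι.restrictScalars ℝ)) y) ∧
      (∀ᶠ y in 𝓝 y₀, del (fun x => ((r x : ℝ) : ℂ)) y e ≠ 0) ∧
      ∀ y, del (fun x => ((r x : ℝ) : ℂ)) y e ≠ 0 → ∀ v,
        del (fun x => ((r x : ℝ) : ℂ)) y v = 0 →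
        ∃ w : K, kerProj (del (fun x => ((r x : ℝ) : ℂ)) y) e (ι w) = v := by
  have hm0 : (m : WithTop ℕ∞) ≠ 0 := by exact_mod_cast (by omega : m ≠ 0)
  have hm1 : (1 : WithTop ℕ∞) ≤ m := by exact_mod_cast (by omega : 1 ≤ m)
  have hm2 : (2 : WithTop ℕ∞) ≤ m := by exact_mod_cast hm
  have hm3 : (m : WithTop ℕ∞) ≤ (m + 1 : ℕ) := by exact_mod_cast Nat.le_succ m
  have hrd : ∀ {y}, ContDiffAt ℝ (m + 1 : ℕ) r y → DifferentiableAt ℝ r y := fun h =>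
    h.differentiableAt (by simp)
  set g : E → ℂ := fun x => ((r x : ℝ) : ℂ) with hg
  have hgs : ∀ {y}, ContDiffAt ℝ (m + 1 : ℕ) r y → ContDiffAt ℝ (m + 1 : ℕ) g y := fun h =>
    Complex.ofRealCLM.contDiff.contDiffAt.comp _ h
  have hker : ∀ {y}, ContDiffAt ℝ (m + 1 : ℕ) r y → ∀ v, del g y v = 0 → fderiv ℝ r y v = 0 :=
    fun h v hv => ((del_ofReal_eq_zero_iff (hrd h) v).1 hv).1
  have hιθ : ∀ z, del g y₀ (ι z) = 0 := fun z => (hι _).2 ⟨z, rfl⟩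
  set A₀ : E → K →L[ℝ] E := fun x => ((kerProj (del g x) e).restrictScalars ℝ).comp (ι.restrictScalars ℝ) with
    hA₀
  have hθ : ∀ {y}, ContDiffAt ℝ (m + 1 : ℕ) r y → ContDiffAt ℝ m (del g) y := fun h =>
    ContDiffAt.del (hgs h)
  have hre : ∀ᶠ y in 𝓝 y₀, ContDiffAt ℝ (m + 1 : ℕ) r y := hr.eventually (by simp)
  have hee : ∀ᶠ y in 𝓝 y₀, del g y e ≠ 0 := by
    have h1 : Filter.Tendsto (fun y => del g y e) (𝓝 y₀) (𝓝 (del g y₀ e)) :=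
      ((ContinuousLinearMap.apply ℂ ℂ e).continuous.tendsto _).comp (hθ hr).continuousAt
    exact h1.eventually_ne (by rw [he]; exact one_ne_zero)
  have hA₀s : ∀ᶠ y in 𝓝 y₀, ContDiffAt ℝ m A₀ y := by
    filter_upwards [hre, hee] with y h1 h2
    exact contDiffAt_kerProj_comp (hθ h1) h2 _
  -- The radial equation is solved for a globally smooth field, so the germ of A₀ at y₀ is extended
  -- by a cutoff.
  obtain ⟨A, hA, -, hAA⟩ := exists_contDiff_eventuallyEq hA₀s
  let B : ℂ →L[ℝ] E := (ContinuousLinearMap.toSpanSingleton ℂ e).restrictScalars ℝ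
  have : CompleteSpace E := FiniteDimensional.complete ℂ E
  have : CompleteSpace K := FiniteDimensional.complete ℂ K
  obtain ⟨Ψ, hΨ, hΨB, hrad⟩ := exists_radial_solution (by omega : 1 ≤ m) hA y₀ B
  have hΨ0 : Ψ 0 = y₀ := by
    have := hΨB.self_of_nhds
    rwa [map_zero, add_zero] at this
  obtain ⟨C, hC⟩ : ∃ C, ∀ᶠ y in 𝓝 y₀, ‖fderiv ℝ A y‖ ≤ C := by
    refine ⟨‖fderiv ℝ A y₀‖ + 1, ?_⟩
    have hc : Continuous fun y => ‖fderiv ℝ A y‖ :=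
      (hA.continuous_fderiv hm0).norm
    exact (hc.tendsto y₀).eventually (ge_mem_nhds (lt_add_one _))
  have hΨt : Filter.Tendsto Ψ (𝓝 0) (𝓝 y₀) := by
    have := hΨ.continuousAt.tendsto
    rwa [hΨ0] at this
  have hsnd : Filter.Tendsto (fun p : K × ℂ => p.2) (𝓝 0) (𝓝 0) := continuous_snd.tendsto 0
  -- the radial derivative
  have hdir : ∀ {t : ℝ} {p : K × ℂ}, ContDiffAt ℝ 1 Ψ (t • p.1, p.2) →
      (∀ᶠ p in 𝓝 (t • p.1, p.2), fderiv ℝ Ψ p (p.1, 0) = A (Ψ p) p.1) →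
      fderiv ℝ Ψ (t • p.1, p.2) (p.1, 0) = A (Ψ (t • p.1, p.2)) p.1 := by
    intro t p h1 h2
    rcases eq_or_ne t 0 with rfl | ht
    · rw [zero_smul] at h1 h2 ⊢
      exact fderiv_radial_solution_zero h1 hA.continuous.continuousAt h2 p.1
    · have h3 := h2.self_of_nhds
      have h4 : ((t • p.1, (0 : ℂ)) : K × ℂ) = t • (p.1, 0) := by simp
      simp only at h3
      rw [h4, map_smul, map_smul] at h3
      exact smul_right_injective E ht h3
  have hpt : ∀ᶠ p in 𝓝 (0 : K × ℂ), ContDiffAt ℝ 2 Ψ p ∧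
      (∀ᶠ p in 𝓝 p, fderiv ℝ Ψ p (p.1, 0) = A (Ψ p) p.1) ∧ A =ᶠ[𝓝 (Ψ p)] A₀ ∧
      del g (Ψ p) e ≠ 0 ∧ ContDiffAt ℝ (m + 1 : ℕ) r (Ψ p) ∧ ‖fderiv ℝ A (Ψ p)‖ ≤ C ∧
      (r (Ψ p) = 0 → ∀ v w, del g (Ψ p) v = 0 → del g (Ψ p) w = 0 →
        del (dbar g) (Ψ p) v w = 0) := by
    filter_upwards [(hΨ.of_le hm2).eventually (by simp), hrad.eventually_nhds,
      hΨt.eventually hAA.eventually_nhds, hΨt.eventually hee, hΨt.eventually hre, hΨt.eventually hC,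
      hΨt.eventually hlevi] with p h1 h2 h3 h4 h5 h6 h7
    exact ⟨h1, h2, h3, h4, h5, h6, h7⟩
  -- Radial derivatives of Ψ lie in ker ∂r, hence in ker Dr, so r is constant along radii.
  -- Levi-flatness plays no role here.
  have hlevel : ∀ᶠ p in 𝓝 (0 : K × ℂ), r (Ψ p) = r (y₀ + p.2 • e) := by
    filter_upwards [eventually_radius hpt, hsnd.eventually hΨB] with p hp hB
    have h := comp_eq_of_fderiv_radius_eq_zero (Ψ := Ψ) (r := r) (z := p.1) (q := p.2)
      (fun t ht => (hp t ht).1.differentiableAt (by norm_num))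
      (fun t ht => hrd (hp t ht).2.2.2.2.1)
      (fun t ht => by
        obtain ⟨h1, h2, h3, h4, h5, -, -⟩ := hp t ht
        rw [hdir (h1.of_le (by norm_num)) h2, h3.self_of_nhds]
        exact hker h5 _ (apply_kerProj h4 _))
    rw [hB] at h
    exact h
  -- The Levi form is known to vanish only on r = 0, but by `hlevel` the whole radius lies there as
  -- soon as its end point does, and Frobenius applies along it.
  have hleaf : ∀ᶠ p in 𝓝 (0 : K × ℂ), r (Ψ p) = 0 → ∀ v : K,
      fderiv ℝ Ψ p (v, 0) = kerProj (del g (Ψ p)) e (ι v) := by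
    filter_upwards [eventually_radius hpt, eventually_radius hlevel] with p hp hl hp0 v
    have hone : ∀ t ∈ Icc (0 : ℝ) 1, r (Ψ (t • p.1, p.2)) = 0 := by
      intro t ht
      have h1 := hl 1 ⟨zero_le_one, le_rfl⟩
      rw [one_smul] at h1
      rw [hl t ht, ← hp0]
      exact h1.symm
    have h := fderiv_radial_solution (Ψ := Ψ) (A := A) (z := p.1) (q := p.2) (C := C)
      (fun t ht => (hp t ht).1) (fun t ht => (hA.of_le hm1).contDiffAt)
      (fun t ht => (hp t ht).2.1)
      (fun t ht v w => by
        obtain ⟨h1, h2, h3, h4, h5, -, h7⟩ := hp t ht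
        have h8 : ∀ w : K, ∀ h, fderiv ℝ A (Ψ (t • p.1, p.2)) h w =
            fderiv ℝ (fun x => kerProj (del g x) e (ι w)) (Ψ (t • p.1, p.2)) h := by
          intro w h
          have h9 : HasFDerivAt (fun x => A x w) ((fderiv ℝ A (Ψ (t • p.1, p.2))).flip w)
              (Ψ (t • p.1, p.2)) :=
            (ContinuousLinearMap.apply ℝ E w).hasFDerivAt.comp _
              (hA.differentiable hm0 _).hasFDerivAt
          have h10 : (fun x => A x w) =ᶠ[𝓝 (Ψ (t • p.1, p.2))]
              fun x => kerProj (del g x) e (ι w) := h3.mono fun x hx => by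
            simp only [hx]
            rfl
          rw [← h10.fderiv_eq, h9.fderiv]
          rfl
        rw [h8, h8, h3.self_of_nhds]
        exact fderiv_kerProj_symm ((hgs h5).of_le (hm2.trans hm3)) h4 (h7 (hone t ht)) (ι v) (ι w))
      (fun t ht => (hp t ht).2.2.2.2.2.1) v
    have h1 := (hp 1 ⟨zero_le_one, le_rfl⟩).2.2.1.self_of_nhds
    rw [one_smul] at h1
    rw [h1] at h
    exact h
  -- the differential at the base point
  have hAy₀ : ∀ z : K, A y₀ z = ι z := by
    intro z
    rw [hAA.self_of_nhds]
    change kerProj (del g y₀) e (ι z) = ι z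
    rw [kerProj_apply, hιθ z, mul_zero, zero_smul, sub_zero]
  have hΨd : DifferentiableAt ℝ Ψ 0 := hΨ.differentiableAt hm0
  -- The differential at 0 identifies K × ℂ with ker ∂r ⊕ ℂe, so Ψ is a local diffeomorphism.
  have hD : ∀ z c, fderiv ℝ Ψ 0 (z, c) = ι z + c • e := by
    intro z c
    have h1 : fderiv ℝ Ψ 0 (z, 0) = ι z := by
      have := fderiv_radial_solution_zero (Ψ := Ψ) (A := A) (q := (0 : ℂ)) (hΨ.of_le hm1)
        hA.continuous.continuousAt hrad z
      rw [← hAy₀ z, ← hΨ0]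
      exact this
    have h2 : fderiv ℝ Ψ 0 (0, c) = c • e := by
      have h3 : HasFDerivAt (fun q : ℂ => Ψ ((0 : K), q)) ((fderiv ℝ Ψ 0).comp
          (ContinuousLinearMap.inr ℝ K ℂ)) 0 :=
        HasFDerivAt.comp (0 : ℂ) hΨd.hasFDerivAt (hasFDerivAt_prodMk_right (0 : K) (0 : ℂ))
      have h4 : HasFDerivAt (fun q : ℂ => y₀ + B q) B 0 := B.hasFDerivAt.const_add y₀
      exact DFunLike.congr_fun (h3.unique (h4.congr_of_eventuallyEq hΨB)) c
    have h3 : ((z, c) : K × ℂ) = (z, 0) + (0, c) := by simp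
    rw [h3, map_add, h1, h2]
  have hθz : ∀ (z : K) (c : ℂ), del g y₀ (ι z + c • e) = c := by
    intro z c
    rw [map_add, hιθ z, map_smul, he, smul_eq_mul, mul_one, zero_add]
  have hsurj : ∀ v, ∃ z, ι z = v - del g y₀ v • e := by
    intro v
    rw [← hι, map_sub, map_smul, he, smul_eq_mul, mul_one, sub_self]
  let L : (K × ℂ) ≃L[ℝ] E := ContinuousLinearEquiv.ofBijective (fderiv ℝ Ψ 0)
    (LinearMap.ker_eq_bot'.2 fun p hp => by
      have hp' : fderiv ℝ Ψ 0 (p.1, p.2) = 0 := hp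
      rw [hD] at hp'
      have h1 := hθz p.1 p.2
      rw [hp', map_zero] at h1
      rw [← h1, zero_smul, add_zero] at hp'
      exact Prod.ext (hinj (hp'.trans (map_zero ι).symm)) h1.symm)
    (LinearMap.range_eq_top.2 fun v => by
      obtain ⟨z, hz⟩ := hsurj v
      refine ⟨(z, del g y₀ v), (hD _ _).trans ?_⟩
      rw [hz, sub_add_cancel])
  have hL : HasFDerivAt Ψ (L : K × ℂ →L[ℝ] E) 0 := hΨd.hasFDerivAt
  have hstrict := hΨ.hasStrictFDerivAt' hL hm0
  refine ⟨Ψ, hΨ.localInverse hL hm0, hΨ, hΨ0, ?_, ?_, hstrict.eventually_left_inverse, ?_,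
    hlevel, hleaf, hA₀s, hee, ?_⟩
  · have := hΨ.to_localInverse hL hm0
    rwa [hΨ0] at this
  · have := hΨ.localInverse_apply_image hL hm0
    rwa [hΨ0] at this
  · have := hstrict.eventually_right_inverse
    rwa [hΨ0] at this
  · intro y hy v hv
    obtain ⟨z, hz⟩ := hsurj v
    refine ⟨z, ?_⟩
    rw [kerProj_apply, hz]
    simp only [map_sub, map_smul, hv, smul_eq_mul, zero_sub, mul_neg, neg_smul, sub_neg_eq_add]
    rw [mul_comm _ (del g y e), inv_mul_cancel_left₀ hy, sub_add_cancel]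

end Leaves

/-! ### Local solvability of the tangential equation in the model space -/

section Solve

open Set

universe u

/-- A conjugate linear form as a real linear map. -/
noncomputable def conjRestrictL (E : Type*) [NormedAddCommGroup E] [NormedSpace ℂ E] :
    (E →L⋆[ℂ] ℂ) →L[ℝ] (E →L[ℝ] ℂ) :=
  LinearMap.mkContinuous₂
    (LinearMap.mk₂ ℝ (fun (l : E →L⋆[ℂ] ℂ) (w : E) => l w) (fun _ _ _ => rfl)
      (fun _ _ _ => rfl) (fun l _ _ => map_add l _ _) (fun c l w => by
        rw [← Complex.coe_smul, map_smulₛₗ, Complex.conj_ofReal, Complex.coe_smul])) 1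
    (fun l w => by simpa using l.le_opNorm w)

/-- The conjugates of the coordinate functions of a basis. -/
noncomputable def conjCoord {K ι : Type*} [NormedAddCommGroup K] [NormedSpace ℂ K]
    [FiniteDimensional ℂ K] (β : Module.Basis ι ℂ K) (i : ι) : K →L⋆[ℂ] ℂ where
  toFun w := starRingEnd ℂ (β.coord i w)
  map_add' v w := by rw [map_add, map_add]
  map_smul' c v := by rw [map_smul, smul_eq_mul, map_mul, smul_eq_mul]
  cont := Complex.continuous_conj.comp (LinearMap.continuous_of_finiteDimensional _)

theorem conjCoord_apply {K ι : Type*} [NormedAddCommGroup K] [NormedSpace ℂ K]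
    [FiniteDimensional ℂ K] (β : Module.Basis ι ℂ K) (i : ι) (w : K) :
    conjCoord β i w = starRingEnd ℂ (β.coord i w) := rfl

/-- The complex line through `v` in the first factor. -/
noncomputable def lineCLM {K : Type*} [NormedAddCommGroup K] [NormedSpace ℂ K] (v : K) :
    ℂ →L[ℝ] K × ℂ :=
  (ContinuousLinearMap.inl ℝ K ℂ).comp
    ((ContinuousLinearMap.toSpanSingleton ℂ v).restrictScalars ℝ)

theorem lineCLM_apply {K : Type*} [NormedAddCommGroup K] [NormedSpace ℂ K] (v : K) (ζ : ℂ) :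
    lineCLM v ζ = (ζ • v, 0) := rfl

theorem fderiv_slice {K F : Type*} [NormedAddCommGroup K] [NormedSpace ℂ K] [NormedAddCommGroup F]
    [NormedSpace ℝ F] {f : K × ℂ → F} {z : K} {c : ℂ} (hf : DifferentiableAt ℝ f (z, c)) :
    HasFDerivAt (fun z => f (z, c)) ((fderiv ℝ f (z, c)).comp (ContinuousLinearMap.inl ℝ K ℂ)) z :=
  HasFDerivAt.comp z hf.hasFDerivAt (hasFDerivAt_prodMk_left z c)

theorem dbarAlong_lineCLM {K : Type*} [NormedAddCommGroup K] [NormedSpace ℂ K] {f : K × ℂ → ℂ}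
    {z : K} {c : ℂ} (hf : DifferentiableAt ℝ f (z, c)) (v : K) :
    dbarAlong (lineCLM v) f (z, c) = dbar (fun z => f (z, c)) z v := by
  rw [dbarAlong, dbar_apply, (fderiv_slice hf).fderiv, lineCLM_apply, lineCLM_apply, one_smul]
  rfl

variable {E : Type u} [NormedAddCommGroup E] [NormedSpace ℂ E] [FiniteDimensional ℂ E]

/-- On a leaf, z ↦ Ψ(z, c) has the complex linear differential `kerProj` ∘ ι, so it is holomorphic
and pulls the equation back to a ∂̄-system in z, with parameter c and C^m coefficients. The
pull-back of u by Φ then solves the original equation on r = 0. -/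
theorem exists_dbar_eq_of_kernel {m : ℕ} (hm : 2 ≤ m) {r : E → ℝ} {y₀ : E}
    (hr : ContDiffAt ℝ (m + 1 : ℕ) r y₀)
    {K : Type u} [NormedAddCommGroup K] [NormedSpace ℂ K] [FiniteDimensional ℂ K]
    {ι : K →L[ℂ] E} (hinj : Function.Injective ι)
    (hι : ∀ v, del (fun x => ((r x : ℝ) : ℂ)) y₀ v = 0 ↔ ∃ z, ι z = v)
    {e : E} (he : del (fun x => ((r x : ℝ) : ℂ)) y₀ e = 1)
    (hlevi : ∀ᶠ y in 𝓝 y₀, r y = 0 → ∀ v w, del (fun x => ((r x : ℝ) : ℂ)) y v = 0 →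
      del (fun x => ((r x : ℝ) : ℂ)) y w = 0 →
      del (dbar fun x => ((r x : ℝ) : ℂ)) y v w = 0)
    {b : E → E →L⋆[ℂ] ℂ} (hb : ContDiffAt ℝ m b y₀)
    (hcl : ∀ᶠ y in 𝓝 y₀, r y = 0 → ∀ v w, del (fun x => ((r x : ℝ) : ℂ)) y v = 0 →
      del (fun x => ((r x : ℝ) : ℂ)) y w = 0 → dbarForm b y v w = 0) :
    ∃ u : E → ℂ, ContDiffAt ℝ m u y₀ ∧ ∀ᶠ y in 𝓝 y₀, r y = 0 → ∀ v,
      del (fun x => ((r x : ℝ) : ℂ)) y v = 0 → dbar u y v = b y v := by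
  have hm0 : (m : WithTop ℕ∞) ≠ 0 := by exact_mod_cast (by omega : m ≠ 0)
  have hm2 : (2 : WithTop ℕ∞) ≤ m := by exact_mod_cast hm
  obtain ⟨Ψ, Φ, hΨ, hΨ0, hΦ, hΦ0, hΦΨ, hΨΦ, hlevel, hleaf, hA, hne, hsurj⟩ :=
    exists_leaf_coordinates hm hr hinj hι he hlevi
  set θ := del (fun x => ((r x : ℝ) : ℂ)) with hθ
  have hΨt : Filter.Tendsto Ψ (𝓝 0) (𝓝 y₀) := by
    have := hΨ.continuousAt.tendsto
    rwa [hΨ0] at this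
  have hΦt : Filter.Tendsto Φ (𝓝 y₀) (𝓝 0) := by
    have := hΦ.continuousAt.tendsto
    rwa [hΦ0] at this
  let β := Module.finBasis ℂ K
  -- Near 0 this is the preimage of the hypersurface. Its condition involves only c, so it is
  -- invariant under all translations in z.
  set S : Set (K × ℂ) := {p | r (y₀ + p.2 • e) = 0} with hS
  have hΨe : ∀ᶠ p in 𝓝 (0 : K × ℂ), ContDiffAt ℝ m Ψ p := hΨ.eventually (by simp)
  have hbe : ∀ᶠ y in 𝓝 y₀, ContDiffAt ℝ m b y := hb.eventually (by simp)
  set a₀ : K → K × ℂ → ℂ := fun v p => b (Ψ p) (kerProj (θ (Ψ p)) e (ι v)) with ha₀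
  have ha₀s : ∀ v, ∀ᶠ p in 𝓝 (0 : K × ℂ), ContDiffAt ℝ m (a₀ v) p := by
    intro v
    filter_upwards [hΨe, hΨt.eventually hbe, hΨt.eventually hA] with p h1 h2 h3
    have h4 : ContDiffAt ℝ m (fun p => conjRestrictL E (b (Ψ p))) p :=
      contDiffAt_clm_comp (G := E →L[ℝ] ℂ) (h2.comp p h1) (conjRestrictL E)
    exact h4.clm_apply ((h3.comp p h1).clm_apply contDiffAt_const)
  choose a ha _ haa using fun i => exists_contDiff_eventuallyEq (ha₀s (β i))
  have hslice : ∀ᶠ p in 𝓝 (0 : K × ℂ), p ∈ S → r (Ψ p) = 0 ∧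
      ContDiffAt ℝ 2 (fun z => Ψ (z, p.2)) p.1 ∧
      (∀ᶠ z in 𝓝 p.1, ∀ v, fderiv ℝ (fun z => Ψ (z, p.2)) z v =
        kerProj (θ (Ψ (z, p.2))) e (ι v)) := by
    filter_upwards [hΨe.eventually_nhds, hlevel.eventually_nhds, hleaf.eventually_nhds] with
      p h1 h2 h3 hpS
    have hc : Filter.Tendsto (fun z : K => (z, p.2)) (𝓝 p.1) (𝓝 p) :=
      (Continuous.prodMk_left p.2).tendsto p.1
    refine ⟨h2.self_of_nhds.trans hpS, ?_, ?_⟩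
    · exact (h1.self_of_nhds.of_le hm2).comp p.1 (f := fun z : K => (z, p.2))
        (contDiffAt_id.prodMk contDiffAt_const)
    · filter_upwards [hc.eventually h1, hc.eventually h2, hc.eventually h3] with z h1 h2 h3 v
      rw [(fderiv_slice (h1.differentiableAt hm0)).fderiv]
      exact h3 (h2.trans hpS) v
  have hcl' : ∀ᶠ p in 𝓝 (0 : K × ℂ), p ∈ S → ∀ i j,
      dbarAlong (lineCLM (β i)) (a j) p = dbarAlong (lineCLM (β j)) (a i) p := by
    have haa' : ∀ᶠ p in 𝓝 (0 : K × ℂ), ∀ i, a i p = a₀ (β i) p :=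
      Filter.eventually_all.2 haa
    filter_upwards [hslice, hΨt.eventually hcl, haa'.eventually_nhds, hΨt.eventually hbe,
      hΨt.eventually hne] with p hp hclp haap hbp hnep hpS i j
    obtain ⟨hr0, hφ2, hφd⟩ := hp hpS
    have hc : Filter.Tendsto (fun z : K => (z, p.2)) (𝓝 p.1) (𝓝 p) :=
      (Continuous.prodMk_left p.2).tendsto p.1
    set φ : K → E := fun z => Ψ (z, p.2) with hφ
    -- Near p this is the pull-back of b to the leaf. Closedness of b along the leaf, transported by
    -- `dbarForm_pullback`, is the compatibility of the coefficients.
    let α : K → K →L⋆[ℂ] ℂ := fun z => ∑ i, a i (z, p.2) • conjCoord β i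
    have had : ∀ i, DifferentiableAt ℝ (a i) p := fun i => (ha i).differentiable hm0 p
    have hα : HasFDerivAt α (∑ i, ((fderiv ℝ (a i) p).comp
        (ContinuousLinearMap.inl ℝ K ℂ)).smulRight (conjCoord β i)) p.1 :=
      HasFDerivAt.fun_sum fun i _ => (fderiv_slice (had i)).smul_const (conjCoord β i)
    have hαβ : ∀ v j, fderiv ℝ α p.1 v (β j) = fderiv ℝ (a j) p (v, 0) := by
      intro v j
      rw [hα.fderiv]
      simp only [sum_apply, ContinuousLinearMap.smulRight_apply, ContinuousLinearMap.comp_apply,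
        ContinuousLinearMap.inl_apply, smul_apply, conjCoord_apply, Module.Basis.coord_apply,
        Module.Basis.repr_self, smul_eq_mul]
      rw [Finset.sum_eq_single j]
      · simp
      · intro k _ hk
        simp [hk.symm]
      · simp
    have hαφ : ∀ᶠ z in 𝓝 p.1, ∀ w, α z w = b (φ z) (fderiv ℝ φ z w) := by
      filter_upwards [hφd, hc.eventually haap] with z h1 h2 w
      rw [h1]
      simp only [α, sum_apply, smul_apply, conjCoord_apply, h2, ha₀, smul_eq_mul]
      conv_rhs => rw [← β.sum_repr w]
      simp only [map_sum, map_smul, map_smulₛₗ, smul_eq_mul, Module.Basis.coord_apply]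
      exact Finset.sum_congr rfl fun i _ => mul_comm _ _
    have hpull := dbarForm_pullback (b := b) hφ2 (hφd.mono fun z hz v => by
      rw [hz, hz, map_smul, map_smul]) (hbp.differentiableAt hm0) hα.differentiableAt hαφ
      (β i) (β j)
    have h0 : dbarForm b (φ p.1) (fderiv ℝ φ p.1 (β i)) (fderiv ℝ φ p.1 (β j)) = 0 := by
      rw [hφd.self_of_nhds, hφd.self_of_nhds]
      exact hclp hr0 _ _ (apply_kerProj hnep _) (apply_kerProj hnep _)
    rw [h0, dbarForm_apply, hαβ, hαβ, hαβ, hαβ] at hpull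
    simp only [dbarAlong, lineCLM_apply, one_smul]
    simp only [smul_eq_mul] at hpull
    linear_combination hpull
  obtain ⟨u, hu, hua⟩ := exists_dbarAlong_eq hm (fun i => lineCLM (β i))
    (fun i => ((LinearMap.toContinuousLinearMap (β.coord i)).restrictScalars ℝ).comp
      (ContinuousLinearMap.fst ℝ K ℂ)) (fun i ζ => by
        simp [lineCLM_apply]) (fun i j hij ζ => by
        simp [lineCLM_apply, hij.symm]) (S := S) (fun i y hy ζ => by
        simpa [hS, lineCLM_apply] using hy) a ha hcl'
  refine ⟨fun y => u (Φ y), hu.contDiffAt.comp y₀ hΦ, ?_⟩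
  have haa' : ∀ᶠ p in 𝓝 (0 : K × ℂ), ∀ i, a i p = a₀ (β i) p := Filter.eventually_all.2 haa
  filter_upwards [hΦt.eventually hslice, hΦt.eventually hlevel, hΦt.eventually hua,
    hΦt.eventually haa', hΨΦ, hΦt.eventually hΦΨ.eventually_nhds, hne,
    hΦ.eventually (by simp)] with y h1 h2 h3 h4 h5 h6 h7 h8 hy v hv
  set p := Φ y with hp
  have hpS : p ∈ S := by
    rw [h5, hy] at h2
    exact h2.symm
  obtain ⟨-, hφ2, hφd⟩ := h1 hpS
  have hc : Filter.Tendsto (fun z : K => (z, p.2)) (𝓝 p.1) (𝓝 p) :=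
    (Continuous.prodMk_left p.2).tendsto p.1
  obtain ⟨w, rfl⟩ := hsurj y h7 v hv
  set φ : K → E := fun z => Ψ (z, p.2) with hφ
  have hφy : φ p.1 = y := h5
  have hud : ∀ q, DifferentiableAt ℝ u q := fun q => hu.differentiable hm0 q
  have hcomp := dbar_comp (φ := φ) (x := p.1) (u := fun y => u (Φ y))
    (hφ2.differentiableAt (by norm_num)) (fun v => by
      rw [hφd.self_of_nhds, hφd.self_of_nhds, map_smul, map_smul])
    (by
      rw [hφy]
      exact (hud _).comp y (h8.differentiableAt hm0)) w
  rw [hφd.self_of_nhds] at hcomp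
  have hφy' : Ψ (p.1, p.2) = y := h5
  rw [hφy', hφy] at hcomp
  rw [← hcomp]
  have hcongr : (fun z => u (Φ (φ z))) =ᶠ[𝓝 p.1] fun z => u (z, p.2) :=
    (hc.eventually h6).mono fun z hz => congrArg u hz
  rw [(dbar_congr hcongr).self_of_nhds]
  -- The system was solved in the basis directions only; conjugate linearity gives all directions.
  have hext : ((dbar (fun z => u (z, p.2)) p.1 : K →L⋆[ℂ] ℂ) : K →ₛₗ[starRingEnd ℂ] ℂ) =
      ((b y).comp ((kerProj (θ y) e).comp ι) : K →L⋆[ℂ] ℂ) := by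
    refine β.ext fun i => ?_
    have h9 := h3 hpS i
    rw [dbarAlong_lineCLM (z := p.1) (c := p.2) (hud _), h4 i, ha₀] at h9
    simp only [h5] at h9
    exact h9
  exact DFunLike.congr_fun hext w

/-- **Local solvability of `∂̄_b` on a Levi-flat hypersurface**, with no loss of
differentiability. -/
theorem exists_dbar_eq_on_levi_flat {m : ℕ} (hm : 2 ≤ m) {r : E → ℝ} {y₀ : E}
    (hr : ContDiffAt ℝ (m + 1 : ℕ) r y₀) (hdr : fderiv ℝ r y₀ ≠ 0)
    (hlevi : ∀ᶠ y in 𝓝 y₀, r y = 0 → ∀ v w, del (fun x => ((r x : ℝ) : ℂ)) y v = 0 →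
      del (fun x => ((r x : ℝ) : ℂ)) y w = 0 →
      del (dbar fun x => ((r x : ℝ) : ℂ)) y v w = 0)
    {b : E → E →L⋆[ℂ] ℂ} (hb : ContDiffAt ℝ m b y₀)
    (hcl : ∀ᶠ y in 𝓝 y₀, r y = 0 → ∀ v w, del (fun x => ((r x : ℝ) : ℂ)) y v = 0 →
      del (fun x => ((r x : ℝ) : ℂ)) y w = 0 → dbarForm b y v w = 0) :
    ∃ u : E → ℂ, ContDiffAt ℝ m u y₀ ∧ ∀ᶠ y in 𝓝 y₀, r y = 0 → ∀ v,
      del (fun x => ((r x : ℝ) : ℂ)) y v = 0 → dbar u y v = b y v := by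
  have hrd : DifferentiableAt ℝ r y₀ := hr.differentiableAt (by simp)
  obtain ⟨v, hv⟩ : ∃ v, fderiv ℝ r y₀ v ≠ 0 := by
    by_contra! h
    exact hdr (ContinuousLinearMap.ext h)
  have hv' : del (fun x => ((r x : ℝ) : ℂ)) y₀ v ≠ 0 := fun h =>
    hv ((del_ofReal_eq_zero_iff hrd v).1 h).1
  let K : Submodule ℂ E := LinearMap.ker (del (fun x => ((r x : ℝ) : ℂ)) y₀ : E →ₗ[ℂ] ℂ)
  exact exists_dbar_eq_of_kernel hm hr (ι := K.subtypeL) Subtype.val_injective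
    (fun v => ⟨fun h => ⟨⟨v, h⟩, rfl⟩, by rintro ⟨z, rfl⟩; exact z.2⟩)
    (e := (del (fun x => ((r x : ℝ) : ℂ)) y₀ v)⁻¹ • v)
    (by rw [map_smul, smul_eq_mul, inv_mul_cancel₀ hv']) hlevi hb hcl

end Solve

/-! ### Forms, functions and derivatives in arbitrary holomorphic charts -/

section Charts

universe u

variable {E : Type u} [NormedAddCommGroup E] [NormedSpace ℂ E]
  {X : Type*} [TopologicalSpace X] [ChartedSpace E X] [IsManifold 𝓘(ℂ, E) ω X]

theorem contDiffAt_transition {φ ψ : OpenPartialHomeomorph X E} (hφ : φ ∈ atlas E X)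
    (hψ : ψ ∈ atlas E X) {y : E} (hy : y ∈ φ.target) (hy' : φ.symm y ∈ ψ.source) :
    ContDiffAt ℂ ω (ψ ∘ φ.symm) y := by
  have h := ((contDiffGroupoid ω 𝓘(ℂ, E)).compatible hφ hψ).1
  have h' : ContDiffOn ℂ ω (ψ ∘ φ.symm) (φ.symm ≫ₕ ψ).source := by
    simpa [contDiffPregroupoid] using h
  refine h'.contDiffAt ((φ.symm ≫ₕ ψ).open_source.mem_nhds ?_)
  simpa using ⟨hy, hy'⟩

theorem isHolAt_of_differentiableAt {F G : Type*} [NormedAddCommGroup F] [NormedSpace ℂ F]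
    [NormedAddCommGroup G] [NormedSpace ℂ G] {f : F → G} {x : F} (h : DifferentiableAt ℂ f x) :
    IsHolAt f x := by
  intro v
  rw [h.fderiv_restrictScalars ℝ, ContinuousLinearMap.coe_restrictScalars', map_smul]

theorem isHolAt_transition {φ ψ : OpenPartialHomeomorph X E} (hφ : φ ∈ atlas E X)
    (hψ : ψ ∈ atlas E X) {y : E} (hy : y ∈ φ.target) (hy' : φ.symm y ∈ ψ.source) :
    IsHolAt (ψ ∘ φ.symm) y :=
  isHolAt_of_differentiableAt ((contDiffAt_transition hφ hψ hy hy').differentiableAt (by simp))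

theorem contDiffAt_real_transition {φ ψ : OpenPartialHomeomorph X E} (hφ : φ ∈ atlas E X)
    (hψ : ψ ∈ atlas E X) {y : E} (hy : y ∈ φ.target) (hy' : φ.symm y ∈ ψ.source)
    {n : WithTop ℕ∞} : ContDiffAt ℝ n (ψ ∘ φ.symm) y :=
  ((contDiffAt_transition hφ hψ hy hy').restrict_scalars ℝ).of_le le_top

theorem eventually_mem_target_source {E X : Type*} [TopologicalSpace E] [TopologicalSpace X]
    {φ ψ : OpenPartialHomeomorph X E} {y : E} (hy : y ∈ φ.target)
    (hy' : φ.symm y ∈ ψ.source) : ∀ᶠ x in 𝓝 y, x ∈ φ.target ∧ φ.symm x ∈ ψ.source :=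
  (φ.open_target.eventually_mem hy).and
    ((φ.continuousAt_symm hy).eventually (ψ.open_source.mem_nhds hy'))

theorem isManifold_real : IsManifold 𝓘(ℝ, E) ∞ X := by
  refine isManifold_of_contDiffOn _ _ _ fun e e' he he' => ?_
  intro x hx
  have hx' : x ∈ e.target ∧ e.symm x ∈ e'.source := by simpa using hx
  have := contDiffAt_real_transition he he' hx'.1 hx'.2 (n := ∞)
  exact this.contDiffWithinAt

/-- Tangent spaces are identified with E by the preferred chart at each point, so the derivative of
an inverse chart is that of the transition map to the preferred chart of the image point. -/
theorem mfderiv_symm_apply {φ : OpenPartialHomeomorph X E} (hφ : φ ∈ atlas E X) {y : E}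
    (hy : y ∈ φ.target) (w : E) :
    (mfderiv 𝓘(ℂ, E) 𝓘(ℂ, E) φ.symm y : E →L[ℂ] E) w =
      fderiv ℝ (chartAt E (φ.symm y) ∘ φ.symm) y w := by
  have : IsManifold 𝓘(ℂ, E) 1 X := IsManifold.of_le (n := ω) le_top
  rw [(mdifferentiableAt_atlas_symm hφ hy).mfderiv]
  have hd : DifferentiableAt ℂ (chartAt E (φ.symm y) ∘ φ.symm) y :=
    (contDiffAt_transition hφ (chart_mem_atlas E _) hy (mem_chart_source E _)).differentiableAt
      (by simp)
  rw [hd.fderiv_restrictScalars ℝ]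
  simp [writtenInExtChartAt, chartAt_self_eq, Function.comp_def]
  rfl

theorem Form01.inChart_apply {φ : OpenPartialHomeomorph X E} (hφ : φ ∈ atlas E X) {y : E}
    (hy : y ∈ φ.target) (a : Form01 E X) (w : E) :
    a.inChart φ y w = a (φ.symm y) (fderiv ℝ (chartAt E (φ.symm y) ∘ φ.symm) y w : E) := by
  rw [← mfderiv_symm_apply hφ hy]
  rfl

/-- The chain rule for changes of charts. -/
theorem fderiv_transition_comp {φ ψ χ : OpenPartialHomeomorph X E} (hφ : φ ∈ atlas E X)
    (hψ : ψ ∈ atlas E X) (hχ : χ ∈ atlas E X) {y : E} (hy : y ∈ φ.target)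
    (hy' : φ.symm y ∈ ψ.source) (hy'' : φ.symm y ∈ χ.source) (w : E) :
    fderiv ℝ (χ ∘ φ.symm) y w =
      fderiv ℝ (χ ∘ ψ.symm) (ψ (φ.symm y)) (fderiv ℝ (ψ ∘ φ.symm) y w) := by
  have h1 : ((χ ∘ ψ.symm) ∘ (ψ ∘ φ.symm)) =ᶠ[𝓝 y] χ ∘ φ.symm := by
    filter_upwards [eventually_mem_target_source hy hy'] with x hx
    simp only [Function.comp_apply, ψ.left_inv hx.2]
  rw [← h1.fderiv_eq, fderiv_comp y]
  · rfl
  · exact (contDiffAt_real_transition hψ hχ (ψ.map_source hy') (by rwa [ψ.left_inv hy'])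
      (n := 1)).differentiableAt (by norm_num)
  · exact (contDiffAt_real_transition hφ hψ hy hy' (n := 1)).differentiableAt (by norm_num)

theorem Form01.inChart_transition {φ ψ : OpenPartialHomeomorph X E} (hφ : φ ∈ atlas E X)
    (hψ : ψ ∈ atlas E X) {y : E} (hy : y ∈ φ.target) (hy' : φ.symm y ∈ ψ.source)
    (a : Form01 E X) (w : E) :
    a.inChart φ y w = a.inChart ψ ((ψ ∘ φ.symm) y) (fderiv ℝ (ψ ∘ φ.symm) y w) := by
  have h1 : ψ (φ.symm y) ∈ ψ.target := ψ.map_source hy'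
  have h2 : ψ.symm (ψ (φ.symm y)) = φ.symm y := ψ.left_inv hy'
  rw [Form01.inChart_apply hφ hy, Function.comp_apply, Form01.inChart_apply hψ h1, h2,
    fderiv_transition_comp hφ hψ (chart_mem_atlas E _) hy hy' (mem_chart_source E _)]

theorem fderiv_transition_self {φ ψ : OpenPartialHomeomorph X E} (hφ : φ ∈ atlas E X)
    (hψ : ψ ∈ atlas E X) {y : E} (hy : y ∈ φ.target) (hy' : φ.symm y ∈ ψ.source) (w : E) :
    fderiv ℝ (φ ∘ ψ.symm) (ψ (φ.symm y)) (fderiv ℝ (ψ ∘ φ.symm) y w) = w := by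
  rw [← fderiv_transition_comp hφ hψ hφ hy hy' (φ.map_target hy)]
  have : (φ ∘ φ.symm) =ᶠ[𝓝 y] id := by
    filter_upwards [φ.open_target.eventually_mem hy] with x hx
    exact φ.right_inv hx
  rw [this.fderiv_eq]
  simp

/-- Tangent vectors in the preferred chart and in another one. -/
theorem exists_fderiv_chartAt_eq {φ : OpenPartialHomeomorph X E} (hφ : φ ∈ atlas E X) {y : E}
    (hy : y ∈ φ.target) (v : E) : ∃ w, fderiv ℝ (chartAt E (φ.symm y) ∘ φ.symm) y w = v := by
  set ψ := chartAt E (φ.symm y) with hψ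
  have hs : φ.symm y ∈ ψ.source := mem_chart_source E _
  have hψa : ψ ∈ atlas E X := chart_mem_atlas E _
  refine ⟨fderiv ℝ (φ ∘ ψ.symm) (ψ (φ.symm y)) v, ?_⟩
  have h1 : ψ.symm (ψ (φ.symm y)) = φ.symm y := ψ.left_inv hs
  have h2 : ψ.symm (ψ (φ.symm y)) ∈ φ.source := by
    rw [h1]
    exact φ.map_target hy
  have := fderiv_transition_self hψa hφ (ψ.map_source hs) h2 v
  rwa [h1, φ.right_inv hy] at this

theorem mfderiv_real_apply {F : Type*} [NormedAddCommGroup F] [NormedSpace ℝ F] {g : X → F}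
    {φ : OpenPartialHomeomorph X E} (hφ : φ ∈ atlas E X) {y : E} (hy : y ∈ φ.target)
    (hg : MDifferentiableAt 𝓘(ℝ, E) 𝓘(ℝ, F) g (φ.symm y)) (w : E) :
    (mfderiv 𝓘(ℝ, E) 𝓘(ℝ, F) g (φ.symm y) : E →L[ℝ] F)
      (fderiv ℝ (chartAt E (φ.symm y) ∘ φ.symm) y w) = fderiv ℝ (g ∘ φ.symm) y w := by
  set ψ := chartAt E (φ.symm y) with hψ
  have hs : φ.symm y ∈ ψ.source := mem_chart_source E _
  have hm : (mfderiv 𝓘(ℝ, E) 𝓘(ℝ, F) g (φ.symm y) : E →L[ℝ] F) =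
      fderiv ℝ (g ∘ ψ.symm) (ψ (φ.symm y)) := by
    rw [hg.mfderiv]
    simp [writtenInExtChartAt, hψ, chartAt_self_eq, Function.comp_def]
    rfl
  have hgd : DifferentiableAt ℝ (g ∘ ψ.symm) (ψ (φ.symm y)) := by
    have := hg.differentiableWithinAt_writtenInExtChartAt
    simpa [writtenInExtChartAt, hψ, chartAt_self_eq, Function.comp_def,
      differentiableWithinAt_univ] using this
  have h1 : ((g ∘ ψ.symm) ∘ (ψ ∘ φ.symm)) =ᶠ[𝓝 y] g ∘ φ.symm := by
    filter_upwards [eventually_mem_target_source hy hs] with x hx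
    simp only [Function.comp_apply, ψ.left_inv hx.2]
  rw [hm, ← h1.fderiv_eq, fderiv_comp (g := g ∘ ψ.symm) (f := ψ ∘ φ.symm) y hgd]
  · rfl
  · exact (contDiffAt_real_transition hφ (chart_mem_atlas E _) hy hs (n := 1)).differentiableAt
      (by norm_num)

theorem contDiffAt_comp_symm {F : Type*} [NormedAddCommGroup F] [NormedSpace ℝ F] {g : X → F}
    {φ : OpenPartialHomeomorph X E} (hφ : φ ∈ atlas E X) {y : E} (hy : y ∈ φ.target) {n : ℕ}
    (hg : ContMDiffAt 𝓘(ℝ, E) 𝓘(ℝ, F) n g (φ.symm y)) : ContDiffAt ℝ n (g ∘ φ.symm) y := by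
  have : IsManifold 𝓘(ℝ, E) ∞ X := isManifold_real
  have : IsManifold 𝓘(ℝ, E) n X := IsManifold.of_le (n := ∞) (by exact_mod_cast le_top)
  have h := contMDiffOn_symm_of_mem_maximalAtlas (I := 𝓘(ℝ, E)) (n := n)
    (IsManifold.subset_maximalAtlas hφ)
  have h2 := hg.comp y ((h y hy).contMDiffAt (φ.open_target.mem_nhds hy))
  exact h2.contDiffAt

theorem contMDiffAt_comp_chart {F : Type*} [NormedAddCommGroup F] [NormedSpace ℝ F] {u : E → F}
    {φ : OpenPartialHomeomorph X E} (hφ : φ ∈ atlas E X) {q : X} (hq : q ∈ φ.source) {n : ℕ}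
    (hu : ContDiffAt ℝ n u (φ q)) : ContMDiffAt 𝓘(ℝ, E) 𝓘(ℝ, F) n (u ∘ φ) q := by
  have : IsManifold 𝓘(ℝ, E) ∞ X := isManifold_real
  have : IsManifold 𝓘(ℝ, E) n X := IsManifold.of_le (n := ∞) (by exact_mod_cast le_top)
  exact hu.contMDiffAt.comp q
    (contMDiffAt_of_mem_maximalAtlas (IsManifold.subset_maximalAtlas hφ) hq)

theorem dbarFun_inChart {u : X → ℂ} {φ : OpenPartialHomeomorph X E} (hφ : φ ∈ atlas E X) {y : E}
    (hy : y ∈ φ.target) (hu : MDifferentiableAt 𝓘(ℝ, E) 𝓘(ℝ, ℂ) u (φ.symm y)) :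
    (dbarFun E u).inChart φ y = dbar (u ∘ φ.symm) y := by
  ext w
  rw [Form01.inChart_apply hφ hy, dbar_apply, ← mfderiv_real_apply hφ hy hu,
    ← mfderiv_real_apply hφ hy hu,
    isHolAt_transition hφ (chart_mem_atlas E _) hy (mem_chart_source E _) w]
  rfl

end Charts

/-! ### Tangent spaces, Levi form and ∂̄ of a form, read in a chart -/

section Hypersurface

universe u

variable {E : Type u} [NormedAddCommGroup E] [NormedSpace ℂ E]
  {X : Type*} [TopologicalSpace X] [ChartedSpace E X] [IsManifold 𝓘(ℂ, E) ω X]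

theorem fderiv_transition_smul {φ ψ : OpenPartialHomeomorph X E} (hφ : φ ∈ atlas E X)
    (hψ : ψ ∈ atlas E X) {y : E} (hy : y ∈ φ.target) (hy' : φ.symm y ∈ ψ.source) (c : ℂ) (v : E) :
    fderiv ℝ (ψ ∘ φ.symm) y (c • v) = c • fderiv ℝ (ψ ∘ φ.symm) y v := by
  rw [((contDiffAt_transition hφ hψ hy hy').differentiableAt (by simp)).fderiv_restrictScalars ℝ,
    ContinuousLinearMap.coe_restrictScalars', map_smul]

/-- The Levi form in an arbitrary chart. -/
theorem leviForm_eq {φ : OpenPartialHomeomorph X E} (hφ : φ ∈ atlas E X) {y : E}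
    (hy : y ∈ φ.target) {f : X → ℝ} {U : Set X} (hU : IsOpen U) (hyU : φ.symm y ∈ U)
    (hf : ContMDiffOn 𝓘(ℝ, E) 𝓘(ℝ, ℝ) (2 : ℕ) f U) (v w : E) :
    leviForm f (φ.symm y) (fderiv ℝ (chartAt E (φ.symm y) ∘ φ.symm) y v)
        (fderiv ℝ (chartAt E (φ.symm y) ∘ φ.symm) y w) =
      del (dbar fun x => ((f (φ.symm x) : ℝ) : ℂ)) y v w := by
  set ψ := chartAt E (φ.symm y) with hψ
  have hs : φ.symm y ∈ ψ.source := mem_chart_source E _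
  have hψa : ψ ∈ atlas E X := chart_mem_atlas E _
  have hsm : ∀ {χ : OpenPartialHomeomorph X E}, χ ∈ atlas E X → ∀ {x}, x ∈ χ.target →
      χ.symm x ∈ U → ContDiffAt ℝ 2 (fun x => ((f (χ.symm x) : ℝ) : ℂ)) x := by
    intro χ hχ x hx hxU
    have h1 := contDiffAt_comp_symm hχ hx ((hf _ hxU).contMDiffAt (hU.mem_nhds hxU))
    exact Complex.ofRealCLM.contDiff.contDiffAt.comp x h1
  have hψy : ψ.symm (ψ (φ.symm y)) = φ.symm y := ψ.left_inv hs
  have hev : ∀ᶠ x in 𝓝 y, φ.symm x ∈ U := (φ.continuousAt_symm hy).eventually (hU.mem_nhds hyU)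
  refine (del_pullback (φ := ψ ∘ φ.symm) (contDiffAt_real_transition hφ hψa hy hs) ?_ ?_ ?_ ?_
    v w).symm
  · filter_upwards [eventually_mem_target_source hy hs] with x hx
    exact isHolAt_transition hφ hψa hx.1 hx.2
  · have h := hsm hψa (x := ψ (φ.symm y)) (ψ.map_source hs) (by rwa [hψy])
    exact (ContDiffAt.dbar (n := 1) h).differentiableAt (by norm_num)
  · exact (ContDiffAt.dbar (n := 1) (hsm hφ hy hyU)).differentiableAt (by norm_num)
  · filter_upwards [(eventually_mem_target_source hy hs).eventually_nhds, hev] with x hx hxU w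
    have hx0 := hx.self_of_nhds
    have h1 : (fun x => ((f (φ.symm x) : ℝ) : ℂ)) =ᶠ[𝓝 x]
        fun x => (fun z => ((f (ψ.symm z) : ℝ) : ℂ)) ((ψ ∘ φ.symm) x) := by
      filter_upwards [hx] with z hz
      simp only [Function.comp_apply, ψ.left_inv hz.2]
    rw [(dbar_congr h1).self_of_nhds]
    refine dbar_comp (u := fun z => ((f (ψ.symm z) : ℝ) : ℂ)) (φ := ψ ∘ φ.symm) ?_ ?_ ?_ w
    · exact (contDiffAt_real_transition hφ hψa hx0.1 hx0.2 (n := 1)).differentiableAt (by norm_num)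
    · exact isHolAt_transition hφ hψa hx0.1 hx0.2
    · refine (hsm hψa (ψ.map_source hx0.2) ?_).differentiableAt (by norm_num)
      rwa [ψ.left_inv hx0.2]

/-- The complex tangent space of a hypersurface in a chart. -/
theorem mem_holTangent_iff [CompleteSpace E] {M : Set X} {φ : OpenPartialHomeomorph X E}
    (hφ : φ ∈ atlas E X) {y : E} (hy : y ∈ φ.target) {f : X → ℝ} {U : Set X} (hU : IsOpen U)
    (hyU : φ.symm y ∈ U) (hf : ContMDiffOn 𝓘(ℝ, E) 𝓘(ℝ, ℝ) (1 : ℕ) f U)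
    (hfM : ∀ q ∈ U, q ∈ M ↔ f q = 0) (hyM : φ.symm y ∈ M)
    (hdf : fderiv ℝ (f ∘ φ.symm) y ≠ 0) (v : E) :
    (fderiv ℝ (chartAt E (φ.symm y) ∘ φ.symm) y v : E) ∈ holTangent E M (φ.symm y) ↔
      del (fun x => ((f (φ.symm x) : ℝ) : ℂ)) y v = 0 := by
  have hs : φ.symm y ∈ (chartAt E (φ.symm y)).source := mem_chart_source E _
  have hψa : chartAt E (φ.symm y) ∈ atlas E X := chart_mem_atlas E _
  have hfa : ContDiffAt ℝ (1 : ℕ) (f ∘ φ.symm) y :=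
    contDiffAt_comp_symm hφ hy ((hf _ hyU).contMDiffAt (hU.mem_nhds hyU))
  constructor
  · intro hv
    -- The defining function is itself one of the functions that tangent vectors must annihilate.
    -- Testing v and iv gives ∂f(v) = 0.
    have hext : IsExtension E 1 (M := M) 0 U (fun x => ((f x : ℝ) : ℂ)) := by
      refine ⟨hU, ?_, fun q hq => ?_⟩
      · exact (Complex.ofRealCLM.contDiff (n := ((1 : ℕ) : WithTop ℕ∞))).contMDiff.comp_contMDiffOn hf
      · change ((f q : ℝ) : ℂ) = 0
        rw [(hfM q hq).1 q.2, Complex.ofReal_zero]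
    have hmd : MDifferentiableAt 𝓘(ℝ, E) 𝓘(ℝ, ℂ) (fun x => ((f x : ℝ) : ℂ)) (φ.symm y) :=
      ((hext.2.1 _ hyU).contMDiffAt (hU.mem_nhds hyU)).mdifferentiableAt (by simp)
    have key : ∀ c : ℂ, fderiv ℝ (fun x => ((f (φ.symm x) : ℝ) : ℂ)) y (c • v) = 0 := by
      intro c
      have h1 := hv c U _ hyU hext
      have h2 := mfderiv_real_apply hφ hy hmd (c • v)
      rw [fderiv_transition_smul hφ hψa hy hs] at h2
      exact h2.symm.trans h1
    rw [del_apply]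
    have h1 := key 1
    rw [one_smul] at h1
    rw [h1, key Complex.I]
    simp
  · intro hv c V g hV hg
    have hmd : MDifferentiableAt 𝓘(ℝ, E) 𝓘(ℝ, ℂ) g (φ.symm y) :=
      ((hg.2.1 _ hV).contMDiffAt (hg.1.mem_nhds hV)).mdifferentiableAt (by simp)
    have h2 := mfderiv_real_apply hφ hy hmd (c • v)
    rw [fderiv_transition_smul hφ hψa hy hs] at h2
    refine h2.trans ?_
    -- Conversely, any test function vanishes on the zero set of f, so its differential kills ker
    -- Df, which contains every complex multiple of v.
    refine fderiv_apply_eq_zero_of_zeroSet (f := f ∘ φ.symm) hfa ((hfM _ hyU).1 hyM) hdf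
      (contDiffAt_comp_symm hφ hy ((hg.2.1 _ hV).contMDiffAt (hg.1.mem_nhds hV))) ?_ ?_
    · filter_upwards [(φ.continuousAt_symm hy).eventually ((hU.inter hg.1).mem_nhds ⟨hyU, hV⟩)]
        with x hx hx0
      exact hg.2.2 ⟨φ.symm x, (hfM _ hx.1).2 hx0⟩ hx.2
    · have h3 := (del_ofReal_eq_zero_iff (r := f ∘ φ.symm) (hfa.differentiableAt (by simp)) v).1 hv
      have h4 : c • v = c.re • v + c.im • (Complex.I • v) := by
        rw [← Complex.coe_smul c.re v, ← Complex.coe_smul c.im (Complex.I • v), smul_smul,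
          ← add_smul, Complex.re_add_im]
      rw [h4, map_add, map_smul, map_smul, h3.1, h3.2, smul_zero, smul_zero, add_zero]

/-- A local defining function of a Levi-flat hypersurface, in a chart. -/
theorem IsLeviFlatHypersurface.exists_chart_defining [CompleteSpace E] {m : ℕ} (hm : 1 ≤ m)
    {M : Set X} (hM : IsLeviFlatHypersurface E (m + 1) M) {φ : OpenPartialHomeomorph X E}
    (hφ : φ ∈ atlas E X) {P : X} (hP : P ∈ M) (hPφ : P ∈ φ.source) :
    ∃ r : E → ℝ, ∀ᶠ y in 𝓝 (φ P), y ∈ φ.target ∧ ContDiffAt ℝ (m + 1 : ℕ) r y ∧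
      (φ.symm y ∈ M ↔ r y = 0) ∧ (r y = 0 → fderiv ℝ r y ≠ 0 ∧
        (∀ v, (fderiv ℝ (chartAt E (φ.symm y) ∘ φ.symm) y v : E) ∈ holTangent E M (φ.symm y) ↔
          del (fun x => ((r x : ℝ) : ℂ)) y v = 0) ∧
        ∀ v w, del (fun x => ((r x : ℝ) : ℂ)) y v = 0 → del (fun x => ((r x : ℝ) : ℂ)) y w = 0 →
          del (dbar fun x => ((r x : ℝ) : ℂ)) y v w = 0) := by
  obtain ⟨U, f, hU, hPU, hf, hfM, hdf, hlevi⟩ := hM.exists_defining P hP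
  have hcont : ContinuousAt φ.symm (φ P) := φ.continuousAt_symm (φ.map_source hPφ)
  refine ⟨f ∘ φ.symm, ?_⟩
  filter_upwards [φ.open_target.mem_nhds (φ.map_source hPφ), hcont.eventually
    (show ∀ᶠ q in 𝓝 (φ.symm (φ P)), q ∈ U from hU.mem_nhds (by rwa [φ.left_inv hPφ]))] with y hy hyU
  have hfy : ContMDiffAt 𝓘(ℝ, E) 𝓘(ℝ, ℝ) (m + 1 : ℕ) f (φ.symm y) :=
    (hf _ hyU).contMDiffAt (hU.mem_nhds hyU)
  refine ⟨hy, contDiffAt_comp_symm hφ hy hfy, hfM _ hyU, fun h0 => ?_⟩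
  have hyM : φ.symm y ∈ M := (hfM _ hyU).2 h0
  have hd : fderiv ℝ (f ∘ φ.symm) y ≠ 0 := by
    intro h
    refine hdf _ ⟨hyM, hyU⟩ (ContinuousLinearMap.ext fun v => ?_)
    obtain ⟨w, hw⟩ := exists_fderiv_chartAt_eq hφ hy v
    have h1 := mfderiv_real_apply hφ hy (hfy.mdifferentiableAt (by simp)) w
    rw [h, hw] at h1
    exact h1
  have hmem := mem_holTangent_iff hφ hy hU hyU (hf.of_le (by exact_mod_cast (by omega : 1 ≤ m + 1)))
    hfM hyM hd
  refine ⟨hd, hmem, fun v w hv hw => ?_⟩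
  rw [← hlevi _ ⟨hyM, hyU⟩ _ ((hmem v).2 hv) _ ((hmem w).2 hw)]
  exact (leviForm_eq hφ hy hU hyU (hf.of_le (by exact_mod_cast (by omega : 2 ≤ m + 1))) v w).symm

/-- The value of `∂̄b` at a point in an arbitrary chart. -/
theorem Form01.dbarAt_eq {b : Form01 E X} {U : Set X} (hU : IsOpen U) (hb : b.IsCk 1 U)
    {φ : OpenPartialHomeomorph X E} (hφ : φ ∈ atlas E X) {y : E} (hy : y ∈ φ.target)
    (hyU : φ.symm y ∈ U) (v w : E) :
    b.dbarAt (φ.symm y) (fderiv ℝ (chartAt E (φ.symm y) ∘ φ.symm) y v)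
      (fderiv ℝ (chartAt E (φ.symm y) ∘ φ.symm) y w) = dbarForm (b.inChart φ) y v w := by
  have hs : φ.symm y ∈ (chartAt E (φ.symm y)).source := mem_chart_source E _
  have hψa : chartAt E (φ.symm y) ∈ atlas E X := chart_mem_atlas E _
  have hd : ∀ {χ : OpenPartialHomeomorph X E}, χ ∈ atlas E X → ∀ {x}, x ∈ χ.target →
      χ.symm x ∈ U → DifferentiableAt ℝ (b.inChart χ) x := by
    intro χ hχ x hx hxU
    exact ((hb χ hχ).contDiffAt ((χ.isOpen_inter_preimage_symm hU).mem_nhds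
      ⟨hx, hxU⟩)).differentiableAt (by simp)
  refine (dbarForm_pullback (φ := chartAt E (φ.symm y) ∘ φ.symm)
    (contDiffAt_real_transition hφ hψa hy hs) ?_ ?_ (hd hφ hy hyU) ?_ v w).symm
  · filter_upwards [eventually_mem_target_source hy hs] with x hx
    exact isHolAt_transition hφ hψa hx.1 hx.2
  · refine hd hψa ((chartAt E (φ.symm y)).map_source hs) ?_
    rwa [Function.comp_apply, (chartAt E (φ.symm y)).left_inv hs]
  · filter_upwards [eventually_mem_target_source hy hs] with x hx w
    exact Form01.inChart_transition hφ hψa hx.1 hx.2 b w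

/-- Forms with equal restrictions to `M`, in a chart. -/
theorem Form01.inChart_eq_of_restrict_eq {M : Set X} {a b : Form01 E X}
    {φ : OpenPartialHomeomorph X E} (hφ : φ ∈ atlas E X) {y : E} (hy : y ∈ φ.target)
    (hyM : φ.symm y ∈ M) (h : a.restrict M ⟨φ.symm y, hyM⟩ = b.restrict M ⟨φ.symm y, hyM⟩) {v : E}
    (hv : (fderiv ℝ (chartAt E (φ.symm y) ∘ φ.symm) y v : E) ∈ holTangent E M (φ.symm y)) :
    a.inChart φ y v = b.inChart φ y v := by
  rw [Form01.inChart_apply hφ hy, Form01.inChart_apply hφ hy]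
  exact DFunLike.congr_fun h ⟨_, hv⟩

theorem Form01.restrict_eq_of_inChart_eq {M : Set X} {a b : Form01 E X}
    {φ : OpenPartialHomeomorph X E} (hφ : φ ∈ atlas E X) {y : E} (hy : y ∈ φ.target)
    (hyM : φ.symm y ∈ M)
    (h : ∀ v, (fderiv ℝ (chartAt E (φ.symm y) ∘ φ.symm) y v : E) ∈ holTangent E M (φ.symm y) →
      a.inChart φ y v = b.inChart φ y v) :
    a.restrict M ⟨φ.symm y, hyM⟩ = b.restrict M ⟨φ.symm y, hyM⟩ := by
  refine ContinuousLinearMap.ext fun ⟨v, hv⟩ => ?_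
  obtain ⟨w, rfl⟩ := exists_fderiv_chartAt_eq hφ hy v
  have := h w hv
  rw [Form01.inChart_apply hφ hy, Form01.inChart_apply hφ hy] at this
  exact this

end Hypersurface

/-! ### Local primitives of α -/

section LocalSolution

universe u

variable {E : Type u} [NormedAddCommGroup E] [NormedSpace ℂ E]
  {X : Type*} [TopologicalSpace X] [ChartedSpace E X] [IsManifold 𝓘(ℂ, E) ω X]

theorem exists_isOpen_of_eventually_chart {E X : Type*} [TopologicalSpace E] [TopologicalSpace X]
    {φ : OpenPartialHomeomorph X E} {P : X} (hP : P ∈ φ.source) {Q : E → Prop}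
    (h : ∀ᶠ y in 𝓝 (φ P), Q y) :
    ∃ U, IsOpen U ∧ P ∈ U ∧ U ⊆ φ.source ∧ ∀ q ∈ U, Q (φ q) := by
  obtain ⟨U, hU, hUo, hPU⟩ := mem_nhds_iff.1
    (((φ.continuousAt hP).eventually h).and (φ.open_source.eventually_mem hP))
  exact ⟨U, hUo, hPU, fun q hq => (hU hq).2, fun q hq => (hU hq).1⟩

theorem Form01.IsCk.contDiffAt {X : Type*} [TopologicalSpace X] [ChartedSpace E X]
    {a : Form01 E X} {k : ℕ} {U : Set X} (ha : a.IsCk k U)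
    (hU : IsOpen U) {φ : OpenPartialHomeomorph X E} (hφ : φ ∈ atlas E X) {y : E}
    (hy : y ∈ φ.target) (hyU : φ.symm y ∈ U) : ContDiffAt ℝ k (a.inChart φ) y :=
  (ha φ hφ).contDiffAt ((φ.isOpen_inter_preimage_symm hU).mem_nhds ⟨hy, hyU⟩)

theorem dbarFun_comp_chart_inChart {u : E → ℂ} {φ : OpenPartialHomeomorph X E} (hφ : φ ∈ atlas E X)
    {y : E} (hy : y ∈ φ.target) (hu : ContDiffAt ℝ (1 : ℕ) u y) :
    (dbarFun E (u ∘ φ)).inChart φ y = dbar u y := by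
  have h1 : ContMDiffAt 𝓘(ℝ, E) 𝓘(ℝ, ℂ) (1 : ℕ) (u ∘ φ) (φ.symm y) :=
    contMDiffAt_comp_chart hφ (φ.map_target hy) (by rwa [φ.right_inv hy])
  rw [dbarFun_inChart hφ hy (h1.mdifferentiableAt (by simp))]
  refine (dbar_congr ?_).self_of_nhds
  filter_upwards [φ.open_target.eventually_mem hy] with x hx
  simp only [Function.comp_apply, φ.right_inv hx]

theorem IsLeviFlatHypersurface.exists_local_solution [FiniteDimensional ℂ E] {m : ℕ} (hm : 2 ≤ m)
    {M : Set X} (hM : IsLeviFlatHypersurface E (m + 1) M) {α : CRForm01 E M} (hα : α.IsCk m)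
    (hclosed : α.IsDbarBClosed) {P : X} (hP : P ∈ M) :
    ∃ (U : Set X) (u : X → ℂ), IsOpen U ∧ P ∈ U ∧ ContMDiffOn 𝓘(ℝ, E) 𝓘(ℝ, ℂ) m u U ∧
      ∀ q : M, (q : X) ∈ U → (dbarFun E u).restrict M q = α q := by
  have : CompleteSpace E := FiniteDimensional.complete ℂ E
  set φ := chartAt E P with hφd
  have hφ : φ ∈ atlas E X := chart_mem_atlas E P
  have hPφ : P ∈ φ.source := mem_chart_source E P
  obtain ⟨r, hr⟩ := hM.exists_chart_defining (by omega : 1 ≤ m) hφ hP hPφ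
  obtain ⟨V, b, hPV, hV, hbk, hbα⟩ := hα P hP
  have hVe : ∀ᶠ y in 𝓝 (φ P), φ.symm y ∈ V := by
    have hc : ContinuousAt φ.symm (φ P) := φ.continuousAt_symm (φ.map_source hPφ)
    exact hc.eventually
      (show ∀ᶠ q in 𝓝 (φ.symm (φ P)), q ∈ V from hV.mem_nhds (by rwa [φ.left_inv hPφ]))
  have hb1 : b.IsCk 1 V := fun χ hχ => (hbk χ hχ).of_le (by exact_mod_cast (by omega : 1 ≤ m))
  have hr0 := hr.self_of_nhds
  have hrP : r (φ P) = 0 := hr0.2.2.1.1 (by rwa [φ.left_inv hPφ])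
  obtain ⟨u, hu, hub⟩ := exists_dbar_eq_on_levi_flat hm hr0.2.1 (hr0.2.2.2 hrP).1
    (hr.mono fun y hy h0 => (hy.2.2.2 h0).2.2)
    (hbk.contDiffAt hV hφ hr0.1 hVe.self_of_nhds) (by
      filter_upwards [hr, hVe] with y hy hyV h0 v w hv hw
      have hyM : φ.symm y ∈ M := hy.2.2.1.2 h0
      have hmem := (hy.2.2.2 h0).2.1
      rw [← Form01.dbarAt_eq hV hb1 hφ hy.1 hyV v w]
      exact hclosed V b ⟨hV, hb1, hbα⟩ _ ⟨hyM, hyV⟩ _ ((hmem v).2 hv) _ ((hmem w).2 hw))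
  obtain ⟨U, hU, hPU, hUφ, hUQ⟩ := exists_isOpen_of_eventually_chart hPφ
    (((hr.and hVe).and hub).and (hu.eventually (by simp)))
  refine ⟨U, u ∘ φ, hU, hPU, fun q hq => ?_, ?_⟩
  · exact (contMDiffAt_comp_chart hφ (hUφ hq) (hUQ q hq).2).contMDiffWithinAt
  · rintro ⟨q, hqM⟩ hq
    change q ∈ U at hq
    obtain ⟨y, hy, rfl⟩ : ∃ y ∈ φ.target, φ.symm y = q :=
      ⟨φ q, φ.map_source (hUφ hq), φ.left_inv (hUφ hq)⟩
    obtain ⟨⟨⟨h1, h2⟩, h3⟩, h4⟩ := hUQ _ hq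
    rw [φ.right_inv hy] at h1 h2 h3 h4
    rw [← hbα ⟨φ.symm y, hqM⟩ h2]
    refine Form01.restrict_eq_of_inChart_eq hφ hy hqM fun v hv => ?_
    have h0 : r y = 0 := h1.2.2.1.1 hqM
    rw [dbarFun_comp_chart_inChart hφ hy (h4.of_le (by exact_mod_cast (by omega : 1 ≤ m)))]
    exact h3 h0 v (((h1.2.2.2 h0).2.1 v).1 hv)

end LocalSolution

/-! ### Gluing ∂̄-exact forms -/

section SmulRight

universe u

variable {E F : Type u} [NormedAddCommGroup E] [NormedSpace ℝ E] [NormedAddCommGroup F]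
  [NormedSpace ℝ F]

theorem contDiffAt_smulRight {n : ℕ} {l : E → E →L[ℝ] ℝ} {d : E → F} {y : E}
    (hl : ContDiffAt ℝ n l y) (hd : ContDiffAt ℝ n d y) :
    ContDiffAt ℝ n (fun x => (l x).smulRight (d x)) y :=
  (contDiffAt_clm_comp (G := F →L[ℝ] E →L[ℝ] F) hl
    (ContinuousLinearMap.smulRightL ℝ E F)).clm_apply hd

theorem FlatBelow.smulRight {k n : ℕ} {l : E → E →L[ℝ] ℝ} {d : E → F} {y : E}
    (h : FlatBelow k d y) (hk : k ≤ n + 1) (hl : ContDiffAt ℝ n l y) (hd : ContDiffAt ℝ n d y) :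
    FlatBelow k (fun x => (l x).smulRight (d x)) y :=
  h.clm_apply (A := fun x => ContinuousLinearMap.smulRightL ℝ E F (l x)) hk
    (contDiffAt_clm_comp (G := F →L[ℝ] E →L[ℝ] F) hl (ContinuousLinearMap.smulRightL ℝ E F)) hd

end SmulRight

section GlueForms

universe u

variable {E : Type u} [NormedAddCommGroup E] [NormedSpace ℂ E] {ι : Type*}

theorem contDiffAt_sum_smul_dbar {n : ℕ} {s : Finset ι} {c : ι → E → ℝ} {v : ι → E → ℂ}
    {A : E → E →L⋆[ℂ] ℂ} {y : E} (hA : A =ᶠ[𝓝 y] fun x => ∑ i ∈ s, c i x • dbar (v i) x)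
    (hc : ∀ i ∈ s, ContDiffAt ℝ (n + 1 : ℕ) (c i) y)
    (hv : ∀ i ∈ s, ContDiffAt ℝ (n + 1 : ℕ) (v i) y) : ContDiffAt ℝ n A y := by
  refine ContDiffAt.congr_of_eventuallyEq ?_ hA
  refine ContDiffAt.sum fun i hi => ?_
  exact ((hc i hi).of_le (by exact_mod_cast n.le_succ)).smul (ContDiffAt.dbar (hv i hi))

theorem sum_smul_dbar_sub {s : Finset ι} {c : ι → E → ℝ} {v : ι → E → ℂ} {A : E → E →L⋆[ℂ] ℂ}
    {y : E} (hA : A =ᶠ[𝓝 y] fun x => ∑ i ∈ s, c i x • dbar (v i) x)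
    (h1 : ∀ᶠ x in 𝓝 y, ∑ i ∈ s, c i x = 1) (w : E → ℂ) :
    (fun x => A x - dbar w x) =ᶠ[𝓝 y] fun x => ∑ i ∈ s, c i x • (dbar (v i) x - dbar w x) := by
  filter_upwards [hA, h1] with x hx hx1
  rw [hx]
  simp only [smul_sub, Finset.sum_sub_distrib]
  rw [← Finset.sum_smul, hx1, one_smul]

theorem flatBelow_sum_smul {k n : ℕ} (hk : k ≤ n + 1) {s : Finset ι} {c : ι → E → ℝ}
    {d : ι → E → E →L⋆[ℂ] ℂ} {y : E} (hc : ∀ i ∈ s, ContDiffAt ℝ n (c i) y)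
    (hd : ∀ i ∈ s, ContDiffAt ℝ n (d i) y) (hflat : ∀ i ∈ s, FlatBelow k (d i) y) :
    FlatBelow k (fun x => ∑ i ∈ s, c i x • d i x) y := by
  refine FlatBelow.sum (n := n) s (fun i hi => ?_) hk fun i hi => (hc i hi).smul (hd i hi)
  exact (hflat i hi).clm_apply (n := n) hk
    (A := fun x => c i x • ContinuousLinearMap.id ℝ (E →L⋆[ℂ] ℂ))
    ((hc i hi).smul contDiffAt_const) (hd i hi)

/-- `∂̄` of a convex combination of `∂̄`-exact forms that agree to high order vanishes to the same
order. -/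
theorem flatBelow_dbarForm_sum_smul_dbar {k n : ℕ} (hk : k ≤ n) (hn : 1 ≤ n) {s : Finset ι}
    {c : ι → E → ℝ} {v : ι → E → ℂ} {A : E → E →L⋆[ℂ] ℂ} {y : E} {w : E → ℂ}
    (hA : A =ᶠ[𝓝 y] fun x => ∑ i ∈ s, c i x • dbar (v i) x)
    (h1 : ∀ᶠ x in 𝓝 y, ∑ i ∈ s, c i x = 1) (hc : ∀ i ∈ s, ContDiffAt ℝ (n + 1 : ℕ) (c i) y)
    (hv : ∀ i ∈ s, ContDiffAt ℝ (n + 1 : ℕ) (v i) y) (hw : ContDiffAt ℝ (n + 1 : ℕ) w y)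
    (hflat : ∀ i ∈ s, FlatBelow k (fun x => dbar (v i) x - dbar w x) y) :
    FlatBelow k (dbarForm A) y := by
  have hsub := sum_smul_dbar_sub hA h1 w
  have h2n : (2 : WithTop ℕ∞) ≤ (n + 1 : ℕ) := by exact_mod_cast (by omega : 2 ≤ n + 1)
  have hn0 : (n : WithTop ℕ∞) ≠ 0 := by exact_mod_cast (by omega : n ≠ 0)
  have hevent : ∀ᶠ x in 𝓝 y, (∀ i ∈ s, ContDiffAt ℝ (n + 1 : ℕ) (c i) x ∧
      ContDiffAt ℝ (n + 1 : ℕ) (v i) x) ∧ ContDiffAt ℝ (n + 1 : ℕ) w x := by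
    refine (((Finset.eventually_all s).2 fun i hi => ?_)).and (hw.eventually (by simp))
    exact ((hc i hi).eventually (by simp)).and ((hv i hi).eventually (by simp))
  -- Since the weights sum to 1, A = ∂̄w + ∑ cᵢ(∂̄vᵢ - ∂̄w). As ∂̄² = 0, only the terms ∂̄cᵢ ∧ (∂̄vᵢ
  -- - ∂̄w) remain.
  have hform : dbarForm A =ᶠ[𝓝 y] fun x => ∑ i ∈ s, antisymmL
      ((fderiv ℝ (c i) x).smulRight (dbar (v i) x - dbar w x)) := by
    filter_upwards [hsub.eventually_nhds, hevent] with x hx hsm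
    have hdd : ∀ {g : E → ℂ}, ContDiffAt ℝ (n + 1 : ℕ) g x →
        HasFDerivAt (dbar g) (fderiv ℝ (dbar g) x) x := fun hg =>
      ((ContDiffAt.dbar hg).differentiableAt hn0).hasFDerivAt
    have hcl : ∀ {g : E → ℂ}, ContDiffAt ℝ (n + 1 : ℕ) g x →
        antisymmL (fderiv ℝ (dbar g) x) = 0 := fun {g} hg => by
      have := dbarForm_dbar (hg.of_le h2n)
      rwa [dbarForm_eq] at this
    have hA' : A =ᶠ[𝓝 x] fun z => dbar w z + ∑ i ∈ s, c i z • (dbar (v i) z - dbar w z) := by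
      filter_upwards [hx] with z hz
      rw [← hz, add_sub_cancel]
    have hder : HasFDerivAt (fun z => dbar w z + ∑ i ∈ s, c i z • (dbar (v i) z - dbar w z))
        (fderiv ℝ (dbar w) x + ∑ i ∈ s, (c i x • (fderiv ℝ (dbar (v i)) x - fderiv ℝ (dbar w) x) +
          (fderiv ℝ (c i) x).smulRight (dbar (v i) x - dbar w x))) x := by
      refine (hdd hsm.2).add (HasFDerivAt.fun_sum fun i hi => ?_)
      exact ((hsm.1 i hi).1.differentiableAt (by simp)).hasFDerivAt.smul
        ((hdd (hsm.1 i hi).2).sub (hdd hsm.2))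
    simp only [dbarForm_eq]
    rw [hA'.fderiv_eq, hder.fderiv, map_add, hcl hsm.2]
    refine (zero_add _).trans ((map_sum (antisymmL (E := E)) _ _).trans ?_)
    refine Finset.sum_congr rfl fun i hi => ?_
    have e1 : antisymmL (c i x • (fderiv ℝ (dbar (v i)) x - fderiv ℝ (dbar w) x)) = 0 := by
      have e2 : antisymmL (fderiv ℝ (dbar (v i)) x - fderiv ℝ (dbar w) x) =
          antisymmL (fderiv ℝ (dbar (v i)) x) - antisymmL (fderiv ℝ (dbar w) x) :=
        map_sub (antisymmL (E := E)) _ _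
      rw [map_smul, e2, hcl hsm.2, hcl (hsm.1 i hi).2]
      exact (congrArg _ (sub_self (0 : E →L⋆[ℂ] E →L⋆[ℂ] ℂ))).trans (smul_zero _)
    rw [map_add, e1]
    exact zero_add (M := E →L⋆[ℂ] E →L⋆[ℂ] ℂ) _
  refine FlatBelow.congr ?_ hform.symm
  have hdn : ∀ i ∈ s, ContDiffAt ℝ n (fun x => dbar (v i) x - dbar w x) y := fun i hi =>
    (ContDiffAt.dbar (hv i hi)).sub (ContDiffAt.dbar hw)
  have hcn : ∀ i ∈ s, ContDiffAt ℝ n (fderiv ℝ (c i)) y := fun i hi =>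
    (hc i hi).fderiv_right (m := n) (by norm_cast)
  have hcd : ∀ i ∈ s, ContDiffAt ℝ n
      (fun x => (fderiv ℝ (c i) x).smulRight (dbar (v i) x - dbar w x)) y := fun i hi =>
    contDiffAt_smulRight (F := E →L⋆[ℂ] ℂ) (hcn i hi) (hdn i hi)
  have hk' : k ≤ n + 1 := hk.trans n.le_succ
  refine FlatBelow.sum (n := n) s (fun i hi => ?_) hk' fun i hi => ?_
  · exact ((hflat i hi).smulRight hk' (hcn i hi) (hdn i hi)).clm_comp (n := n)
      (G := E →L⋆[ℂ] E →L⋆[ℂ] ℂ) antisymmL hk'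
      (hcd i hi)
  · exact contDiffAt_clm_comp (G := E →L⋆[ℂ] E →L⋆[ℂ] ℂ) (hcd i hi) antisymmL

end GlueForms

/-! ### Chart independence of flatness -/

section FlatForms

universe u

variable {E : Type u} [NormedAddCommGroup E] [NormedSpace ℂ E]
  {X : Type*} [TopologicalSpace X] [ChartedSpace E X]

/-- Pull-back of conjugate linear forms by complex linear maps. -/
noncomputable def conjPrecompL (E : Type*) [NormedAddCommGroup E] [NormedSpace ℂ E] :
    (E →L[ℂ] E) →L[ℝ] (E →L⋆[ℂ] ℂ) →L[ℝ] (E →L⋆[ℂ] ℂ) :=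
  LinearMap.mkContinuous₂
    (LinearMap.mk₂ ℝ (fun (T : E →L[ℂ] E) (l : E →L⋆[ℂ] ℂ) => l.comp T)
      (fun T T' l => by ext; simp) (fun c T l => by
        ext w
        simp only [ContinuousLinearMap.comp_apply, smul_apply]
        rw [← Complex.coe_smul, map_smulₛₗ, Complex.conj_ofReal, Complex.coe_smul])
      (fun T l l' => by ext; simp) (fun c T l => by ext; simp)) 1
    (fun T l => by
      rw [one_mul, mul_comm]
      exact l.opNorm_comp_le T)

theorem Form01.inChart_sub (a b : Form01 E X) (φ : OpenPartialHomeomorph X E) (y : E) :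
    (a - b).inChart φ y = a.inChart φ y - b.inChart φ y := rfl

/-- Vanishing to a given order does not depend on the chart. -/
theorem Form01.flatBelow_of_chart [IsManifold 𝓘(ℂ, E) ω X] {D : Form01 E X} {k n : ℕ}
    (hk : k ≤ n + 1) {φ ψ : OpenPartialHomeomorph X E} (hφ : φ ∈ atlas E X) (hψ : ψ ∈ atlas E X)
    {q : X} (hqφ : q ∈ φ.source) (hqψ : q ∈ ψ.source) (hc : ContDiffAt ℝ n (D.inChart φ) (φ q))
    (h : FlatBelow k (D.inChart φ) (φ q)) : FlatBelow k (D.inChart ψ) (ψ q) := by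
  have hy : ψ q ∈ ψ.target := ψ.map_source hqψ
  have hy' : ψ.symm (ψ q) ∈ φ.source := by rwa [ψ.left_inv hqψ]
  have hτ : (φ ∘ ψ.symm) (ψ q) = φ q := by rw [Function.comp_apply, ψ.left_inv hqψ]
  have he : D.inChart ψ =ᶠ[𝓝 (ψ q)] fun y => conjPrecompL E (fderiv ℂ (φ ∘ ψ.symm) y)
      (D.inChart φ ((φ ∘ ψ.symm) y)) := by
    filter_upwards [eventually_mem_target_source hy hy'] with y h
    ext w
    rw [Form01.inChart_transition hψ hφ h.1 h.2, ((contDiffAt_transition hψ hφ h.1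
      h.2).differentiableAt (by simp)).fderiv_restrictScalars ℝ]
    rfl
  have hreal : ContDiffAt ℝ n (φ ∘ ψ.symm) (ψ q) := contDiffAt_real_transition hψ hφ hy hy'
  rw [← hτ] at h hc
  have hfd : ContDiffAt ℝ n (fderiv ℂ (φ ∘ ψ.symm)) (ψ q) :=
    (((contDiffAt_transition hψ hφ hy hy').fderiv_right (m := ω) le_top).restrict_scalars ℝ).of_le
      le_top
  refine FlatBelow.congr ?_ he.symm
  exact (h.comp hk hc hreal).clm_apply (n := n) hk
    (contDiffAt_clm_comp (G := (E →L⋆[ℂ] ℂ) →L[ℝ] (E →L⋆[ℂ] ℂ)) hfd (conjPrecompL E))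
    (hc.comp (ψ q) hreal)

end FlatForms

/-! ### The induction on the order of flatness -/

section Extension

theorem conjPart_zero {E F : Type*} [NormedAddCommGroup E] [NormedSpace ℂ E]
    [NormedAddCommGroup F] [NormedSpace ℂ F] : conjPart (0 : E →L[ℝ] F) = 0 := by
  ext v
  simp [conjPart_apply]

universe u

variable {E : Type u} [NormedAddCommGroup E] [NormedSpace ℂ E]
  {X : Type*} [TopologicalSpace X] [ChartedSpace E X]

/-- `u` solves `∂̄_b u = α` on `M ∩ U`, and `a - ∂̄u` has vanishing derivatives of order `< k` at
the points of `M ∩ U`. -/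
structure IsFlatSolution (n k : ℕ) {M : Set X} (α : CRForm01 E M) (a : Form01 E X) (U : Set X)
    (u : X → ℂ) : Prop where
  isOpen : IsOpen U
  contMDiffOn : ContMDiffOn 𝓘(ℝ, E) 𝓘(ℝ, ℂ) (n + 1 : ℕ) u U
  restrict_eq : ∀ q : M, (q : X) ∈ U → (dbarFun E u).restrict M q = α q
  flatBelow : ∀ q ∈ M, q ∈ U → ∀ φ ∈ atlas E X, q ∈ φ.source →
    FlatBelow k ((a - dbarFun E u).inChart φ) (φ q)

/-- `a` extends `α`, with `∂̄a` vanishing to order `k - 1` along `M`, and is `∂̄`-exact near `M` to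
the same order. -/
structure IsFlatExtension (n k : ℕ) {M : Set X} (α : CRForm01 E M) (a : Form01 E X) : Prop where
  isCk : a.IsCk n Set.univ
  restrict_eq : a.restrict M = α
  flatBelow_dbarForm : ∀ q ∈ M, ∀ φ ∈ atlas E X, q ∈ φ.source →
    FlatBelow k (dbarForm (a.inChart φ)) (φ q)
  exists_solution : ∀ P ∈ M, ∃ U u, P ∈ U ∧ IsFlatSolution n k α a U u

theorem contDiffAt_comp_symm_of_contMDiffOn [IsManifold 𝓘(ℂ, E) ω X] {n : ℕ} {U : Set X}
    (hU : IsOpen U) {u : X → ℂ}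
    (hu : ContMDiffOn 𝓘(ℝ, E) 𝓘(ℝ, ℂ) n u U) {φ : OpenPartialHomeomorph X E} (hφ : φ ∈ atlas E X)
    {q : X} (hqφ : q ∈ φ.source) (hq : q ∈ U) : ContDiffAt ℝ n (u ∘ φ.symm) (φ q) :=
  contDiffAt_comp_symm hφ (φ.map_source hqφ)
    (by rw [φ.left_inv hqφ]; exact (hu q hq).contMDiffAt (hU.mem_nhds hq))

theorem dbarFun_inChart_eventuallyEq [IsManifold 𝓘(ℂ, E) ω X] {n : ℕ} {U : Set X}
    (hU : IsOpen U) {u : X → ℂ}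
    (hu : ContMDiffOn 𝓘(ℝ, E) 𝓘(ℝ, ℂ) (n + 1 : ℕ) u U) {φ : OpenPartialHomeomorph X E}
    (hφ : φ ∈ atlas E X) {q : X} (hqφ : q ∈ φ.source) (hq : q ∈ U) :
    (dbarFun E u).inChart φ =ᶠ[𝓝 (φ q)] dbar (u ∘ φ.symm) := by
  have hc : ContinuousAt φ.symm (φ q) := φ.continuousAt_symm (φ.map_source hqφ)
  filter_upwards [φ.open_target.mem_nhds (φ.map_source hqφ), hc.eventually
    (show ∀ᶠ q in 𝓝 (φ.symm (φ q)), q ∈ U from hU.mem_nhds (by rwa [φ.left_inv hqφ]))] with y hy hyU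
  exact dbarFun_inChart hφ hy (((hu _ hyU).contMDiffAt (hU.mem_nhds hyU)).mdifferentiableAt
    (by simp))

theorem contDiffAt_dbarFun_inChart [IsManifold 𝓘(ℂ, E) ω X] {n : ℕ} {U : Set X}
    (hU : IsOpen U) {u : X → ℂ}
    (hu : ContMDiffOn 𝓘(ℝ, E) 𝓘(ℝ, ℂ) (n + 1 : ℕ) u U) {φ : OpenPartialHomeomorph X E}
    (hφ : φ ∈ atlas E X) {q : X} (hqφ : q ∈ φ.source) (hq : q ∈ U) :
    ContDiffAt ℝ n ((dbarFun E u).inChart φ) (φ q) :=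
  (ContDiffAt.dbar (contDiffAt_comp_symm_of_contMDiffOn hU hu hφ hqφ hq)).congr_of_eventuallyEq
    (dbarFun_inChart_eventuallyEq hU hu hφ hqφ hq)

theorem Form01.IsCk.contDiffAt_univ {a : Form01 E X} {k : ℕ} (ha : a.IsCk k Set.univ)
    {φ : OpenPartialHomeomorph X E} (hφ : φ ∈ atlas E X) {q : X} (hq : q ∈ φ.source) :
    ContDiffAt ℝ k (a.inChart φ) (φ q) :=
  ha.contDiffAt isOpen_univ hφ (φ.map_source hq) trivial

/-- A form obtained by gluing `∂̄`-exact forms by a partition of unity. -/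
theorem exists_glued_form [FiniteDimensional ℂ E] [T2Space X] [SecondCountableTopology X]
    [IsManifold 𝓘(ℂ, E) ω X] {n : ℕ} {U : X → Set X} {u : X → X → ℂ} (hU : ∀ x, IsOpen (U x))
    (hxU : ∀ x, x ∈ U x) :
    ∃ a : Form01 E X, ∀ q, ∃ (s : Finset X) (c : X → X → ℝ), (∀ x ∈ s, q ∈ U x) ∧
      (∀ x, ContMDiff 𝓘(ℝ, E) 𝓘(ℝ, ℝ) (n + 1 : ℕ) (c x)) ∧
      (∀ᶠ p in 𝓝 q, ∑ x ∈ s, c x p = 1) ∧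
      ∀ᶠ p in 𝓝 q, a p = ∑ x ∈ s, c x p • dbarFun E (u x) p := by
  have : FiniteDimensional ℝ E := FiniteDimensional.complexToReal E
  have : IsManifold 𝓘(ℝ, E) ∞ X := isManifold_real
  have : LocallyCompactSpace X := ChartedSpace.locallyCompactSpace E X
  obtain ⟨ρ, hρ⟩ := SmoothPartitionOfUnity.exists_isSubordinate 𝓘(ℝ, E) isClosed_univ U hU
    fun x _ => Set.mem_iUnion.2 ⟨x, hxU x⟩
  refine ⟨fun p => ∑ x ∈ ρ.finsupport p, ρ x p • dbarFun E (u x) p, fun q =>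
    ⟨ρ.fintsupport q, fun x p => ρ x p, fun x hx => ?_, fun x => ?_, ?_, ?_⟩⟩
  · exact hρ x ((ρ.mem_fintsupport_iff q x).1 hx)
  · exact (ρ x).contMDiff.of_le (by exact_mod_cast le_top)
  · filter_upwards [ρ.eventually_finsupport_subset q] with p hp
    exact ρ.sum_finsupport' p trivial hp
  · filter_upwards [ρ.eventually_finsupport_subset q] with p hp
    refine Finset.sum_subset hp fun x _ hx => ?_
    have : ρ x p = 0 := by simpa [ρ.mem_finsupport] using hx
    rw [this]
    exact zero_smul ℝ (dbarFun E (u x) p)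

theorem Form01.inChart_sum_smul {s : Finset X} (c : X → X → ℝ) (b : X → Form01 E X)
    {a : Form01 E X} {φ : OpenPartialHomeomorph X E} {y : E}
    (h : a (φ.symm y) = ∑ x ∈ s, c x (φ.symm y) • b x (φ.symm y)) :
    a.inChart φ y = ∑ x ∈ s, c x (φ.symm y) • (b x).inChart φ y := by
  ext w
  refine (DFunLike.congr_fun h (mfderiv 𝓘(ℂ, E) 𝓘(ℂ, E) φ.symm y w)).trans ?_
  exact (sum_apply _ _ _).trans 
    (sum_apply s (fun x => c x (φ.symm y) • (b x).inChart φ y) w).symm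

/-- The new form is ∑ ρₓ ∂̄uₓ. The old form a serves only as a common reference: each ∂̄uₓ is close
to it along M, hence they are close to one another. -/
theorem IsFlatSolution.exists_isFlatExtension [FiniteDimensional ℂ E] [T2Space X]
    [SecondCountableTopology X] [IsManifold 𝓘(ℂ, E) ω X] {n k : ℕ} (hn : 1 ≤ n) (hk : k ≤ n)
    {M : Set X} (hM : IsClosed M) {α : CRForm01 E M} {a : Form01 E X} (ha : a.IsCk n Set.univ)
    (h : ∀ P ∈ M, ∃ U u, P ∈ U ∧ IsFlatSolution n k α a U u) :
    ∃ a', IsFlatExtension n k α a' := by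
  have h' : ∀ x : X, ∃ U u, x ∈ U ∧ IsFlatSolution n k α a U u := by
    intro x
    by_cases hx : x ∈ M
    · exact h x hx
    -- Off M the zero function will do, all conditions being imposed at points of M.
    · exact ⟨Mᶜ, 0, hx, hM.isOpen_compl, contMDiffOn_const, fun q hq => absurd q.2 hq,
        fun q hq hq' => absurd hq hq'⟩
  choose U u hxU hsol using h'
  obtain ⟨a', ha'⟩ := exists_glued_form (E := E) (X := X) (n := n) (u := u)
    (fun x => (hsol x).isOpen) hxU
  choose s c hsU hc hc1 hca using ha'
  have hev : ∀ {q : X} {φ : OpenPartialHomeomorph X E}, q ∈ φ.source → ∀ {Q : X → Prop},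
      (∀ᶠ p in 𝓝 q, Q p) → ∀ᶠ y in 𝓝 (φ q), Q (φ.symm y) := by
    intro q φ hq Q hQ
    have hcont : ContinuousAt φ.symm (φ q) := φ.continuousAt_symm (φ.map_source hq)
    exact hcont.eventually (by rwa [φ.left_inv hq])
  have hv : ∀ {q : X} {φ : OpenPartialHomeomorph X E}, φ ∈ atlas E X → q ∈ φ.source → ∀ {x},
      q ∈ U x → ContDiffAt ℝ (n + 1 : ℕ) (u x ∘ φ.symm) (φ q) := fun hφ hq x hx =>
    contDiffAt_comp_symm_of_contMDiffOn (hsol x).isOpen (hsol x).contMDiffOn hφ hq hx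
  have hcc : ∀ {q : X} {φ : OpenPartialHomeomorph X E}, φ ∈ atlas E X → q ∈ φ.source → ∀ {x},
      ContDiffAt ℝ (n + 1 : ℕ) (c q x ∘ φ.symm) (φ q) := fun {_ φ} hφ hq x =>
    contDiffAt_comp_symm hφ (φ.map_source hq) ((hc _ x) _)
  have hA : ∀ {q : X} {φ : OpenPartialHomeomorph X E}, φ ∈ atlas E X → q ∈ φ.source →
      a'.inChart φ =ᶠ[𝓝 (φ q)]
        fun y => ∑ x ∈ s q, (c q x ∘ φ.symm) y • dbar (u x ∘ φ.symm) y := by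
    intro q φ hφ hq
    filter_upwards [hev hq (hca q), (Finset.eventually_all (s q)).2 fun x hx =>
      dbarFun_inChart_eventuallyEq (hsol x).isOpen (hsol x).contMDiffOn hφ hq (hsU q x hx)]
      with y hy hy'
    rw [Form01.inChart_sum_smul (c q) (fun x => dbarFun E (u x)) hy]
    exact Finset.sum_congr rfl fun x hx => by rw [hy' x hx]; rfl
  have hpair : ∀ {q : X} {φ : OpenPartialHomeomorph X E}, φ ∈ atlas E X → q ∈ φ.source → q ∈ M →
      ∀ {x z}, q ∈ U x → q ∈ U z →
      FlatBelow k (fun y => dbar (u x ∘ φ.symm) y - dbar (u z ∘ φ.symm) y) (φ q) := by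
    intro q φ hφ hq hqM x z hx hz
    have hcd : ∀ {x}, q ∈ U x → ContDiffAt ℝ n ((a - dbarFun E (u x)).inChart φ) (φ q) :=
      fun {x} hx => (ha.contDiffAt_univ hφ hq).sub (contDiffAt_dbarFun_inChart (hsol x).isOpen
        (hsol x).contMDiffOn hφ hq hx)
    refine (((hsol z).flatBelow q hqM hz φ hφ hq).sub ((hsol x).flatBelow q hqM hx φ hφ hq)
      (n := n) (by omega) (hcd hz) (hcd hx)).congr ?_
    filter_upwards [dbarFun_inChart_eventuallyEq (hsol x).isOpen (hsol x).contMDiffOn hφ hq hx,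
      dbarFun_inChart_eventuallyEq (hsol z).isOpen (hsol z).contMDiffOn hφ hq hz] with y h1 h2
    rw [Form01.inChart_sub, Form01.inChart_sub, h1, h2]
    abel
  refine ⟨a', ⟨?_, ?_, ?_, ?_⟩⟩
  · intro φ hφ y hy
    have hq := φ.map_target hy.1
    have := contDiffAt_sum_smul_dbar (hA hφ hq) (fun x _ => hcc hφ hq)
      (fun x hx => hv hφ hq (hsU _ x hx))
    rw [φ.right_inv hy.1] at this
    exact this.contDiffWithinAt
  · funext q
    have h1 := (hca q).self_of_nhds
    have h2 := (hc1 q).self_of_nhds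
    ext w
    have h3 : ∀ x ∈ s q, dbarFun E (u x) q w = α q w := fun x hx =>
      DFunLike.congr_fun ((hsol x).restrict_eq q (hsU q x hx)) w
    change a' q w = _
    rw [h1, sum_apply]
    refine (Finset.sum_congr rfl fun x hx => (congrArg (c q x q • ·) (h3 x hx))).trans ?_
    rw [← Finset.sum_smul, h2, one_smul]
  · intro q hqM φ hφ hq
    exact flatBelow_dbarForm_sum_smul_dbar hk hn (hA hφ hq) (hev hq (hc1 q))
      (fun x _ => hcc hφ hq) (fun x hx => hv hφ hq (hsU q x hx)) (hv hφ hq (hxU q))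
      fun x hx => hpair hφ hq hqM (hsU q x hx) (hxU q)
  · intro P _
    refine ⟨U P, u P, hxU P, (hsol P).isOpen, (hsol P).contMDiffOn, (hsol P).restrict_eq,
      fun q hqM hqU φ hφ hq => ?_⟩
    have h1 := sum_smul_dbar_sub (hA hφ hq) (hev hq (hc1 q)) (u P ∘ φ.symm)
    have h2 := dbarFun_inChart_eventuallyEq (hsol P).isOpen (hsol P).contMDiffOn hφ hq hqU
    refine FlatBelow.congr (flatBelow_sum_smul (n := n) (by omega)
      (fun x _ => (hcc hφ hq).of_le (by exact_mod_cast n.le_succ)) (fun x hx =>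
      (ContDiffAt.dbar (hv hφ hq (hsU q x hx))).sub (ContDiffAt.dbar (hv hφ hq hqU)))
      fun x hx => hpair hφ hq hqM (hsU q x hx) hqU) (h1.symm.trans ?_)
    filter_upwards [h2] with y hy
    rw [Form01.inChart_sub, hy]

/-- Improving the order of flatness of a local solution. -/
theorem IsFlatExtension.exists_flatter_solution [FiniteDimensional ℂ E]
    [IsManifold 𝓘(ℂ, E) ω X] {n k : ℕ} (hk : k + 1 ≤ n)
    {M : Set X} (hM : IsLeviFlatHypersurface E (n + 1 + 1) M) {α : CRForm01 E M} {a : Form01 E X}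
    (ha : IsFlatExtension n k α a) {P : X} (hP : P ∈ M) :
    ∃ U u, P ∈ U ∧ IsFlatSolution n (k + 1) α a U u := by
  have : CompleteSpace E := FiniteDimensional.complete ℂ E
  obtain ⟨U, u, hPU, hu⟩ := ha.exists_solution P hP
  set φ := chartAt E P with hφd
  have hφ : φ ∈ atlas E X := chart_mem_atlas E P
  have hPφ : P ∈ φ.source := mem_chart_source E P
  obtain ⟨r, hr⟩ := hM.exists_chart_defining (by omega : 1 ≤ n + 1) hφ hP hPφ
  have hUe : ∀ᶠ y in 𝓝 (φ P), φ.symm y ∈ U := by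
    have hc : ContinuousAt φ.symm (φ P) := φ.continuousAt_symm (φ.map_source hPφ)
    exact hc.eventually
      (show ∀ᶠ q in 𝓝 (φ.symm (φ P)), q ∈ U from hu.isOpen.mem_nhds (by rwa [φ.left_inv hPφ]))
  have hr0 := hr.self_of_nhds
  have hrP : r (φ P) = 0 := hr0.2.2.1.1 (by rwa [φ.left_inv hPφ])
  obtain ⟨ν, hν⟩ : ∃ ν, fderiv ℝ r (φ P) ν ≠ 0 := by
    by_contra! h
    exact (hr0.2.2.2 hrP).1 (ContinuousLinearMap.ext h)
  have hνe : ∀ᶠ y in 𝓝 (φ P), fderiv ℝ r y ν ≠ 0 := by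
    have hc : ContinuousAt (fun y => fderiv ℝ r y ν) (φ P) :=
      (hr0.2.1.continuousAt_fderiv (by simp)).clm_apply continuousAt_const
    exact hc.eventually_ne hν
  obtain ⟨Ω, hΩsub, hΩ, hPΩ⟩ := mem_nhds_iff.1 ((hr.and hUe).and hνe)
  set b : E → E →L⋆[ℂ] ℂ := (a - dbarFun E u).inChart φ with hb
  have hex : ∀ y ∈ Ω, φ.symm y ∈ φ.source ∧ φ (φ.symm y) = y := fun y hy =>
    ⟨φ.map_target (hΩsub hy).1.1.1, φ.right_inv (hΩsub hy).1.1.1⟩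
  have hac : ∀ y ∈ Ω, ContDiffAt ℝ n (a.inChart φ) y := fun y hy => by
    simpa only [(hex y hy).2] using ha.isCk.contDiffAt_univ hφ (hex y hy).1
  have huc : ∀ y ∈ Ω, ContDiffAt ℝ (n + 1 : ℕ) (u ∘ φ.symm) y := fun y hy => by
    simpa only [(hex y hy).2] using contDiffAt_comp_symm_of_contMDiffOn hu.isOpen hu.contMDiffOn hφ
      (hex y hy).1 (hΩsub hy).1.2
  have hue : ∀ y ∈ Ω, (dbarFun E u).inChart φ =ᶠ[𝓝 y] dbar (u ∘ φ.symm) := fun y hy => by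
    simpa only [(hex y hy).2] using dbarFun_inChart_eventuallyEq hu.isOpen hu.contMDiffOn hφ
      (hex y hy).1 (hΩsub hy).1.2
  have hbe : ∀ y ∈ Ω, b =ᶠ[𝓝 y] fun x => a.inChart φ x - dbar (u ∘ φ.symm) x := fun y hy => by
    filter_upwards [hue y hy] with x hx
    rw [hb, Form01.inChart_sub, hx]
  have hbc : ∀ y ∈ Ω, ContDiffAt ℝ n b y := fun y hy =>
    ((hac y hy).sub (ContDiffAt.dbar (huc y hy))).congr_of_eventuallyEq (hbe y hy)
  have hMr : ∀ y ∈ Ω, r y = 0 → φ.symm y ∈ M := fun y hy => (hΩsub hy).1.1.2.2.1.2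
  have hflat : ∀ y ∈ Ω, r y = 0 → FlatBelow k b y := fun y hy h0 => by
    simpa only [(hex y hy).2] using
      hu.flatBelow _ (hMr y hy h0) (hΩsub hy).1.2 φ hφ (hex y hy).1
  have hrc : ∀ y ∈ Ω, ContDiffAt ℝ (n + 1 + 1 : ℕ) r y := fun y hy => (hΩsub hy).1.1.2.1
  have hdel : ∀ y ∈ Ω, ∀ v, del (fun x => ((r x : ℝ) : ℂ)) y v = 0 ↔
      fderiv ℝ r y v = 0 ∧ fderiv ℝ r y (Complex.I • v) = 0 := fun y hy v =>
    del_ofReal_eq_zero_iff ((hrc y hy).differentiableAt (by simp)) v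
  -- Near y one has ∂̄b = ∂̄a, because ∂̄² = 0.
  have hclosed : ∀ y ∈ Ω, r y = 0 → FlatBelow k (dbarForm b) y := by
    intro y hy h0
    have h1 := ha.flatBelow_dbarForm _ (hMr y hy h0) φ hφ (hex y hy).1
    rw [(hex y hy).2] at h1
    refine h1.congr ?_
    filter_upwards [hΩ.mem_nhds hy] with x hx
    have hsub := dbarForm_congr (hbe x hx)
    have hn0 : (n : WithTop ℕ∞) ≠ 0 := by exact_mod_cast (by omega : n ≠ 0)
    rw [hsub.self_of_nhds, dbarForm_eq, dbarForm_eq]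
    beta_reduce
    rw [fderiv_fun_sub ((hac x hx).differentiableAt hn0)
      ((ContDiffAt.dbar (huc x hx)).differentiableAt hn0)]
    have e2 : antisymmL (fderiv ℝ (a.inChart φ) x - fderiv ℝ (dbar (u ∘ φ.symm)) x) =
        antisymmL (fderiv ℝ (a.inChart φ) x) - antisymmL (fderiv ℝ (dbar (u ∘ φ.symm)) x) :=
      map_sub (antisymmL (E := E)) _ _
    have e3 : antisymmL (fderiv ℝ (dbar (u ∘ φ.symm)) x) = 0 := by
      have := dbarForm_dbar ((huc x hx).of_le
        (by exact_mod_cast (by omega : 2 ≤ n + 1) : (2 : WithTop ℕ∞) ≤ (n + 1 : ℕ)))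
      rwa [dbarForm_eq] at this
    rw [e2, e3]
    exact (sub_zero (G := E →L⋆[ℂ] E →L⋆[ℂ] ℂ) _).symm
  have hker : ∀ y ∈ Ω, r y = 0 → ∀ v, fderiv ℝ r y v = 0 → fderiv ℝ r y (Complex.I • v) = 0 →
      (pd ν)^[k] b y v = 0 := by
    intro y hy h0 v hv hv'
    -- At order 0 the statement is that a and ∂̄u have the same restriction to M. At higher orders
    -- it follows from closedness.
    rcases Nat.eq_zero_or_pos k with rfl | hkpos
    · have h1 : a.restrict M ⟨φ.symm y, hMr y hy h0⟩ =
          (dbarFun E u).restrict M ⟨φ.symm y, hMr y hy h0⟩ := by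
        rw [ha.restrict_eq]
        exact (hu.restrict_eq ⟨φ.symm y, hMr y hy h0⟩ (hΩsub hy).1.2).symm
      have h2 := Form01.inChart_eq_of_restrict_eq hφ (hΩsub hy).1.1.1 (hMr y hy h0) h1
        ((((hΩsub hy).1.1.2.2.2 h0).2.1 v).2 ((hdel y hy v).2 ⟨hv, hv'⟩))
      exact sub_eq_zero.2 h2
    · obtain ⟨j, rfl⟩ : ∃ j, k = j + 1 := ⟨k - 1, by omega⟩
      exact pd_iterate_apply_eq_zero_of_dbarForm (n := n) (by omega) hΩ
        (fun x hx => (hrc x hx).of_le (by exact_mod_cast (by omega : 1 ≤ n + 1 + 1)))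
        (fun x hx => (hΩsub hx).2) hbc hflat hclosed hy h0 hv hv'
  obtain ⟨e, he, hee⟩ := exists_dbar_sub_flat hk hΩ
    (fun x hx => (hrc x hx).of_le (by exact_mod_cast (n + 1).le_succ))
    (fun x hx => (hΩsub hx).2) hbc hflat hker hPΩ
  obtain ⟨V, hV, hPV, hVφ, hVQ⟩ := exists_isOpen_of_eventually_chart hPφ
    (hee.and (hΩ.eventually_mem hPΩ))
  have hVU : V ⊆ U := fun q hq => by
    simpa only [φ.left_inv (hVφ hq)] using (hΩsub (hVQ q hq).2).1.2
  have hsm : ContMDiffOn 𝓘(ℝ, E) 𝓘(ℝ, ℂ) (n + 1 : ℕ) (u + e ∘ φ) V :=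
    (hu.contMDiffOn.mono hVU).add fun q hq =>
      (contMDiffAt_comp_chart hφ (hVφ hq) he.contDiffAt).contMDiffWithinAt
  have hflat' : ∀ q ∈ M, q ∈ V →
      FlatBelow (k + 1) ((a - dbarFun E (u + e ∘ φ)).inChart φ) (φ q) := by
    intro q hqM hqV
    obtain ⟨hq1, hqΩ⟩ := hVQ q hqV
    have h0 : r (φ q) = 0 :=
      (hΩsub hqΩ).1.1.2.2.1.1 (by rwa [φ.left_inv (hVφ hqV)])
    refine (hq1 h0).2.congr ?_
    filter_upwards [dbarFun_inChart_eventuallyEq hV hsm hφ (hVφ hqV) hqV, hbe _ hqΩ,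
      hΩ.mem_nhds hqΩ, φ.open_target.mem_nhds (φ.map_source (hVφ hqV))] with x hx hx' hxΩ hxt
    have hcongr : (u + e ∘ φ) ∘ φ.symm =ᶠ[𝓝 x] fun z => (u ∘ φ.symm) z + e z := by
      filter_upwards [φ.open_target.mem_nhds hxt] with z hz
      simp only [Function.comp_apply, Pi.add_apply, φ.right_inv hz]
    rw [Form01.inChart_sub, hx, (dbar_congr hcongr).self_of_nhds, hx', dbar_eq, dbar_eq, dbar_eq]
    beta_reduce
    rw [fderiv_fun_add ((huc x hxΩ).differentiableAt (by simp))
        (he.contDiffAt.differentiableAt (by simp)), map_add]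
    exact (sub_add_eq_sub_sub (α := E →L⋆[ℂ] ℂ) _ _ _).symm
  refine ⟨V, u + e ∘ φ, hPV, hV, hsm, ?_, ?_⟩
  · rintro ⟨q, hqM⟩ hq
    change q ∈ V at hq
    rw [← ha.restrict_eq]
    -- Flatness below k + 1 ≥ 1 includes equality of values, so ∂̄ of the corrected function equals
    -- a on M and still restricts to α.
    have h0 := (flatBelow_succ.1 (hflat' q hqM hq)).1
    rw [Form01.inChart_sub, sub_eq_zero] at h0
    obtain ⟨y, hy, rfl⟩ : ∃ y ∈ φ.target, φ.symm y = q :=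
      ⟨φ q, φ.map_source (hVφ hq), φ.left_inv (hVφ hq)⟩
    rw [φ.right_inv hy] at h0
    exact (Form01.restrict_eq_of_inChart_eq hφ hy hqM fun v _ => by rw [h0]).symm
  · intro q hqM hqV ψ hψ hqψ
    exact Form01.flatBelow_of_chart (n := n) (by omega) hφ hψ (hVφ hqV) hqψ
      ((ha.isCk.contDiffAt_univ hφ (hVφ hqV)).sub
        (contDiffAt_dbarFun_inChart hV hsm hφ (hVφ hqV) hqV)) (hflat' q hqM hqV)

/-- Each step improves the local solutions relative to the current form and then reglues. The
induction starts with the zero form, for which any local primitives of α qualify. -/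
theorem IsLeviFlatHypersurface.exists_isFlatExtension [FiniteDimensional ℂ E] [T2Space X]
    [SecondCountableTopology X] [IsManifold 𝓘(ℂ, E) ω X] {n : ℕ} (hn : 1 ≤ n)
    {M : Set X} (hM : IsLeviFlatHypersurface E (n + 1 + 1) M) {α : CRForm01 E M}
    (hα : α.IsCk (n + 1)) (hclosed : α.IsDbarBClosed) {k : ℕ} (hk : k ≤ n) :
    ∃ a, IsFlatExtension n k α a := by
  induction k with
  | zero =>
    have h0 : (0 : Form01 E X).IsCk n Set.univ := fun φ _ =>
      contDiffOn_const (c := (0 : E →L⋆[ℂ] ℂ)) |>.congr fun y _ => by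
        ext w
        rfl
    refine IsFlatSolution.exists_isFlatExtension hn hk hM.isClosed h0 fun P hP => ?_
    obtain ⟨U, u, hU, hPU, hu, hres⟩ := hM.exists_local_solution (by omega) hα hclosed hP
    exact ⟨U, u, hPU, hU, hu, hres, fun q _ _ φ _ _ => flatBelow_zero _ _⟩
  | succ k ih =>
    obtain ⟨a, ha⟩ := ih (by omega)
    exact IsFlatSolution.exists_isFlatExtension hn hk hM.isClosed ha.isCk fun P hP =>
      ha.exists_flatter_solution hk hM hP

end Extension

end CRGeom

theorem lemma5p2 {E : Type*} [NormedAddCommGroup E] [NormedSpace ℂ E] [FiniteDimensional ℂ E]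
    {X : Type*} [TopologicalSpace X] [T2Space X] [SecondCountableTopology X]
    [ChartedSpace E X] [IsManifold 𝓘(ℂ, E) ω X]
    (m : ℕ) (hm : 2 ≤ m) (M : Set X) (hM : CRGeom.IsLeviFlatHypersurface E (m + 1) M)
    (α : CRGeom.CRForm01 E M) (hα : α.IsCk m) (hclosed : α.IsDbarBClosed) :
    ∃ (α' : CRGeom.Form01 E X) (H : M → ℂ),
      α'.IsCk (m - 1) Set.univ ∧
      CRGeom.IsCkOn E m H ∧
      α'.restrict M = α + CRGeom.dbarB E H ∧
      (∀ p ∈ M, α'.DbarVanishesAt (m - 2) p) ∧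
      (∀ p ∈ M, ∃ (U : Set X) (h : X → ℂ), IsOpen U ∧ p ∈ U ∧
        ContMDiffOn 𝓘(ℝ, E) 𝓘(ℝ, ℂ) m h U ∧
        ∀ q ∈ M ∩ U, (α' - CRGeom.dbarFun E h).VanishesAt (m - 2) q) := by
  obtain ⟨n, rfl⟩ : ∃ n, m = n + 1 := ⟨m - 1, by omega⟩
  obtain ⟨a, ha⟩ := hM.exists_isFlatExtension (by omega : 1 ≤ n) hα hclosed le_rfl
  have hext : ∀ k : ℕ, CRGeom.IsExtension E k (0 : M → ℂ) Set.univ 0 := fun k =>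
    ⟨isOpen_univ, contMDiffOn_const, fun _ _ => rfl⟩
  -- Flatness below n is vanishing to order n - 1 = m - 2; n ≥ 1 keeps the truncated subtraction
  -- honest.
  have hlt : ∀ j ≤ n + 1 - 2, j < n := fun j hj => by omega
  -- The glued form restricts to α exactly, so H = 0 suffices.
  refine ⟨a, 0, ha.isCk, fun p _ => ⟨Set.univ, 0, trivial, hext _⟩, ?_, fun p hp φ hφ hpφ j hj =>
    ha.flatBelow_dbarForm p hp φ hφ hpφ j (hlt j hj), fun p hp => ?_⟩
  · have h0 : CRGeom.dbarB E (0 : M → ℂ) = 0 := by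
      funext p
      rw [CRGeom.dbarB_eq p (Set.mem_univ _) (hext 1)]
      have hd : mfderiv 𝓘(ℝ, E) 𝓘(ℝ, ℂ) (0 : X → ℂ) (p : X) = 0 := mfderiv_const
      ext w
      change CRGeom.conjPart (E := E) (F := ℂ) (mfderiv 𝓘(ℝ, E) 𝓘(ℝ, ℂ) (0 : X → ℂ) (p : X)) w.1 = 0
      rw [hd]
      exact DFunLike.congr_fun (CRGeom.conjPart_zero (E := E) (F := ℂ)) w.1
    rw [ha.restrict_eq, h0, add_zero]
  · obtain ⟨U, u, hpU, hu⟩ := ha.exists_solution p hp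
    exact ⟨U, u, hu.isOpen, hpU, hu.contMDiffOn, fun q hq φ hφ hqφ j hj =>
      hu.flatBelow q hq.1 hq.2 φ hφ hqφ j (hlt j hj)⟩
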